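/- Let $K$ and $G$ be (finite-dimensional, real) Lie groups and let $(K,H,\sigma)$ be a symmetric space: $H\subset K$ is a Lie subgroup (an embedded submanifold), $\sigma:K\to K$ is an involutive Lie group automorphism, and $K_\sigma^e\subseteq H\subseteq K_\sigma$, where $K_\sigma$ is the subgroup of fixed points of $\sigma$ and $K_\sigma^e$ its identity component. Write $\mathfrak k=\mathfrak h\oplus\mathfrak m$ for the decomposition of the Lie algebra of $K$ into the $+1$- and $-1$-eigenspaces of $T_e\sigma$; $\mathfrak h$ is the Lie algebra of $H$. Let $\lambda:H\to G$ be a Lie group homomorphism and let $\pi:P_\lambda=K\times_H G\to K/H$, $\pi([k,g])=kH$, be the associated homogeneous principal $G$-bundle, the quotient of $K\times G$ by the right action $(k,g)\cdot h=(kh,\lambda(h)^{-1}g)$ of $H$, with the left action $k'\cdot[k,g]=[k'k,g]$ of $K$ and the right action $[k,g]\cdot g'=[k,gg']$ of $G$. The quotients $K/H$ and $P_\lambda$ carry the smooth structures for which the quotient maps from $K$ and $K\times G$ are submersions. Let $K/H$ be equipped with a $K$-invariant Riemannian metric, and let $n=\dim K/H$. Then there is exactly one principal connection $\omega\in\Omega^1(P_\lambda;\mathfrak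 g)$ that is $K$-invariant and satisfies $\omega_{p_o}(\xi_{P_\lambda})=\mathbf W(\xi)$ for all $\xi\in\mathfrak k$. Here $p_o=[e,e]$, $\xi_{P_\lambda}$ is the vector field induced on $P_\lambda$ by the left $K$-action, and $\mathbf W:\mathfrak k\to\mathfrak g$ is the linear map with $\mathbf W|_{\mathfrak h}=T_e\lambda$ and $\mathbf W|_{\mathfrak m}=0$. This $\omega$ is called the canonical connection. The canonical connection is a Yang–Mills connection: $$\delta_\omega\Omega^\omega=0 .$$ Here $D^\omega\varphi=d\varphi\circ\mathrm{Hor}$ (the exterior differential evaluated on the horizontal parts of the arguments), $\Omega^\omega=D^\omega\omega$ is the curvature, and $\delta_\omega\varphi=-(-1)^{n(q+1)}*D^\omega*\varphi$ for horizontal $G$-equivariant $\mathfrak g$-valued $q$-forms $\varphi$ on $P_\lambda$ (with $\delta_\omega\varphi=0$ for $q>n$). The Hodge operator $*$ is defined through the identification of these forms with the forms on $K/H$ with values in the adjoint bundle, by the metric and a Riemannian volume form. As $\delta_\omega$ is local and does not depend on the orientation, volume forms of open subsets of $K/H$ are used, so that $K/H$ need not be orientable. -/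

import Mathlib

open scoped Manifold ContDiff Topology

noncomputable section

namespace YangMills

/-! ### Vector-valued differential forms on manifolds -/

section Forms

variable {E E' F : Type*} [NormedAddCommGroup E] [NormedSpace ℝ E]
  [NormedAddCommGroup E'] [NormedSpace ℝ E'] [NormedAddCommGroup F] [NormedSpace ℝ F]
  {M N : Type*} [TopologicalSpace M] [ChartedSpace E M] [TopologicalSpace N] [ChartedSpace E' N]
  {r s n : ℕ}

/-- `F`-valued `r`-forms on the manifold `M` modelled on `E` (without regularity). -/
abbrev DForm (E : Type*) [NormedAddCommGroup E] [NormedSpace ℝ E] (M : Type*)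
    [TopologicalSpace M] [ChartedSpace E M] (r : ℕ) (F : Type*) [NormedAddCommGroup F]
    [NormedSpace ℝ F] : Type _ :=
  ∀ x : M, TangentSpace 𝓘(ℝ, E) x [⋀^Fin r]→L[ℝ] F

/-- The pull-back `f^* φ`. -/
def DForm.pullback (f : N → M) (φ : DForm E M r F) : DForm E' N r F := fun x =>
  (φ (f x)).compContinuousLinearMap (mfderiv 𝓘(ℝ, E') 𝓘(ℝ, E) f x)

/-- The expression of a form in the preferred chart at `x₀` (meaningful on the chart's target). -/
def DForm.inChart (φ : DForm E M r F) (x₀ : M) : E → E [⋀^Fin r]→L[ℝ] F := fun y =>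
  (φ ((chartAt E x₀).symm y)).compContinuousLinearMap
    (mfderiv 𝓘(ℝ, E) 𝓘(ℝ, E) (chartAt E x₀).symm y)

/-- Smoothness of a form on an open set `U`. -/
def DForm.SmoothOn (φ : DForm E M r F) (U : Set M) : Prop :=
  ∀ x₀ : M, ContDiffOn ℝ ∞ (φ.inChart x₀) ((chartAt E x₀).target ∩ (chartAt E x₀).symm ⁻¹' U)

/-- The exterior derivative, computed in the preferred chart at each point. -/
def DForm.extDer (φ : DForm E M r F) : DForm E M (r + 1) F := fun x =>
  (extDeriv (φ.inChart x) (chartAt E x x)).compContinuousLinearMap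
    (mfderiv 𝓘(ℝ, E) 𝓘(ℝ, E) (chartAt E x) x)

end Forms

/-! ### The Hodge operator of a Euclidean vector space -/

section Hodge

theorem append_update_right {V : Type*} {r s : ℕ} (v : Fin r → V) (w : Fin s → V) (i : Fin s) (z : V) :
    Fin.append v (Function.update w i z) =
      Function.update (Fin.append v w) (Fin.natAdd r i) z := by
  ext j
  refine Fin.addCases (fun a => ?_) (fun a => ?_) j
  · rw [Fin.append_left, Function.update_of_ne, Fin.append_left]
    intro hc
    have := congrArg Fin.val hc
    simp at this
    omega
  · rw [Fin.append_right]
    by_cases ha : a = i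
    · subst ha; simp
    · rw [Function.update_of_ne ha, Function.update_of_ne, Fin.append_right]
      intro hc
      exact ha (Fin.natAdd_injective _ _ hc)

variable {V F : Type*} [AddCommGroup V] [Module ℝ V] [TopologicalSpace V]
  [NormedAddCommGroup F] [NormedSpace ℝ F] {r s n : ℕ}

/-- The form `w ↦ μ (v₁, …, v_r, w₁, …, w_s)`. -/
def fillFirst (h : r + s = n) (μ : V [⋀^Fin n]→L[ℝ] ℝ) (v : Fin r → V) :
    V [⋀^Fin s]→L[ℝ] ℝ where
  toFun w := μ (Fin.append v w ∘ Fin.cast h.symm)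
  map_update_add' := by
    subst h
    intro inst w i x y
    obtain rfl : inst = instDecidableEqFin s := Subsingleton.elim _ _
    simp only [Fin.cast_refl, Function.comp_id, append_update_right]
    exact μ.map_update_add _ _ x y
  map_update_smul' := by
    subst h
    intro inst w i c x
    obtain rfl : inst = instDecidableEqFin s := Subsingleton.elim _ _
    simp only [Fin.cast_refl, Function.comp_id, append_update_right]
    exact μ.map_update_smul _ _ c x
  cont := by
    subst h
    refine μ.cont.comp (continuous_pi fun j => ?_)
    refine Fin.addCases (fun a => ?_) (fun a => ?_) j
    · simpa using continuous_const
    · simpa using continuous_apply a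
  map_eq_zero_of_eq' := by
    subst h
    intro w i j hw hij
    refine μ.map_eq_zero_of_eq _ (i := Fin.natAdd r i) (j := Fin.natAdd r j) ?_ ?_
    · simpa using hw
    · exact fun hc => hij (Fin.natAdd_injective _ _ hc)

/-- The Hodge operator from `r`-forms to `s`-forms on `V`, `r + s = n = dim V`, for the scalar
product `B` and the volume form `μ`: in a basis `b` with inverse Gram matrix `(B^{ij})`,
`(*φ)(w) = (1/r!) ∑_{I,J} B^{i₁j₁} ⋯ B^{i_r j_r} μ(b_{i₁}, …, b_{i_r}, w) φ(b_{j₁}, …, b_{j_r})`.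
This does not depend on the basis. -/
def hodge [FiniteDimensional ℝ V] (B : V →L[ℝ] V →L[ℝ] ℝ) (h : r + s = n)
    (μ : V [⋀^Fin n]→L[ℝ] ℝ) (φ : V [⋀^Fin r]→L[ℝ] F) : V [⋀^Fin s]→L[ℝ] F :=
  let b := Module.finBasis ℝ V
  let Binv : Matrix _ _ ℝ := (Matrix.of fun i j => B (b i) (b j))⁻¹
  ((r.factorial : ℝ)⁻¹) • ∑ I : Fin r → Fin (Module.finrank ℝ V),
    ∑ J : Fin r → Fin (Module.finrank ℝ V),
      (∏ k, Binv (I k) (J k)) • (fillFirst h μ (b ∘ I)).smulRight (φ (b ∘ J))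

end Hodge

/-! ### Principal connections, curvature and the Yang–Mills equation

`G` is a Lie group acting on the right of the manifold `P` by `R`, with orbits the fibres of
`π : P → M`. The Lie algebra of `G` is the tangent space `T_1 G`, which is the model space `E_G`. -/

section Connections

variable {E_P E_G E_M : Type*} [NormedAddCommGroup E_P] [NormedSpace ℝ E_P]
  [NormedAddCommGroup E_G] [NormedSpace ℝ E_G] [NormedAddCommGroup E_M] [NormedSpace ℝ E_M]
  {P G M : Type*} [TopologicalSpace P] [ChartedSpace E_P P]
  [TopologicalSpace G] [ChartedSpace E_G G] [Group G]
  [TopologicalSpace M] [ChartedSpace E_M M] {r s n : ℕ}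

/-- `Ad_g`, the derivative at `1` of `x ↦ g x g⁻¹`. -/
def Ad (g : G) : E_G →L[ℝ] E_G :=
  mfderiv 𝓘(ℝ, E_G) 𝓘(ℝ, E_G) (fun x : G => g * x * g⁻¹) 1

/-- `η ↦ η_P(p)`, the infinitesimal right action: the derivative at `1` of `g ↦ p · g`. -/
def fund (R : P → G → P) (p : P) : E_G →L[ℝ] TangentSpace 𝓘(ℝ, E_P) p :=
  mfderiv 𝓘(ℝ, E_G) 𝓘(ℝ, E_P) (fun g : G => R p g) 1

/-- The linear map `T_p P → 𝔤` underlying a `𝔤`-valued `1`-form. -/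
def lin (A : DForm E_P P 1 E_G) (p : P) : TangentSpace 𝓘(ℝ, E_P) p →L[ℝ] E_G :=
  (ContinuousAlternatingMap.ofSubsingleton ℝ (TangentSpace 𝓘(ℝ, E_P) p) E_G (0 : Fin 1)).symm (A p)

/-- Principal connections: smooth `𝔤`-valued `1`-forms with `R_g^* A = Ad_{g⁻¹} A` and
`A(η_P) = η`. -/
structure IsPrincipalConnection (R : P → G → P) (A : DForm E_P P 1 E_G) : Prop where
  smooth : A.SmoothOn Set.univ
  equivariant : ∀ (g : G) (p : P),
    DForm.pullback (fun p => R p g) A p = (Ad g⁻¹).compContinuousAlternatingMap (A p)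
  fund : ∀ (p : P) (η : E_G), lin A p (fund R p η) = η

/-- The projection `X ↦ X^H = X - (A(X))_P` of `T_p P` onto `ker A_p` along the vertical space. -/
def horProj (R : P → G → P) (A : DForm E_P P 1 E_G) (p : P) :
    TangentSpace 𝓘(ℝ, E_P) p →L[ℝ] TangentSpace 𝓘(ℝ, E_P) p :=
  ContinuousLinearMap.id ℝ _ - (fund R p).comp (lin A p)

/-- The covariant derivative `D^A φ = dφ ∘ Hor`. -/
def covDeriv (R : P → G → P) (A : DForm E_P P 1 E_G) (φ : DForm E_P P r E_G) :
    DForm E_P P (r + 1) E_G :=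
  fun p => (φ.extDer p).compContinuousLinearMap (horProj R A p)

/-- The curvature `Ω^A = D^A A`. -/
def curvature (R : P → G → P) (A : DForm E_P P 1 E_G) : DForm E_P P 2 E_G :=
  covDeriv R A A

/-- The horizontal lift `Γ_p : T_{π(p)} M → ker A_p`, i.e. `Y ↦ X` with `dπ(X) = Y`, `A(X) = 0`
(for a principal connection, `(dπ, A) : T_p P → T_{π(p)} M × 𝔤` is invertible). -/
def horLift (π : P → M) (A : DForm E_P P 1 E_G) (p : P) :
    TangentSpace 𝓘(ℝ, E_M) (π p) →L[ℝ] TangentSpace 𝓘(ℝ, E_P) p :=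
  (((mfderiv 𝓘(ℝ, E_P) 𝓘(ℝ, E_M) π p).prod (lin A p)).inverse).comp
    (ContinuousLinearMap.inl ℝ (TangentSpace 𝓘(ℝ, E_M) (π p)) E_G)

variable [IsManifold 𝓘(ℝ, E_M) ∞ M]

/-- Smooth Riemannian metrics on `M`. -/
abbrev Metric (E_M : Type*) [NormedAddCommGroup E_M] [NormedSpace ℝ E_M] (M : Type*)
    [TopologicalSpace M] [ChartedSpace E_M M] [IsManifold 𝓘(ℝ, E_M) ∞ M] : Type _ :=
  Bundle.ContMDiffRiemannianMetric 𝓘(ℝ, E_M) ∞ E_M (fun x : M => TangentSpace 𝓘(ℝ, E_M) x)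

/-- `μ` is on `U` a Riemannian volume form (for one of the orientations): it is smooth and takes
the values `±1` on orthonormal frames. -/
def IsVolumeForm (g : Metric E_M M) (U : Set M) (μ : DForm E_M M n ℝ) : Prop :=
  μ.SmoothOn U ∧ ∀ x ∈ U, ∀ e : Fin n → TangentSpace 𝓘(ℝ, E_M) x,
    (∀ i j, g.inner x (e i) (e j) = if i = j then 1 else 0) → |μ x e| = 1

variable [FiniteDimensional ℝ E_M]

/-- The Hodge operator on horizontal equivariant forms on `P`, through their identification with
forms on `M` with values in the adjoint bundle: at `p` the horizontal form is carried to
`T_{π(p)} M` by the horizontal lift, and `*` of it is carried back by `dπ`. -/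
def hodgeStar (π : P → M) (A : DForm E_P P 1 E_G) (g : Metric E_M M) (μ : DForm E_M M n ℝ)
    (h : r + s = n) (φ : DForm E_P P r E_G) : DForm E_P P s E_G := fun p =>
  haveI : FiniteDimensional ℝ (TangentSpace 𝓘(ℝ, E_M) (π p)) :=
    inferInstanceAs (FiniteDimensional ℝ E_M)
  (hodge (g.inner (π p)) h (μ (π p))
    ((φ p).compContinuousLinearMap (horLift π A p))).compContinuousLinearMap
      (mfderiv 𝓘(ℝ, E_P) 𝓘(ℝ, E_M) π p)

/-- The covariant codifferential `δ_A φ = -(-1)^{n(q+1)} * D^A * φ` on `q`-forms, `q = r + 1`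
(zero if `q > n`, where horizontal `q`-forms vanish). -/
def codiff (π : P → M) (R : P → G → P) (A : DForm E_P P 1 E_G) (g : Metric E_M M)
    (μ : DForm E_M M n ℝ) (φ : DForm E_P P (r + 1) E_G) : DForm E_P P r E_G :=
  if h : r + 1 ≤ n then
    (-(-1 : ℝ) ^ (n * ((r + 1) + 1))) •
      hodgeStar π A g μ (show (n - (r + 1) + 1) + r = n by omega)
        (covDeriv R A (hodgeStar π A g μ (show (r + 1) + (n - (r + 1)) = n by omega) φ))
  else 0

/-- Yang–Mills connections: `δ_A Ω^A = 0`. The codifferential is a local operator which does not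
depend on the orientation, so it is computed with the Riemannian volume forms of open subsets of
`M`, and `M` need not be orientable; if `M` is oriented, `U = M` is allowed. -/
def IsYangMills (π : P → M) (R : P → G → P) (g : Metric E_M M) (A : DForm E_P P 1 E_G) : Prop :=
  ∀ (U : Set M) (μ : DForm E_M M (Module.finrank ℝ E_M) ℝ), IsOpen U → IsVolumeForm g U μ →
    ∀ p : P, π p ∈ U → codiff π R A g μ (curvature R A) p = 0

end Connections

/-! ### Symmetric spaces -/

section Symmetric

variable {E_K : Type*} [NormedAddCommGroup E_K] [NormedSpace ℝ E_K]
  {K : Type*} [TopologicalSpace K] [ChartedSpace E_K K] [Group K]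

/-- The triple `(K, H, σ)` is a symmetric space: `σ` is an involutive automorphism of the Lie group
`K` and `K_σ^e ⊆ H ⊆ K_σ`, where `K_σ` is the fixed subgroup of `σ` and `K_σ^e` its identity
component. -/
structure IsSymmetricSpace (H : Subgroup K) (σ : K ≃* K) : Prop where
  smooth : ContMDiff 𝓘(ℝ, E_K) 𝓘(ℝ, E_K) ∞ σ
  involutive : ∀ k, σ (σ k) = k
  identityComponent_subset : connectedComponentIn {k : K | σ k = k} 1 ⊆ (H : Set K)
  fixed : ∀ k ∈ H, σ k = k

/-- A Riemannian metric on `K/H` is `K`-invariant. -/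
def IsInvariantMetric {E_M : Type*} [NormedAddCommGroup E_M] [NormedSpace ℝ E_M] {H : Subgroup K}
    [ChartedSpace E_M (K ⧸ H)] [IsManifold 𝓘(ℝ, E_M) ∞ (K ⧸ H)] (g : Metric E_M (K ⧸ H)) : Prop :=
  ∀ (k : K) (x : K ⧸ H) (v w : TangentSpace 𝓘(ℝ, E_M) x),
    g.inner (k • x) (mfderiv 𝓘(ℝ, E_M) 𝓘(ℝ, E_M) (fun y : K ⧸ H => k • y) x v)
      (mfderiv 𝓘(ℝ, E_M) 𝓘(ℝ, E_M) (fun y : K ⧸ H => k • y) x w) = g.inner x v w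

end Symmetric

/-! ### Homogeneous principal bundles `P_λ = K ×_H G` -/

section Homogeneous

variable {K G : Type*} [Group K] [Group G] (H : Subgroup K) (lam : H →* G)

/-- The orbit relation of the right action `(k, g) · h = (k h, λ(h)⁻¹ g)` of `H` on `K × G`. -/
def bundleSetoid : Setoid (K × G) where
  r a b := ∃ h : H, b = (a.1 * (h : K), (lam h)⁻¹ * a.2)
  iseqv :=
    { refl := fun a => ⟨1, by simp⟩
      symm := by
        rintro a b ⟨h, rfl⟩
        exact ⟨h⁻¹, by simp⟩
      trans := by
        rintro a b c ⟨h, rfl⟩ ⟨h', rfl⟩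
        exact ⟨h * h', by simp [mul_assoc]⟩ }

/-- `P_λ = K ×_H G`. -/
def HomBundle : Type _ := Quotient (bundleSetoid H lam)

namespace HomBundle

instance [TopologicalSpace K] [TopologicalSpace G] : TopologicalSpace (HomBundle H lam) :=
  inferInstanceAs (TopologicalSpace (Quotient (bundleSetoid H lam)))

/-- `(k, g) ↦ [k, g]`. -/
def mk (a : K × G) : HomBundle H lam := Quotient.mk (bundleSetoid H lam) a

/-- `[k, g] ↦ k H`. -/
def proj (p : HomBundle H lam) : K ⧸ H :=
  Quotient.lift (fun a : K × G => (a.1 : K ⧸ H))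
    (by
      rintro a b ⟨h, rfl⟩
      simp) p

/-- The left action `k' · [k, g] = [k' k, g]`. -/
def leftAct (k : K) (p : HomBundle H lam) : HomBundle H lam :=
  Quotient.map (sa := bundleSetoid H lam) (sb := bundleSetoid H lam)
    (fun a : K × G => (k * a.1, a.2))
    (by
      rintro a b ⟨h, rfl⟩
      exact ⟨h, by simp [mul_assoc]⟩) p

/-- The right action `[k, g] · g' = [k, g g']`. -/
def rightAct (p : HomBundle H lam) (g : G) : HomBundle H lam :=
  Quotient.map (sa := bundleSetoid H lam) (sb := bundleSetoid H lam)
    (fun a : K × G => (a.1, a.2 * g))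
    (by
      rintro a b ⟨h, rfl⟩
      exact ⟨h, by simp [mul_assoc]⟩) p

end HomBundle

variable {H lam}
variable {E_K E_H E_G E_P : Type*} [NormedAddCommGroup E_K] [NormedSpace ℝ E_K]
  [NormedAddCommGroup E_H] [NormedSpace ℝ E_H] [NormedAddCommGroup E_G] [NormedSpace ℝ E_G]
  [NormedAddCommGroup E_P] [NormedSpace ℝ E_P]
  [TopologicalSpace K] [ChartedSpace E_K K] [TopologicalSpace G] [ChartedSpace E_G G]
  [ChartedSpace E_H H] [ChartedSpace E_P (HomBundle H lam)]

/-- The Wang map `W : 𝔨 → 𝔤` of the canonical connection: `W = T_e λ` on `𝔥` (the image of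
`T_1 H` in `𝔨 = T_1 K`), and `W = 0` on the `(-1)`-eigenspace `𝔪` of `T_e σ`. -/
def IsCanonicalWangMap (σ : K ≃* K) (lam : H →* G) (W : E_K →L[ℝ] E_G) : Prop :=
  (∀ ζ : E_H, W (mfderiv 𝓘(ℝ, E_H) 𝓘(ℝ, E_K) (Subtype.val : H → K) 1 ζ) =
    mfderiv 𝓘(ℝ, E_H) 𝓘(ℝ, E_G) lam 1 ζ) ∧
  ∀ ξ : E_K, mfderiv 𝓘(ℝ, E_K) 𝓘(ℝ, E_K) σ 1 ξ = -ξ → W ξ = 0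

/-- The canonical connection on `P_λ`: the `K`-invariant principal connection with
`A_{p_o}(ξ_P) = W(ξ)` for `ξ ∈ 𝔨`, where `p_o = [e, e]`, `ξ_P` is the vector field induced by the
left `K`-action, and `W` is the canonical Wang map. -/
structure IsCanonicalConnection (σ : K ≃* K) (A : DForm E_P (HomBundle H lam) 1 E_G) : Prop where
  principal : IsPrincipalConnection (HomBundle.rightAct H lam) A
  invariant : ∀ k : K, DForm.pullback (HomBundle.leftAct H lam k) A = A
  wang : ∃ W : E_K →L[ℝ] E_G, IsCanonicalWangMap (E_H := E_H) σ lam W ∧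
    ∀ ξ : E_K, lin A (HomBundle.mk H lam (1, 1)) (mfderiv 𝓘(ℝ, E_K) 𝓘(ℝ, E_P)
      (fun k : K => HomBundle.leftAct H lam k (HomBundle.mk H lam (1, 1))) 1 ξ) = W ξ

end Homogeneous

end YangMills

end

/-!
The canonical connection is studied on `K × G`, where it becomes an explicit form. Differentiating
`(k, g) ↦ [k, g]` shows that a canonical connection pulls back to
`(X, Y) ↦ Ad_{g⁻¹} W(k⁻¹ X) + g⁻¹ Y` (`wangForm`, `IsCanonicalConnection.exists_isInducedBy`), and
since `K × G → P_λ` is a submersion this gives uniqueness. Conversely, `wangForm` is basic for the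
action of `H`: along an `H`-valued change of representative the contributions of its velocity
cancel, because `W = T_e λ` on `𝔥` and `W` intertwines the adjoint actions of `H`
(`wangForm_comp_gauge`). Hence its pull-backs along local sections of `K × G → P_λ` define a smooth
form on `P_λ` (`canonicalForm`), which has the required invariance
(`IsInducedBy.isCanonicalConnection`). The map `W` exists and is unique because `𝔨 = 𝔥 ⊕ 𝔪`. The
point here is that every `ξ` with `T_e σ ξ = ξ` is tangent to `H`: in a chart that linearizes `σ`
there is a curve of fixed points of `σ` with velocity `ξ`, and it stays in the identity component
(`exists_fixed_curve`, `mem_range_tdiff_val`).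

The Yang–Mills equation follows from the symmetries of `K/H`. The symmetry
`k' H ↦ k σ(k⁻¹ k') H` at `k H` is an isometry of every invariant metric with differential `-1` at
`k H`, and it lifts to the automorphism `[k', g] ↦ [k σ(k⁻¹ k'), g]` of `P_λ`, which fixes all
points `[k, g]` over `k H` and preserves the canonical connection because `W ∘ T_e σ = W`
(`isSymmetry_bundleSymm`, `baseSymm_isometry`). The codifferential `δ_A Ω^A` is therefore
invariant under the lift; an isometry changes a volume form at most by a sign, which enters twice.
At `p = [k, g]` it is a `1`-form `γ ∘ dπ`, and invariance gives `γ ∘ dπ = -γ ∘ dπ`, so it vanishes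
(`codiff_curvature_eq_zero`). The naturality of `δ_A` under symmetries rests on the independence of
the Hodge operator from the basis (`hodge_comp`) and on `d f^* = f^* d` (`DForm.extDer_pullback`).
-/

open scoped Manifold ContDiff Topology

noncomputable section

namespace YangMills

/-! ### The Hodge operator does not depend on the basis -/

section HodgeNaturality

open Module Matrix

variable {V V' F : Type*} [AddCommGroup V] [Module ℝ V] [AddCommGroup V'] [Module ℝ V']
  [NormedAddCommGroup F] [NormedSpace ℝ F] {r s n : ℕ}
  {ι ι' : Type*} [Fintype ι] [Fintype ι']

omit [Fintype ι'] in
theorem _root_.MultilinearMap.map_basis_change {F : Type*} [AddCommGroup F] [Module ℝ F]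
    (b : Basis ι ℝ V) (b' : Basis ι' ℝ V)
    (m : MultilinearMap ℝ (fun _ : Fin r => V) F) (J : Fin r → ι') :
    m (b' ∘ J) = ∑ C : Fin r → ι, (∏ k, b.toMatrix b' (C k) (J k)) • m (b ∘ C) := by
  have h : b' ∘ J = fun k => ∑ i, b.toMatrix b' i (J k) • b i := by
    funext k
    exact (b.sum_toMatrix_smul_self b' (J k)).symm
  rw [h, m.map_sum]
  exact Finset.sum_congr rfl fun C _ => m.map_smul_univ _ _

/-- The full contraction of two multilinear maps with the tensor `∑ N i j • b i ⊗ b j` depends only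
on that tensor, not on the basis `b`. -/
theorem contraction_basis_change (b : Basis ι ℝ V) (b' : Basis ι' ℝ V)
    (N : Matrix ι ι ℝ) (N' : Matrix ι' ι' ℝ)
    (hN : b.toMatrix b' * N' * (b.toMatrix b')ᵀ = N)
    (m : MultilinearMap ℝ (fun _ : Fin r => V) ℝ) (φ : MultilinearMap ℝ (fun _ : Fin r => V) F) :
    ∑ I : Fin r → ι', ∑ J : Fin r → ι', (∏ k, N' (I k) (J k)) • m (b' ∘ I) • φ (b' ∘ J) =
      ∑ A : Fin r → ι, ∑ C : Fin r → ι, (∏ k, N (A k) (C k)) • m (b ∘ A) • φ (b ∘ C) := by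
  classical
  set P := b.toMatrix b'
  have hentry (a c : ι) : N a c = ∑ i, ∑ j, N' i j * P a i * P c j := by
    rw [← hN]
    simp only [Matrix.mul_apply, Matrix.transpose_apply, Finset.sum_mul]
    rw [Finset.sum_comm]
    exact Finset.sum_congr rfl fun i _ => Finset.sum_congr rfl fun j _ => by ring
  have hprod (A C : Fin r → ι) : ∏ k, N (A k) (C k) =
      ∑ I : Fin r → ι', ∑ J : Fin r → ι',
        (∏ k, N' (I k) (J k)) * (∏ k, P (A k) (I k)) * ∏ k, P (C k) (J k) := by
    simp only [hentry, Fintype.prod_sum, Finset.prod_mul_distrib]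
  calc _ = ∑ I : Fin r → ι', ∑ J : Fin r → ι', ∑ A : Fin r → ι, ∑ C : Fin r → ι,
        ((∏ k, N' (I k) (J k)) * (∏ k, P (A k) (I k)) * ∏ k, P (C k) (J k)) •
          m (b ∘ A) • φ (b ∘ C) := by
        refine Finset.sum_congr rfl fun I _ => Finset.sum_congr rfl fun J _ => ?_
        rw [m.map_basis_change b b', φ.map_basis_change b b', Finset.sum_smul, Finset.smul_sum]
        refine Finset.sum_congr rfl fun A _ => ?_
        rw [Finset.smul_sum, Finset.smul_sum]
        refine Finset.sum_congr rfl fun C _ => ?_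
        simp only [smul_smul, smul_eq_mul]
        congr 1
        ring
    _ = ∑ A : Fin r → ι, ∑ C : Fin r → ι, ∑ I : Fin r → ι', ∑ J : Fin r → ι',
        ((∏ k, N' (I k) (J k)) * (∏ k, P (A k) (I k)) * ∏ k, P (C k) (J k)) •
          m (b ∘ A) • φ (b ∘ C) := by
        rw [Finset.sum_congr rfl fun I _ => Finset.sum_comm, Finset.sum_comm]
        refine Finset.sum_congr rfl fun A _ => ?_
        rw [Finset.sum_congr rfl fun I _ => Finset.sum_comm, Finset.sum_comm]
    _ = _ := by
        simp_rw [hprod, Finset.sum_smul]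

omit [Fintype ι'] in
theorem gram_basis_change (B : V →ₗ[ℝ] V →ₗ[ℝ] ℝ) (c : Basis ι ℝ V) (c' : Basis ι' ℝ V) :
    (Matrix.of fun i j => B (c' i) (c' j)) =
      (c.toMatrix c')ᵀ * (Matrix.of fun i j => B (c i) (c j)) * c.toMatrix c' := by
  ext i j
  simp only [Matrix.of_apply, Matrix.mul_apply, Matrix.transpose_apply, Finset.sum_mul]
  conv_lhs => rw [← c.sum_toMatrix_smul_self c' i, ← c.sum_toMatrix_smul_self c' j]
  simp only [map_sum, map_smul, LinearMap.sum_apply, LinearMap.smul_apply, smul_eq_mul]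
  exact Finset.sum_congr rfl fun x _ => by
    simp only [Finset.mul_sum]
    exact Finset.sum_congr rfl fun y _ => by ring

/-- The inverse Gram matrix transforms as a bivector. -/
theorem inv_gram_basis_change [DecidableEq ι] [DecidableEq ι'] (b : Basis ι ℝ V)
    (b' : Basis ι' ℝ V) (B : V →ₗ[ℝ] V →ₗ[ℝ] ℝ) :
    b.toMatrix b' * (Matrix.of fun i j => B (b' i) (b' j))⁻¹ * (b.toMatrix b')ᵀ =
      (Matrix.of fun i j => B (b i) (b j))⁻¹ := by
  set G := Matrix.of fun i j => B (b i) (b j)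
  set G' := Matrix.of fun i j => B (b' i) (b' j)
  have hG : G = (b'.toMatrix b)ᵀ * G' * b'.toMatrix b := gram_basis_change B b' b
  have hG' : G' = (b.toMatrix b')ᵀ * G * b.toMatrix b' := gram_basis_change B b b'
  have hPQ : b.toMatrix b' * b'.toMatrix b = 1 := b.toMatrix_mul_toMatrix_flip b'
  have hQP : b'.toMatrix b * b.toMatrix b' = 1 := b'.toMatrix_mul_toMatrix_flip b
  have hPQt : (b'.toMatrix b)ᵀ * (b.toMatrix b')ᵀ = 1 := by rw [← transpose_mul, hPQ, transpose_one]
  by_cases hu : IsUnit G'.det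
  · symm
    apply Matrix.inv_eq_right_inv
    rw [hG]
    calc _ = (b'.toMatrix b)ᵀ * G' * (b'.toMatrix b * b.toMatrix b') * G'⁻¹ *
          (b.toMatrix b')ᵀ := by simp only [Matrix.mul_assoc]
      _ = 1 := by
        rw [hQP, Matrix.mul_one, Matrix.mul_assoc _ G', Matrix.mul_nonsing_inv _ hu, Matrix.mul_one,
          hPQt]
  · -- both Gram matrices are singular, and their inverses are `0` by convention
    have hu' : ¬ IsUnit G.det := by
      intro h
      apply hu
      have hQPt : (b.toMatrix b')ᵀ * (b'.toMatrix b)ᵀ = 1 := by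
        rw [← transpose_mul, hQP, transpose_one]
      have h1 : G' * (b'.toMatrix b * G⁻¹ * (b'.toMatrix b)ᵀ) = 1 := by
        rw [hG']
        calc _ = (b.toMatrix b')ᵀ * G * (b.toMatrix b' * b'.toMatrix b) * G⁻¹ *
              (b'.toMatrix b)ᵀ := by simp only [Matrix.mul_assoc]
          _ = 1 := by
            rw [hPQ, Matrix.mul_one, Matrix.mul_assoc _ G, Matrix.mul_nonsing_inv _ h,
              Matrix.mul_one, hQPt]
      exact (Matrix.isUnit_iff_isUnit_det _).1 (IsUnit.of_mul_eq_one _ h1)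
    rw [Matrix.nonsing_inv_apply_not_isUnit _ hu, Matrix.nonsing_inv_apply_not_isUnit _ hu',
      Matrix.mul_zero, Matrix.zero_mul]

variable [TopologicalSpace V] [TopologicalSpace V']

/-- `v ↦ μ (v, w)` as a multilinear map. -/
theorem exists_multilinear_fillFirst (h : r + s = n) (μ : V [⋀^Fin n]→L[ℝ] ℝ) (w : Fin s → V) :
    ∃ m : MultilinearMap ℝ (fun _ : Fin r => V) ℝ, ∀ v, m v = fillFirst h μ v w := by
  subst h
  let c := ((μ.toMultilinearMap.domDomCongr finSumFinEquiv.symm).currySum :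
    MultilinearMap ℝ (fun _ : Fin r => V) (MultilinearMap ℝ (fun _ : Fin s => V) ℝ))
  refine ⟨{ toFun := fun v => c v w, map_update_add' := ?_, map_update_smul' := ?_ }, ?_⟩
  · intro _ v i x y
    rw [c.map_update_add]; rfl
  · intro _ v i a x
    rw [c.map_update_smul]; rfl
  · intro v
    change μ _ = μ _
    congr 1
    funext j
    refine Fin.addCases (fun a => ?_) (fun a => ?_) j <;> simp

theorem hodge_apply_eq_basis [FiniteDimensional ℝ V] (b : Basis ι ℝ V) [DecidableEq ι]
    (B : V →L[ℝ] V →L[ℝ] ℝ) (h : r + s = n) (μ : V [⋀^Fin n]→L[ℝ] ℝ)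
    (φ : V [⋀^Fin r]→L[ℝ] F) (w : Fin s → V) :
    hodge B h μ φ w = ((r.factorial : ℝ)⁻¹) • ∑ I : Fin r → ι, ∑ J : Fin r → ι,
      (∏ k, (Matrix.of fun i j => B (b i) (b j))⁻¹ (I k) (J k)) •
        fillFirst h μ (b ∘ I) w • φ (b ∘ J) := by
  obtain ⟨m, hm⟩ := exists_multilinear_fillFirst h μ w
  have key := contraction_basis_change b (finBasis ℝ V) _ _
    (inv_gram_basis_change b (finBasis ℝ V)
      (LinearMap.mk₂ ℝ (fun v w => B v w) (by simp) (by simp) (by simp) (by simp))) m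
    φ.toMultilinearMap
  simp only [hm, LinearMap.mk₂_apply, ContinuousMultilinearMap.coe_coe,
    ContinuousAlternatingMap.coe_toContinuousMultilinearMap] at key
  rw [← key]
  simp [hodge, ContinuousAlternatingMap.sum_apply, ContinuousAlternatingMap.smul_apply]

/-- The Hodge operator commutes with linear isomorphisms. -/
theorem hodge_comp [FiniteDimensional ℝ V] [FiniteDimensional ℝ V'] (L : V ≃L[ℝ] V')
    (B : V →L[ℝ] V →L[ℝ] ℝ) (B' : V' →L[ℝ] V' →L[ℝ] ℝ) (hB : ∀ v w, B' (L v) (L w) = B v w)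
    (h : r + s = n) (μ : V' [⋀^Fin n]→L[ℝ] ℝ) (φ : V' [⋀^Fin r]→L[ℝ] F) :
    (hodge B' h μ φ).compContinuousLinearMap (L : V →L[ℝ] V') =
      hodge B h (μ.compContinuousLinearMap (L : V →L[ℝ] V'))
        (φ.compContinuousLinearMap (L : V →L[ℝ] V')) := by
  ext w
  rw [ContinuousAlternatingMap.compContinuousLinearMap_apply,
    hodge_apply_eq_basis ((finBasis ℝ V).map L.toLinearEquiv),
    hodge_apply_eq_basis (finBasis ℝ V)]
  have hfill (v : Fin r → V) : fillFirst h μ (L ∘ v) (L ∘ w) =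
      fillFirst h (μ.compContinuousLinearMap (L : V →L[ℝ] V')) v w := by
    subst h
    change μ _ = μ _
    congr 1
    funext j
    refine Fin.addCases (fun a => ?_) (fun a => ?_) j <;> simp
  have hb (I : Fin r → Fin (finrank ℝ V)) :
      ((finBasis ℝ V).map L.toLinearEquiv) ∘ I = L ∘ (finBasis ℝ V ∘ I) := by
    funext k; simp
  simp only [hb, Basis.map_apply, ContinuousLinearEquiv.coe_toLinearEquiv, hB,
    ContinuousAlternatingMap.compContinuousLinearMap_apply, ContinuousLinearEquiv.coe_coe, hfill]

theorem hodge_smul_form [FiniteDimensional ℝ V] (B : V →L[ℝ] V →L[ℝ] ℝ) (h : r + s = n) (ε : ℝ)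
    (μ : V [⋀^Fin n]→L[ℝ] ℝ) (φ : V [⋀^Fin r]→L[ℝ] F) :
    hodge B h (ε • μ) φ = ε • hodge B h μ φ := by
  ext w
  have hf (v : Fin r → V) : fillFirst h (ε • μ) v w = ε * fillFirst h μ v w := rfl
  simp only [hodge_apply_eq_basis (finBasis ℝ V), ContinuousAlternatingMap.smul_apply, hf,
    Finset.smul_sum, smul_smul]
  refine Finset.sum_congr rfl fun I _ => Finset.sum_congr rfl fun J _ => ?_
  congr 1
  ring

theorem hodge_smul_arg [FiniteDimensional ℝ V] (B : V →L[ℝ] V →L[ℝ] ℝ) (h : r + s = n) (ε : ℝ)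
    (μ : V [⋀^Fin n]→L[ℝ] ℝ) (φ : V [⋀^Fin r]→L[ℝ] F) :
    hodge B h μ (ε • φ) = ε • hodge B h μ φ := by
  ext w
  simp only [hodge_apply_eq_basis (finBasis ℝ V), ContinuousAlternatingMap.smul_apply,
    Finset.smul_sum, smul_smul]
  refine Finset.sum_congr rfl fun I _ => Finset.sum_congr rfl fun J _ => ?_
  congr 1
  ring

end HodgeNaturality

/-! ### Pull-backs and the exterior derivative -/

section Naturality

variable {E E' E'' F : Type*} [NormedAddCommGroup E] [NormedSpace ℝ E]
  [NormedAddCommGroup E'] [NormedSpace ℝ E'] [NormedAddCommGroup E''] [NormedSpace ℝ E'']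
  [NormedAddCommGroup F] [NormedSpace ℝ F]
  {M N Q : Type*} [TopologicalSpace M] [ChartedSpace E M] [TopologicalSpace N] [ChartedSpace E' N]
  [TopologicalSpace Q] [ChartedSpace E'' Q] {r : ℕ}

namespace DForm

theorem pullback_congr (φ : DForm E M r F) {f f' : N → M} {y : N} (h : f =ᶠ[𝓝 y] f') :
    DForm.pullback (E' := E') f φ y = DForm.pullback (E' := E') f' φ y := by
  have h2 : (mfderiv 𝓘(ℝ, E') 𝓘(ℝ, E) f y : E' →L[ℝ] E) = mfderiv 𝓘(ℝ, E') 𝓘(ℝ, E) f' y :=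
    h.mfderiv_eq
  let ψ : M → E [⋀^Fin r]→L[ℝ] F := φ
  exact congrArg₂ (fun (a : M) (L : E' →L[ℝ] E) => (ψ a).compContinuousLinearMap L)
    h.self_of_nhds h2

theorem pullback_comp (φ : DForm E M r F) {f : N → M} {k : Q → N} {y : Q}
    (hf : MDifferentiableAt 𝓘(ℝ, E') 𝓘(ℝ, E) f (k y))
    (hk : MDifferentiableAt 𝓘(ℝ, E'') 𝓘(ℝ, E') k y) :
    DForm.pullback (E' := E'') (f ∘ k) φ y =
      DForm.pullback (E' := E'') k (DForm.pullback (E' := E') f φ) y := by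
  unfold DForm.pullback
  rw [mfderiv_comp y hf hk]
  rfl

theorem pullback_id (φ : DForm E M r F) (y : M) : DForm.pullback (E' := E) id φ y = φ y := by
  unfold DForm.pullback
  rw [mfderiv_id]
  rfl

variable [IsManifold 𝓘(ℝ, E) ∞ M] [IsManifold 𝓘(ℝ, E') ∞ N]

/-- The expression of `f^* φ` in charts is the pull-back, under the expression of `f` in charts, of
the expression of `φ`. -/
theorem inChart_pullback (φ : DForm E M r F) {f : N → M} (hf : ContMDiff 𝓘(ℝ, E') 𝓘(ℝ, E) ∞ f)
    (x : N) :
    ∀ᶠ y in 𝓝 (chartAt E' x x), (DForm.pullback (E' := E') f φ).inChart x y =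
      (φ.inChart (f x) ((chartAt E (f x) ∘ f ∘ (chartAt E' x).symm) y)).compContinuousLinearMap
        (fderiv ℝ (chartAt E (f x) ∘ f ∘ (chartAt E' x).symm) y) := by
  set c := chartAt E' x
  set c' := chartAt E (f x)
  have hcx : c x ∈ c.target := c.map_source (mem_chart_source E' x)
  have hev : ∀ᶠ y in 𝓝 (c x), y ∈ c.target ∧ f (c.symm y) ∈ c'.source := by
    refine (show ∀ᶠ y in 𝓝 (c x), y ∈ c.target from c.open_target.mem_nhds hcx).and ?_
    have hcont : ContinuousAt (f ∘ c.symm) (c x) :=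
      hf.continuous.continuousAt.comp (c.symm.continuousAt hcx)
    refine hcont (c'.open_source.mem_nhds ?_)
    simp [c, c', mem_chart_source]
  filter_upwards [eventually_eventually_nhds.2 hev] with y hy
  obtain ⟨hyt, hys⟩ := hy.self_of_nhds
  have hmc : MDifferentiableAt 𝓘(ℝ, E') 𝓘(ℝ, E') c.symm y :=
    mdifferentiableAt_atlas_symm (chart_mem_atlas E' x) hyt
  have hmf := (hf.mdifferentiable (by simp)) (c.symm y)
  have hmc' : MDifferentiableAt 𝓘(ℝ, E) 𝓘(ℝ, E) c' (f (c.symm y)) :=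
    mdifferentiableAt_atlas (chart_mem_atlas E (f x)) hys
  have hmF : MDifferentiableAt 𝓘(ℝ, E') 𝓘(ℝ, E) (c' ∘ f ∘ c.symm) y :=
    hmc'.comp y (hmf.comp y hmc)
  have hmc's : MDifferentiableAt 𝓘(ℝ, E) 𝓘(ℝ, E) c'.symm ((c' ∘ f ∘ c.symm) y) :=
    mdifferentiableAt_atlas_symm (chart_mem_atlas E (f x)) (c'.map_source hys)
  have h1 : DForm.pullback (E' := E') (c'.symm ∘ (c' ∘ f ∘ c.symm)) φ y =
      DForm.pullback (E' := E') (f ∘ c.symm) φ y := by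
    refine pullback_congr φ ?_
    filter_upwards [hy] with z hz
    exact c'.left_inv hz.2
  rw [pullback_comp φ hmc's hmF, pullback_comp φ hmf hmc] at h1
  rw [← mfderiv_eq_fderiv]
  exact h1.symm

theorem contDiffAt_inCharts {f : N → M} (hf : ContMDiff 𝓘(ℝ, E') 𝓘(ℝ, E) ∞ f) (x : N) :
    ContDiffAt ℝ ∞ (chartAt E (f x) ∘ f ∘ (chartAt E' x).symm) (chartAt E' x x) := by
  rw [← contMDiffAt_iff_contDiffAt]
  have h3 : ContMDiffAt 𝓘(ℝ, E') 𝓘(ℝ, E') ∞ (chartAt E' x).symm (chartAt E' x x) :=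
    contMDiffOn_chart_symm.contMDiffAt ((chartAt E' x).open_target.mem_nhds (mem_chart_target E' x))
  have hx : (chartAt E' x).symm (chartAt E' x x) = x :=
    (chartAt E' x).left_inv (mem_chart_source E' x)
  have h1 : ContMDiffAt 𝓘(ℝ, E) 𝓘(ℝ, E) ∞ (chartAt E (f x))
      (f ((chartAt E' x).symm (chartAt E' x x))) := by
    rw [hx]
    exact contMDiffOn_chart.contMDiffAt
      ((chartAt E (f x)).open_source.mem_nhds (mem_chart_source E (f x)))
  exact ContMDiffAt.comp (chartAt E' x x) h1 (ContMDiffAt.comp (chartAt E' x x) (hf _) h3)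

theorem differentiableAt_inChart_pullback (φ : DForm E M r F) {f : N → M}
    (hf : ContMDiff 𝓘(ℝ, E') 𝓘(ℝ, E) ∞ f) (x : N)
    (hφ : DifferentiableAt ℝ (φ.inChart (f x)) (chartAt E (f x) (f x))) :
    DifferentiableAt ℝ ((DForm.pullback (E' := E') f φ).inChart x) (chartAt E' x x) := by
  refine DifferentiableAt.congr_of_eventuallyEq ?_ (inChart_pullback φ hf x)
  have hF := contDiffAt_inCharts hf x
  have hx : (chartAt E' x).symm (chartAt E' x x) = x :=
    (chartAt E' x).left_inv (mem_chart_source E' x)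
  have h1 : DifferentiableAt ℝ (φ.inChart (f x) ∘ (chartAt E (f x) ∘ f ∘ (chartAt E' x).symm))
      (chartAt E' x x) := by
    refine DifferentiableAt.comp (chartAt E' x x) ?_ (hF.differentiableAt (by simp))
    simpa [hx] using hφ
  exact h1.continuousAlternatingMapCompContinuousLinearMap
    ((hF.fderiv_right (m := 1) (by norm_cast)).differentiableAt (by simp))

theorem extDer_pullback_of_differentiableAt (φ : DForm E M r F) {f : N → M}
    (hf : ContMDiff 𝓘(ℝ, E') 𝓘(ℝ, E) ∞ f) (x : N)
    (hφ : DifferentiableAt ℝ (φ.inChart (f x)) (chartAt E (f x) (f x))) :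
    (DForm.pullback (E' := E') f φ).extDer x = DForm.pullback (E' := E') f φ.extDer x := by
  have hF := contDiffAt_inCharts hf x
  have hx : (chartAt E' x).symm (chartAt E' x x) = x :=
    (chartAt E' x).left_inv (mem_chart_source E' x)
  have hFx : (chartAt E (f x) ∘ f ∘ (chartAt E' x).symm) (chartAt E' x x) =
      chartAt E (f x) (f x) := by simp [hx]
  have h1 : extDeriv ((DForm.pullback (E' := E') f φ).inChart x) (chartAt E' x x) =
      (extDeriv (φ.inChart (f x)) (chartAt E (f x) (f x))).compContinuousLinearMap
        (fderiv ℝ (chartAt E (f x) ∘ f ∘ (chartAt E' x).symm) (chartAt E' x x)) := by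
    rw [Filter.EventuallyEq.extDeriv_eq (inChart_pullback φ hf x),
      extDeriv_pullback (by rwa [hFx]) hF (by simp; norm_cast), hFx]
  have hmc : MDifferentiableAt 𝓘(ℝ, E') 𝓘(ℝ, E') (chartAt E' x) x :=
    mdifferentiableAt_atlas (chart_mem_atlas E' x) (mem_chart_source E' x)
  have hmc' : MDifferentiableAt 𝓘(ℝ, E) 𝓘(ℝ, E) (chartAt E (f x)) (f x) :=
    mdifferentiableAt_atlas (chart_mem_atlas E (f x)) (mem_chart_source E (f x))
  have hL : (mfderiv 𝓘(ℝ, E') 𝓘(ℝ, E) (chartAt E (f x) ∘ f ∘ (chartAt E' x).symm)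
        (chartAt E' x x)).comp (mfderiv 𝓘(ℝ, E') 𝓘(ℝ, E') (chartAt E' x) x) =
      (mfderiv 𝓘(ℝ, E) 𝓘(ℝ, E) (chartAt E (f x)) (f x)).comp (mfderiv 𝓘(ℝ, E') 𝓘(ℝ, E) f x) := by
    rw [← mfderiv_comp x (hF.differentiableAt (by simp)).mdifferentiableAt hmc,
      ← mfderiv_comp x hmc' (hf.mdifferentiable (by simp) x)]
    refine Filter.EventuallyEq.mfderiv_eq ?_
    filter_upwards [(chartAt E' x).open_source.mem_nhds (mem_chart_source E' x)] with z hz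
    simp [(chartAt E' x).left_inv hz]
  unfold DForm.extDer
  rw [h1]
  unfold DForm.pullback
  rw [← mfderiv_eq_fderiv]
  exact congrArg (fun L : E' →L[ℝ] E => (extDeriv (φ.inChart (f x))
    (chartAt E (f x) (f x))).compContinuousLinearMap (M' := E') L) hL

/-- The exterior derivative commutes with the pull-back by a smooth involution. No regularity of
the form is needed: `φ` is differentiable at `f x` if and only if `f^* φ` is at `x`, and otherwise
both sides vanish. -/
theorem extDer_pullback (φ : DForm E M r F) {f : M → M}
    (hf : ContMDiff 𝓘(ℝ, E) 𝓘(ℝ, E) ∞ f) (hff : ∀ x, f (f x) = x) :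
    (DForm.pullback (E' := E) f φ).extDer = DForm.pullback (E' := E) f φ.extDer := by
  funext x
  by_cases hφ : DifferentiableAt ℝ (φ.inChart (f x)) (chartAt E (f x) (f x))
  · exact extDer_pullback_of_differentiableAt φ hf x hφ
  · have hφ' : ¬ DifferentiableAt ℝ ((DForm.pullback (E' := E) f φ).inChart x) (chartAt E x x) := by
      intro h
      apply hφ
      have h2 := differentiableAt_inChart_pullback (DForm.pullback (E' := E) f φ) hf (f x)
        (by rw [hff x]; exact h)
      have h3 : DForm.pullback (E' := E) f (DForm.pullback (E' := E) f φ) = φ := by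
        funext y
        have hm := hf.mdifferentiable (by simp)
        rw [← pullback_comp φ (hm _) (hm _), show f ∘ f = id from funext hff, pullback_id]
      rwa [h3] at h2
    have h0 : extDeriv (φ.inChart (f x)) (chartAt E (f x) (f x)) = 0 := by
      rw [extDeriv, fderiv_zero_of_not_differentiableAt hφ]
      exact map_zero (ContinuousAlternatingMap.alternatizeUncurryFinCLM ℝ E F)
    have h0' : extDeriv ((DForm.pullback (E' := E) f φ).inChart x) (chartAt E x x) = 0 := by
      rw [extDeriv, fderiv_zero_of_not_differentiableAt hφ']
      exact map_zero (ContinuousAlternatingMap.alternatizeUncurryFinCLM ℝ E F)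
    have h1 : (DForm.pullback (E' := E) f φ).extDer x = 0 := by
      unfold DForm.extDer
      rw [h0']
      rfl
    have h2 : φ.extDer (f x) = 0 := by
      unfold DForm.extDer
      rw [h0]
      rfl
    rw [h1]
    unfold DForm.pullback
    rw [h2]
    rfl

omit [IsManifold 𝓘(ℝ, E) ∞ M] in
/-- The exterior derivative is local and commutes with constant factors. -/
theorem extDer_eq_smul_of_eventually {φ ψ : DForm E M r F} {x : M} (ε : ℝ)
    (h : ∀ᶠ y in 𝓝 x, φ y = ε • ψ y) : φ.extDer x = ε • ψ.extDer x := by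
  have hcont : ContinuousAt (chartAt E x).symm (chartAt E x x) :=
    (chartAt E x).symm.continuousAt (mem_chart_target E x)
  have hx : (chartAt E x).symm (chartAt E x x) = x :=
    (chartAt E x).left_inv (mem_chart_source E x)
  have h' : φ.inChart x =ᶠ[𝓝 (chartAt E x x)] ε • ψ.inChart x := by
    filter_upwards [hcont (by rwa [hx])] with y hy
    unfold DForm.inChart
    have hy : φ _ = ε • ψ _ := hy
    rw [hy]
    rfl
  unfold DForm.extDer
  rw [h'.extDeriv_eq, extDeriv_smul]
  rfl

end DForm

end Naturality

/-! ### Naturality of the covariant codifferential under symmetries of a connection -/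

section Symmetry

variable {E_P E_G E_M : Type*} [NormedAddCommGroup E_P] [NormedSpace ℝ E_P]
  [NormedAddCommGroup E_G] [NormedSpace ℝ E_G] [NormedAddCommGroup E_M] [NormedSpace ℝ E_M]
  {P G M : Type*} [TopologicalSpace P] [ChartedSpace E_P P]
  [TopologicalSpace G] [ChartedSpace E_G G] [Group G]
  [TopologicalSpace M] [ChartedSpace E_M M] {r s n : ℕ}

/-- An involutive automorphism `f` of the bundle `π : P → M` with its right action `R`, which covers
`fb` and preserves the connection form `A`. -/
structure IsSymmetry (π : P → M) (R : P → G → P) (A : DForm E_P P 1 E_G) (f : P → P)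
    (fb : M → M) : Prop where
  smooth : ContMDiff 𝓘(ℝ, E_P) 𝓘(ℝ, E_P) ∞ f
  smooth_base : ContMDiff 𝓘(ℝ, E_M) 𝓘(ℝ, E_M) ∞ fb
  invol : ∀ p, f (f p) = p
  invol_base : ∀ x, fb (fb x) = x
  proj : ∀ p, π (f p) = fb (π p)
  equivariant : ∀ p g, f (R p g) = R (f p) g
  pullback_eq : DForm.pullback f A = A

/-- The differential of a smooth involution as a linear isomorphism. -/
theorem exists_equiv_mfderiv {f : P → P} (hf : ContMDiff 𝓘(ℝ, E_P) 𝓘(ℝ, E_P) ∞ f)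
    (hff : ∀ p, f (f p) = p) (p : P) : ∃ e : E_P ≃L[ℝ] E_P,
      (e : E_P →L[ℝ] E_P) = mfderiv 𝓘(ℝ, E_P) 𝓘(ℝ, E_P) f p := by
  have hm := hf.mdifferentiable (by simp)
  have key (q : P) : (mfderiv 𝓘(ℝ, E_P) 𝓘(ℝ, E_P) f (f q)).comp (mfderiv 𝓘(ℝ, E_P) 𝓘(ℝ, E_P) f q) =
      ContinuousLinearMap.id ℝ E_P := by
    rw [← mfderiv_comp q (hm _) (hm _), show f ∘ f = id from funext hff]
    exact mfderiv_id
  have key2 : (mfderiv 𝓘(ℝ, E_P) 𝓘(ℝ, E_P) f p : E_P →L[ℝ] E_P).comp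
      (mfderiv 𝓘(ℝ, E_P) 𝓘(ℝ, E_P) f (f p)) = ContinuousLinearMap.id ℝ E_P := by
    have := key (f p)
    rwa [hff p] at this
  exact ⟨ContinuousLinearEquiv.equivOfInverse _ _ (fun v => DFunLike.congr_fun (key p) v)
    (fun v => DFunLike.congr_fun key2 v), rfl⟩

namespace IsSymmetry

variable {π : P → M} {R : P → G → P} {A : DForm E_P P 1 E_G} {f : P → P} {fb : M → M}

omit [TopologicalSpace G] [ChartedSpace E_G G] [Group G] in
theorem lin_mfderiv (hS : IsSymmetry (E_M := E_M) π R A f fb) (p : P) :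
    (lin A (f p)).comp (mfderiv 𝓘(ℝ, E_P) 𝓘(ℝ, E_P) f p) = lin A p := by
  ext v
  have h := congrArg (fun φ => φ fun _ => v) (congrFun hS.pullback_eq p)
  exact h

theorem mfderiv_fund (hS : IsSymmetry (E_M := E_M) π R A f fb) (hR1 : ∀ p, R p 1 = p)
    (hR : ∀ p, MDifferentiableAt 𝓘(ℝ, E_G) 𝓘(ℝ, E_P) (fun g : G => R p g) 1) (p : P) :
    (mfderiv 𝓘(ℝ, E_P) 𝓘(ℝ, E_P) f p : E_P →L[ℝ] E_P).comp (fund R p : E_G →L[ℝ] E_P) =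
      (fund R (f p) : E_G →L[ℝ] E_P) := by
  have hm := hS.smooth.mdifferentiable (by simp)
  have h := mfderiv_comp (1 : G) (hm (R p 1)) (hR p)
  have h2 : f ∘ (fun g : G => R p g) = fun g : G => R (f p) g := funext fun g => hS.equivariant p g
  rw [h2] at h
  unfold fund
  rw [hR1 p] at h
  exact h.symm

theorem mfderiv_horProj (hS : IsSymmetry (E_M := E_M) π R A f fb) (hR1 : ∀ p, R p 1 = p)
    (hR : ∀ p, MDifferentiableAt 𝓘(ℝ, E_G) 𝓘(ℝ, E_P) (fun g : G => R p g) 1) (p : P) :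
    (horProj R A (f p) : E_P →L[ℝ] E_P).comp (mfderiv 𝓘(ℝ, E_P) 𝓘(ℝ, E_P) f p : E_P →L[ℝ] E_P) =
      (mfderiv 𝓘(ℝ, E_P) 𝓘(ℝ, E_P) f p : E_P →L[ℝ] E_P).comp (horProj R A p : E_P →L[ℝ] E_P) := by
  ext v
  have h1 := DFunLike.congr_fun (hS.lin_mfderiv p) v
  have h2 := DFunLike.congr_fun (hS.mfderiv_fund hR1 hR p) (lin A p v)
  let D : E_P →L[ℝ] E_P := mfderiv 𝓘(ℝ, E_P) 𝓘(ℝ, E_P) f p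
  let F : E_G →L[ℝ] E_P := fund R p
  let F' : E_G →L[ℝ] E_P := fund R (f p)
  let a : E_P →L[ℝ] E_G := lin A p
  let w : E_P := v
  change D w - F' (lin A (f p) (D w)) = D (w - F (a w))
  rw [map_sub]
  congr 1
  exact (congrArg F' h1).trans h2.symm

/-- The covariant derivative commutes with symmetries. -/
theorem covDeriv_pullback [IsManifold 𝓘(ℝ, E_P) ∞ P] (hS : IsSymmetry (E_M := E_M) π R A f fb)
    (hR1 : ∀ p, R p 1 = p)
    (hR : ∀ p, MDifferentiableAt 𝓘(ℝ, E_G) 𝓘(ℝ, E_P) (fun g : G => R p g) 1)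
    (φ : DForm E_P P r E_G) :
    covDeriv R A (DForm.pullback f φ) = DForm.pullback f (covDeriv R A φ) := by
  funext p
  unfold covDeriv
  rw [DForm.extDer_pullback φ hS.smooth hS.invol]
  let ψ : E_P [⋀^Fin (r + 1)]→L[ℝ] E_G := φ.extDer (f p)
  exact congrArg (fun L : E_P →L[ℝ] E_P => ψ.compContinuousLinearMap L)
    (hS.mfderiv_horProj hR1 hR p).symm

theorem pullback_curvature [IsManifold 𝓘(ℝ, E_P) ∞ P] (hS : IsSymmetry (E_M := E_M) π R A f fb)
    (hR1 : ∀ p, R p 1 = p)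
    (hR : ∀ p, MDifferentiableAt 𝓘(ℝ, E_G) 𝓘(ℝ, E_P) (fun g : G => R p g) 1) :
    DForm.pullback f (curvature R A) = curvature R A := by
  unfold curvature
  rw [← hS.covDeriv_pullback hR1 hR, hS.pullback_eq]

omit [TopologicalSpace G] [ChartedSpace E_G G] [Group G] in
theorem mfderiv_proj (hS : IsSymmetry (E_M := E_M) π R A f fb)
    (hπ : ContMDiff 𝓘(ℝ, E_P) 𝓘(ℝ, E_M) ∞ π) (p : P) :
    (mfderiv 𝓘(ℝ, E_P) 𝓘(ℝ, E_M) π (f p) : E_P →L[ℝ] E_M).comp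
        (mfderiv 𝓘(ℝ, E_P) 𝓘(ℝ, E_P) f p : E_P →L[ℝ] E_P) =
      (mfderiv 𝓘(ℝ, E_M) 𝓘(ℝ, E_M) fb (π p) : E_M →L[ℝ] E_M).comp
        (mfderiv 𝓘(ℝ, E_P) 𝓘(ℝ, E_M) π p : E_P →L[ℝ] E_M) := by
  have h1 := mfderiv_comp p (hπ.mdifferentiable (by simp) (f p))
    (hS.smooth.mdifferentiable (by simp) p)
  have h2 := mfderiv_comp p (hS.smooth_base.mdifferentiable (by simp) (π p))
    (hπ.mdifferentiable (by simp) p)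
  rw [show π ∘ f = fb ∘ π from funext hS.proj] at h1
  exact h1.symm.trans h2

omit [TopologicalSpace G] [ChartedSpace E_G G] [Group G] in
/-- Horizontal lifts commute with symmetries. -/
theorem horLift_mfderiv (hS : IsSymmetry (E_M := E_M) π R A f fb)
    (hπ : ContMDiff 𝓘(ℝ, E_P) 𝓘(ℝ, E_M) ∞ π) (p : P) :
    (horLift π A (f p) : E_M →L[ℝ] E_P).comp
        (mfderiv 𝓘(ℝ, E_M) 𝓘(ℝ, E_M) fb (π p) : E_M →L[ℝ] E_M) =
      (mfderiv 𝓘(ℝ, E_P) 𝓘(ℝ, E_P) f p : E_P →L[ℝ] E_P).comp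
        (horLift π A p : E_M →L[ℝ] E_P) := by
  obtain ⟨e, he⟩ := exists_equiv_mfderiv hS.smooth hS.invol p
  obtain ⟨eb, heb⟩ := exists_equiv_mfderiv hS.smooth_base hS.invol_base (π p)
  let T (q : P) : E_P →L[ℝ] E_M × E_G := (mfderiv 𝓘(ℝ, E_P) 𝓘(ℝ, E_M) π q).prod (lin A q)
  let e2 : (E_M × E_G) ≃L[ℝ] (E_M × E_G) := eb.prodCongr (ContinuousLinearEquiv.refl ℝ E_G)
  have hT : T (f p) = ((e2 : (E_M × E_G) →L[ℝ] (E_M × E_G)).comp (T p)).comp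
      (e.symm : E_P →L[ℝ] E_P) := by
    let D : E_P →L[ℝ] E_M := mfderiv 𝓘(ℝ, E_P) 𝓘(ℝ, E_M) π p
    let D' : E_P →L[ℝ] E_M := mfderiv 𝓘(ℝ, E_P) 𝓘(ℝ, E_M) π (f p)
    let a : E_P →L[ℝ] E_G := lin A p
    let a' : E_P →L[ℝ] E_G := lin A (f p)
    refine ContinuousLinearMap.ext fun v => Prod.ext ?_ ?_
    · have h : D'.comp (e : E_P →L[ℝ] E_P) = (eb : E_M →L[ℝ] E_M).comp D := by
        rw [he, heb]; exact hS.mfderiv_proj hπ p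
      have h' := DFunLike.congr_fun h (e.symm v)
      simp only [ContinuousLinearMap.comp_apply, ContinuousLinearEquiv.coe_coe,
        e.apply_symm_apply] at h'
      exact h'
    · have h : a'.comp (e : E_P →L[ℝ] E_P) = a := by
        rw [he]; exact hS.lin_mfderiv p
      have h' := DFunLike.congr_fun h (e.symm v)
      simp only [ContinuousLinearMap.comp_apply, ContinuousLinearEquiv.coe_coe,
        e.apply_symm_apply] at h'
      exact h'
  have hinv : (T (f p)).inverse = ((e : E_P →L[ℝ] E_P).comp (T p).inverse).comp
      (e2.symm : (E_M × E_G) →L[ℝ] (E_M × E_G)) := by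
    rw [hT, ContinuousLinearMap.inverse_comp_equiv, ContinuousLinearMap.inverse_equiv_comp]
    rfl
  rw [← he, ← heb]
  change ((T (f p)).inverse.comp (ContinuousLinearMap.inl ℝ E_M E_G)).comp (eb : E_M →L[ℝ] E_M) =
    (e : E_P →L[ℝ] E_P).comp ((T p).inverse.comp (ContinuousLinearMap.inl ℝ E_M E_G))
  rw [hinv]
  ext v
  simp only [ContinuousLinearMap.comp_apply, ContinuousLinearEquiv.coe_coe,
    ContinuousLinearMap.inl_apply]
  congr 2
  simp [e2, ContinuousLinearEquiv.prodCongr_symm]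

variable [IsManifold 𝓘(ℝ, E_M) ∞ M] [FiniteDimensional ℝ E_M]

omit [TopologicalSpace G] [ChartedSpace E_G G] [Group G] in
/-- The Hodge operator commutes with symmetries covering isometries. -/
theorem hodgeStar_pullback (hS : IsSymmetry (E_M := E_M) π R A f fb)
    (hπ : ContMDiff 𝓘(ℝ, E_P) 𝓘(ℝ, E_M) ∞ π) (g : Metric E_M M)
    (hg : ∀ (x : M) (v w : TangentSpace 𝓘(ℝ, E_M) x),
      g.inner (fb x) (mfderiv 𝓘(ℝ, E_M) 𝓘(ℝ, E_M) fb x v)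
        (mfderiv 𝓘(ℝ, E_M) 𝓘(ℝ, E_M) fb x w) = g.inner x v w)
    (μ : DForm E_M M n ℝ) (h : r + s = n) (φ : DForm E_P P r E_G) :
    DForm.pullback f (hodgeStar π A g μ h φ) =
      hodgeStar π A g (DForm.pullback fb μ) h (DForm.pullback f φ) := by
  funext p
  obtain ⟨eb, heb⟩ := exists_equiv_mfderiv hS.smooth_base hS.invol_base (π p)
  have h1 := hS.mfderiv_proj hπ p
  have h2 := hS.horLift_mfderiv hπ p
  have hgp := hg (π p)
  let B : M → E_M →L[ℝ] E_M →L[ℝ] ℝ := g.inner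
  let ν : M → E_M [⋀^Fin n]→L[ℝ] ℝ := μ
  let φp : E_P [⋀^Fin r]→L[ℝ] E_G := φ (f p)
  let Df : E_P →L[ℝ] E_P := mfderiv 𝓘(ℝ, E_P) 𝓘(ℝ, E_P) f p
  let Γ : E_M →L[ℝ] E_P := horLift π A p
  let Γ' : E_M →L[ℝ] E_P := horLift π A (f p)
  let D : E_P →L[ℝ] E_M := mfderiv 𝓘(ℝ, E_P) 𝓘(ℝ, E_M) π p
  let D' : E_P →L[ℝ] E_M := mfderiv 𝓘(ℝ, E_P) 𝓘(ℝ, E_M) π (f p)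
  change D'.comp Df = (mfderiv 𝓘(ℝ, E_M) 𝓘(ℝ, E_M) fb (π p) : E_M →L[ℝ] E_M).comp D at h1
  change Γ'.comp (mfderiv 𝓘(ℝ, E_M) 𝓘(ℝ, E_M) fb (π p) : E_M →L[ℝ] E_M) = Df.comp Γ at h2
  rw [← heb] at h1 h2
  change ((hodge (B (π (f p))) h (ν (π (f p)))
      (φp.compContinuousLinearMap Γ')).compContinuousLinearMap D').compContinuousLinearMap Df =
    (hodge (B (π p)) h ((ν (fb (π p))).compContinuousLinearMap
      (mfderiv 𝓘(ℝ, E_M) 𝓘(ℝ, E_M) fb (π p) : E_M →L[ℝ] E_M))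
      ((φp.compContinuousLinearMap Df).compContinuousLinearMap Γ)).compContinuousLinearMap D
  have hgp' : ∀ v w, B (fb (π p)) (eb v) (eb w) = B (π p) v w := by
    intro v w
    have h3 : eb v = (mfderiv 𝓘(ℝ, E_M) 𝓘(ℝ, E_M) fb (π p) : E_M →L[ℝ] E_M) v := by rw [← heb]; rfl
    have h4 : eb w = (mfderiv 𝓘(ℝ, E_M) 𝓘(ℝ, E_M) fb (π p) : E_M →L[ℝ] E_M) w := by rw [← heb]; rfl
    rw [h3, h4]
    exact hgp v w
  have hcomp (ψ : E_M [⋀^Fin s]→L[ℝ] E_G) :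
      (ψ.compContinuousLinearMap D').compContinuousLinearMap Df =
        (ψ.compContinuousLinearMap (eb : E_M →L[ℝ] E_M)).compContinuousLinearMap D :=
    congrArg (fun L : E_P →L[ℝ] E_M => ψ.compContinuousLinearMap L) h1
  have hcomp2 : (φp.compContinuousLinearMap Γ').compContinuousLinearMap (eb : E_M →L[ℝ] E_M) =
      (φp.compContinuousLinearMap Df).compContinuousLinearMap Γ :=
    congrArg (fun L : E_M →L[ℝ] E_P => φp.compContinuousLinearMap L) h2
  rw [hcomp, hS.proj, hodge_comp eb _ _ hgp', hcomp2, heb]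

end IsSymmetry

variable [IsManifold 𝓘(ℝ, E_M) ∞ M] [FiniteDimensional ℝ E_M]

theorem hodgeStar_smul_form (π : P → M) (A : DForm E_P P 1 E_G) (g : Metric E_M M)
    {μ μ' : DForm E_M M n ℝ} (h : r + s = n) (φ : DForm E_P P r E_G) (ε : ℝ) {p : P}
    (hμ : μ' (π p) = ε • μ (π p)) :
    hodgeStar π A g μ' h φ p = ε • hodgeStar π A g μ h φ p := by
  let B : E_M →L[ℝ] E_M →L[ℝ] ℝ := g.inner (π p)
  let ν : M → E_M [⋀^Fin n]→L[ℝ] ℝ := μ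
  let ν' : M → E_M [⋀^Fin n]→L[ℝ] ℝ := μ'
  let φ' : E_M [⋀^Fin r]→L[ℝ] E_G :=
    ContinuousAlternatingMap.compContinuousLinearMap (φ p) (horLift π A p)
  let D : E_P →L[ℝ] E_M := mfderiv 𝓘(ℝ, E_P) 𝓘(ℝ, E_M) π p
  have hν : ν' (π p) = ε • ν (π p) := hμ
  change (hodge B h (ν' (π p)) φ').compContinuousLinearMap D =
    ε • (hodge B h (ν (π p)) φ').compContinuousLinearMap D
  rw [hν, hodge_smul_form]
  rfl

theorem hodgeStar_smul_arg (π : P → M) (A : DForm E_P P 1 E_G) (g : Metric E_M M)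
    (μ : DForm E_M M n ℝ) (h : r + s = n) {φ ψ : DForm E_P P r E_G} (ε : ℝ) {p : P}
    (hφ : φ p = ε • ψ p) :
    hodgeStar π A g μ h φ p = ε • hodgeStar π A g μ h ψ p := by
  let B : E_M →L[ℝ] E_M →L[ℝ] ℝ := g.inner (π p)
  let ν : E_M [⋀^Fin n]→L[ℝ] ℝ := μ (π p)
  let φ' : E_P [⋀^Fin r]→L[ℝ] E_G := φ p
  let ψ' : E_P [⋀^Fin r]→L[ℝ] E_G := ψ p
  let Γ : E_M →L[ℝ] E_P := horLift π A p
  let D : E_P →L[ℝ] E_M := mfderiv 𝓘(ℝ, E_P) 𝓘(ℝ, E_M) π p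
  have hφ' : φ' = ε • ψ' := hφ
  have h1 : φ'.compContinuousLinearMap Γ = ε • ψ'.compContinuousLinearMap Γ := by rw [hφ']; rfl
  change (hodge B h ν (φ'.compContinuousLinearMap Γ)).compContinuousLinearMap D =
    ε • (hodge B h ν (ψ'.compContinuousLinearMap Γ)).compContinuousLinearMap D
  rw [h1, hodge_smul_arg]
  rfl

end Symmetry

/-! ### Volume forms under isometries -/

section VolumeForms

variable {E_M : Type*} [NormedAddCommGroup E_M] [NormedSpace ℝ E_M] [FiniteDimensional ℝ E_M]
  {M : Type*} [TopologicalSpace M] [ChartedSpace E_M M] [IsManifold 𝓘(ℝ, E_M) ∞ M]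

theorem exists_orthonormal_basis (g : Metric E_M M) (x : M) :
    ∃ e : Module.Basis (Fin (Module.finrank ℝ E_M)) ℝ (TangentSpace 𝓘(ℝ, E_M) x),
      ∀ i j, g.inner x (e i) (e j) = if i = j then 1 else 0 := by
  let core := g.toRiemannianMetric.toCore x
  let : NormedAddCommGroup (TangentSpace 𝓘(ℝ, E_M) x) := core.toNormedAddCommGroup
  let : InnerProductSpace ℝ (TangentSpace 𝓘(ℝ, E_M) x) := InnerProductSpace.ofCore core.toCore
  have : FiniteDimensional ℝ (TangentSpace 𝓘(ℝ, E_M) x) :=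
    inferInstanceAs (FiniteDimensional ℝ E_M)
  let e := stdOrthonormalBasis ℝ (TangentSpace 𝓘(ℝ, E_M) x)
  refine ⟨e.toBasis, fun i j => ?_⟩
  have h := orthonormal_iff_ite.1 e.orthonormal i j
  rw [← congrFun e.coe_toBasis i, ← congrFun e.coe_toBasis j] at h
  exact h

theorem eq_smul_of_abs_eq_one {V : Type*} [AddCommGroup V] [Module ℝ V] [TopologicalSpace V] {n : ℕ}
    (e : Module.Basis (Fin n) ℝ V) (μ μ' : V [⋀^Fin n]→L[ℝ] ℝ) (h : |μ e| = 1) (h' : |μ' e| = 1) :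
    ∃ δ : ℝ, |δ| = 1 ∧ μ' = δ • μ := by
  have hμ0 : μ e ≠ 0 := by
    intro h0
    simp [h0] at h
  refine ⟨μ' e / μ e, by rw [abs_div, h, h', div_one], ?_⟩
  apply ContinuousAlternatingMap.toAlternatingMap_injective
  have h1 := AlternatingMap.eq_smul_basis_det e μ.toAlternatingMap
  have h2 := AlternatingMap.eq_smul_basis_det e μ'.toAlternatingMap
  ext v
  have h1v : μ v = μ e * e.det v := DFunLike.congr_fun h1 v
  have h2v : μ' v = μ' e * e.det v := DFunLike.congr_fun h2 v
  change μ' v = μ' e / μ e * μ v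
  rw [h1v, h2v]
  field_simp

/-- The pull-back of a volume form under an isometry is, near a fixed point, `±` that form: the
quotient of the two forms has values `±1` and is continuous. -/
theorem exists_sign_pullback_volumeForm (g : Metric E_M M) {U : Set M} (hU : IsOpen U)
    {μ : DForm E_M M (Module.finrank ℝ E_M) ℝ} (hμ : IsVolumeForm g U μ) {fb : M → M}
    (hfb : ContMDiff 𝓘(ℝ, E_M) 𝓘(ℝ, E_M) ∞ fb)
    (hg : ∀ (x : M) (v w : TangentSpace 𝓘(ℝ, E_M) x),
      g.inner (fb x) (mfderiv 𝓘(ℝ, E_M) 𝓘(ℝ, E_M) fb x v)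
        (mfderiv 𝓘(ℝ, E_M) 𝓘(ℝ, E_M) fb x w) = g.inner x v w)
    {x : M} (hx : x ∈ U) (hfx : fb x = x) :
    ∃ ε : ℝ, ε * ε = 1 ∧ ∀ᶠ y in 𝓝 x, DForm.pullback (E' := E_M) fb μ y = ε • μ y := by
  set c := chartAt E_M x
  set μ' := DForm.pullback (E' := E_M) fb μ
  have hc0 : c.symm (c x) = x := c.left_inv (mem_chart_source E_M x)
  have hcx : c x ∈ c.target := mem_chart_target E_M x
  have hpt : ∀ y ∈ U, fb y ∈ U → ∃ δ : ℝ, |δ| = 1 ∧ μ' y = δ • μ y := by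
    intro y hy hfy
    obtain ⟨e, he⟩ := exists_orthonormal_basis g y
    refine eq_smul_of_abs_eq_one e (μ y) (μ' y) (hμ.2 y hy e he) ?_
    exact hμ.2 (fb y) hfy (fun i => mfderiv 𝓘(ℝ, E_M) 𝓘(ℝ, E_M) fb y (e i))
      fun i j => (hg y _ _).trans (he i j)
  have hcont : ContinuousAt c.symm (c x) := c.symm.continuousAt hcx
  have hev : ∀ᶠ z in 𝓝 (c x), c.symm z ∈ U ∧ fb (c.symm z) ∈ U := by
    refine hcont (show {y | y ∈ U ∧ fb y ∈ U} ∈ 𝓝 (c.symm (c x)) from ?_)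
    rw [hc0]
    refine (hU.inter (hU.preimage hfb.continuous)).mem_nhds ⟨hx, ?_⟩
    rw [Set.mem_preimage, hfx]
    exact hx
  have hm : DifferentiableAt ℝ (μ.inChart x) (c x) := by
    refine ((hμ.1 x).contDiffAt ?_).differentiableAt (by simp)
    exact Filter.inter_mem (c.open_target.mem_nhds hcx) (hev.mono fun z hz => hz.1)
  have hm' : DifferentiableAt ℝ (μ'.inChart x) (c x) := by
    refine DForm.differentiableAt_inChart_pullback μ hfb x ?_
    rw [hfx]
    exact hm
  -- a tuple on which the local expression of `μ` does not vanish at the base point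
  obtain ⟨w, hw⟩ : ∃ w : Fin (Module.finrank ℝ E_M) → E_M, μ.inChart x (c x) w ≠ 0 := by
    obtain ⟨e, he⟩ := exists_orthonormal_basis g (c.symm (c x))
    have hsurj : Function.Surjective (mfderiv 𝓘(ℝ, E_M) 𝓘(ℝ, E_M) c.symm (c x)) :=
      (mdifferentiable_chart (I := 𝓘(ℝ, E_M)) x).symm.mfderiv_surjective hcx
    choose w hw using fun i => hsurj (e i)
    refine ⟨w, fun h0 => ?_⟩
    have h1 := hμ.2 (c.symm (c x)) (by rw [hc0]; exact hx) e he
    have h2 : μ (c.symm (c x)) (fun i => mfderiv 𝓘(ℝ, E_M) 𝓘(ℝ, E_M) c.symm (c x) (w i)) = 0 := h0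
    simp only [hw] at h2
    rw [h2] at h1
    simp at h1
  have hδ : ∀ᶠ z in 𝓝 (c x), ∃ δ : ℝ, |δ| = 1 ∧ μ' (c.symm z) = δ • μ (c.symm z) ∧
      μ'.inChart x z w = δ * μ.inChart x z w := by
    filter_upwards [hev] with z hz
    obtain ⟨δ, h1, h2⟩ := hpt _ hz.1 hz.2
    refine ⟨δ, h1, h2, ?_⟩
    exact congrArg (fun ψ => ψ (fun i => mfderiv 𝓘(ℝ, E_M) 𝓘(ℝ, E_M) c.symm z (w i))) h2
  have happ (ψ : E_M → E_M [⋀^Fin (Module.finrank ℝ E_M)]→L[ℝ] ℝ) (hψ : ContinuousAt ψ (c x)) :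
      ContinuousAt (fun z => ψ z w) (c x) :=
    ((ContinuousAlternatingMap.apply ℝ E_M ℝ w).continuous.continuousAt).comp hψ
  have hmw := happ _ hm.continuousAt
  have hq : ContinuousAt (fun z => μ'.inChart x z w / μ.inChart x z w) (c x) :=
    (happ _ hm'.continuousAt).div hmw hw
  obtain ⟨ε, hε, -, hεw⟩ := hδ.self_of_nhds
  have hε0 : μ'.inChart x (c x) w / μ.inChart x (c x) w = ε := by rw [hεw]; field_simp
  have hcase (t : ℝ) (ht : |t| = 1) : t = 1 ∨ t = -1 := by
    rcases abs_choice t with h | h <;> rw [h] at ht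
    · exact Or.inl ht
    · exact Or.inr (by linarith)
  refine ⟨ε, by rcases hcase ε hε with h | h <;> rw [h] <;> norm_num, ?_⟩
  have hnear : ∀ᶠ z in 𝓝 (c x), |μ'.inChart x z w / μ.inChart x z w - ε| < 1 := by
    have h := Metric.continuousAt_iff'.1 hq 1 one_pos
    simpa only [hε0, Real.dist_eq] using h
  have hfin : ∀ᶠ z in 𝓝 (c x), μ' (c.symm z) = ε • μ (c.symm z) := by
    filter_upwards [hδ, hnear, hmw.eventually_ne hw] with z ⟨δ, h1, h2, h3⟩ h4 h5
    have h6 : μ'.inChart x z w / μ.inChart x z w = δ := by rw [h3]; field_simp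
    rw [h6] at h4
    have h7 : δ = ε := by
      rcases hcase δ h1 with h | h <;> rcases hcase ε hε with h' | h' <;> rw [h, h'] at h4 ⊢ <;>
        norm_num at h4
    rw [h2, h7]
  have hcc : ContinuousAt c x := c.continuousAt (mem_chart_source E_M x)
  filter_upwards [hcc.eventually hfin, c.open_source.mem_nhds (mem_chart_source E_M x)]
    with y hy hys
  rwa [c.left_inv hys] at hy

end VolumeForms

/-! ### Vanishing of the codifferential of the curvature at a fixed point of a symmetry -/

section Vanishing

variable {E_P E_G E_M : Type*} [NormedAddCommGroup E_P] [NormedSpace ℝ E_P]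
  [NormedAddCommGroup E_G] [NormedSpace ℝ E_G] [NormedAddCommGroup E_M] [NormedSpace ℝ E_M]
  [FiniteDimensional ℝ E_M]
  {P G M : Type*} [TopologicalSpace P] [ChartedSpace E_P P] [IsManifold 𝓘(ℝ, E_P) ∞ P]
  [TopologicalSpace G] [ChartedSpace E_G G] [Group G]
  [TopologicalSpace M] [ChartedSpace E_M M] [IsManifold 𝓘(ℝ, E_M) ∞ M]
  {π : P → M} {R : P → G → P} {A : DForm E_P P 1 E_G} {f : P → P} {fb : M → M}

/-- If a symmetry of the connection fixes `p` and covers an isometry with differential `-1` at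
`π p`, then `δ_A Ω^A` vanishes at `p`: it is an invariant `1`-form which is basic, so at `p` it
equals its own negative. The Hodge operator enters twice, so the sign of the volume form is
irrelevant. -/
theorem codiff_curvature_eq_zero (hS : IsSymmetry (E_M := E_M) π R A f fb)
    (hπ : ContMDiff 𝓘(ℝ, E_P) 𝓘(ℝ, E_M) ∞ π) (hR1 : ∀ p, R p 1 = p)
    (hR : ∀ p, MDifferentiableAt 𝓘(ℝ, E_G) 𝓘(ℝ, E_P) (fun g : G => R p g) 1) (g : Metric E_M M)
    (hg : ∀ (x : M) (v w : TangentSpace 𝓘(ℝ, E_M) x),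
      g.inner (fb x) (mfderiv 𝓘(ℝ, E_M) 𝓘(ℝ, E_M) fb x v)
        (mfderiv 𝓘(ℝ, E_M) 𝓘(ℝ, E_M) fb x w) = g.inner x v w)
    {p : P} (hfp : f p = p)
    (hneg : ∀ v : E_M, (mfderiv 𝓘(ℝ, E_M) 𝓘(ℝ, E_M) fb (π p) : E_M →L[ℝ] E_M) v = -v)
    {U : Set M} (hU : IsOpen U) {μ : DForm E_M M (Module.finrank ℝ E_M) ℝ}
    (hμ : IsVolumeForm g U μ) (hp : π p ∈ U) :
    codiff π R A g μ (curvature R A) p = 0 := by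
  unfold codiff
  split_ifs with h
  swap
  · rfl
  set h1 : (1 + 1) + (Module.finrank ℝ E_M - (1 + 1)) = Module.finrank ℝ E_M := by omega
  set h2 : (Module.finrank ℝ E_M - (1 + 1) + 1) + 1 = Module.finrank ℝ E_M := by omega
  set ψ := hodgeStar π A g μ h1 (curvature R A)
  set X := hodgeStar π A g μ h2 (covDeriv R A ψ) with hX
  have hfb : fb (π p) = π p := by rw [← hS.proj, hfp]
  obtain ⟨ε, hε, hev⟩ := exists_sign_pullback_volumeForm g hU hμ hS.smooth_base hg hp hfb
  have hψ : ∀ᶠ q in 𝓝 p, DForm.pullback f ψ q = ε • ψ q := by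
    filter_upwards [hπ.continuous.continuousAt.eventually hev] with q hq
    rw [hS.hodgeStar_pullback hπ g hg, hS.pullback_curvature hR1 hR]
    exact hodgeStar_smul_form π A g h1 _ ε hq
  have hDψ : covDeriv R A (DForm.pullback f ψ) p = ε • covDeriv R A ψ p := by
    unfold covDeriv
    rw [DForm.extDer_eq_smul_of_eventually ε hψ]
    rfl
  have hinv : DForm.pullback f X p = X p := by
    rw [hX, hS.hodgeStar_pullback hπ g hg, ← hS.covDeriv_pullback hR1 hR,
      hodgeStar_smul_form π A g h2 _ ε hev.self_of_nhds, hodgeStar_smul_arg π A g μ h2 ε hDψ,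
      smul_smul, hε, one_smul]
  have hXp : X p = 0 := by
    let X' : P → E_P [⋀^Fin 1]→L[ℝ] E_G := X
    let D (q : P) : E_P →L[ℝ] E_M := mfderiv 𝓘(ℝ, E_P) 𝓘(ℝ, E_M) π q
    let Df : E_P →L[ℝ] E_P := mfderiv 𝓘(ℝ, E_P) 𝓘(ℝ, E_P) f p
    obtain ⟨γ, hγ⟩ : ∃ γ : E_M [⋀^Fin 1]→L[ℝ] E_G, X' p = γ.compContinuousLinearMap (D p) :=
      ⟨_, rfl⟩
    have e1 : (X' (f p)).compContinuousLinearMap Df = X' p := hinv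
    have e2 : (D (f p)).comp Df =
      (mfderiv 𝓘(ℝ, E_M) 𝓘(ℝ, E_M) fb (π p) : E_M →L[ℝ] E_M).comp (D p) := hS.mfderiv_proj hπ p
    rw [hfp] at e1 e2
    have e3 (v : E_P) : D p (Df v) = -D p v := (DFunLike.congr_fun e2 v).trans (hneg _)
    change X' p = 0
    ext v
    have e4 : X' p v = -X' p v := by
      conv_lhs => rw [← e1]
      have e5 : (D p ∘ (Df ∘ v)) = fun i => (-1 : ℝ) • (D p ∘ v) i := by
        funext i
        simp [e3]
      rw [hγ]
      simp only [ContinuousAlternatingMap.compContinuousLinearMap_apply]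
      rw [e5, γ.map_smul_univ]
      simp
    have e6 : (2 : ℝ) • X' p v = 0 := by
      rw [two_smul]
      nth_rewrite 1 [e4]
      exact neg_add_cancel _
    exact (smul_eq_zero.1 e6).resolve_left two_ne_zero
  rw [Pi.smul_apply, hXp, smul_zero]

end Vanishing

/-! ### Submersions and their local sections -/

section Submersion

variable {E H M : Type*} [NormedAddCommGroup E] [NormedSpace ℝ E] [TopologicalSpace H]
  {I : ModelWithCorners ℝ E H} [I.Boundaryless] [TopologicalSpace M] [ChartedSpace H M]
  {E' N : Type*} [NormedAddCommGroup E'] [NormedSpace ℝ E'] [TopologicalSpace N] [ChartedSpace E' N]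

omit [I.Boundaryless] in
theorem contMDiffAt_extend_of_mem_maximalAtlas {e : OpenPartialHomeomorph M H}
    (he : e ∈ IsManifold.maximalAtlas I ∞ M) {x : M} (hx : x ∈ e.source) :
    ContMDiffAt I 𝓘(ℝ, E) ∞ (e.extend I) x := by
  have h : ContMDiffAt I 𝓘(ℝ, E) ∞ I (e x) := I.contMDiff.contMDiffAt
  exact h.comp x ((contMDiffOn_of_mem_maximalAtlas he).contMDiffAt (e.open_source.mem_nhds hx))

theorem contMDiffAt_extend_symm_of_mem_maximalAtlas {e : OpenPartialHomeomorph M H}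
    (he : e ∈ IsManifold.maximalAtlas I ∞ M) {y : E} (hy : y ∈ (e.extend I).target) :
    ContMDiffAt 𝓘(ℝ, E) I ∞ (e.extend I).symm y := by
  refine (contMDiffOn_extend_symm he).contMDiffAt ?_
  have h := e.isOpen_extend_target (I := I)
  rw [e.extend_target_eq_image_source (I := I)] at h hy
  refine Filter.mem_of_superset (h.mem_nhds hy) ?_
  rintro _ ⟨x, hx, rfl⟩
  exact ⟨e x, e.map_source hx, rfl⟩

variable {f : M → N} {a : M}

/-- A submersion has smooth local sections through every point. -/
theorem exists_local_section (hf : Manifold.IsSubmersionAt I 𝓘(ℝ, E') ∞ f a) :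
    ∃ s : N → M, ContMDiffAt 𝓘(ℝ, E') I ∞ s (f a) ∧ s (f a) = a ∧ ∀ᶠ z in 𝓝 (f a), f (s z) = z := by
  set φ := hf.domChart.extend I
  set ψ := hf.codChart
  have haφ : a ∈ φ.source := by
    rw [hf.domChart.extend_source]; exact hf.mem_domChart_source
  have hψ : ContMDiffAt 𝓘(ℝ, E') 𝓘(ℝ, E') ∞ ψ (f a) :=
    (contMDiffOn_of_mem_maximalAtlas hf.codChart_mem_maximalAtlas).contMDiffAt
      (ψ.open_source.mem_nhds hf.mem_codChart_source)
  have hw : ∀ w ∈ φ.target, ψ (f (φ.symm w)) = (hf.equiv w).1 := fun w hw => hf.writtenInCharts hw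
  have hfa : ψ (f a) = (hf.equiv (φ a)).1 := by
    rw [← hw _ (φ.map_source haφ), φ.left_inv haφ]
  let u : N → E := fun z => hf.equiv.symm (ψ z, (hf.equiv (φ a)).2)
  have hua : u (f a) = φ a := by
    change hf.equiv.symm (ψ (f a), _) = _
    rw [hfa]
    exact hf.equiv.symm_apply_apply _
  have hu : ContMDiffAt 𝓘(ℝ, E') 𝓘(ℝ, E) ∞ u (f a) := by
    have h1 : ContDiff ℝ ∞ (fun y : E' => hf.equiv.symm (y, (hf.equiv (φ a)).2)) :=
      hf.equiv.symm.contDiff.comp (contDiff_id.prodMk contDiff_const)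
    exact h1.contMDiff.contMDiffAt.comp (f a) hψ
  refine ⟨fun z => φ.symm (u z), ?_, ?_, ?_⟩
  · refine ContMDiffAt.comp (f a) (contMDiffAt_extend_symm_of_mem_maximalAtlas
      hf.domChart_mem_maximalAtlas ?_) hu
    rw [hua]
    exact φ.map_source haφ
  · simp only [hua]
    exact φ.left_inv haφ
  · have hev : ∀ᶠ z in 𝓝 (f a), u z ∈ φ.target :=
      hu.continuousAt (by
        rw [hua]
        exact (hf.domChart.isOpen_extend_target (I := I)).mem_nhds (φ.map_source haφ))
    filter_upwards [hev, ψ.open_source.mem_nhds hf.mem_codChart_source] with z hz hzs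
    have h1 : φ.symm (u z) ∈ hf.domChart.source := by
      rw [← hf.domChart.extend_source (I := I)]; exact φ.map_target hz
    refine ψ.injOn (hf.source_subset_preimage_source h1) hzs ?_
    rw [hw _ hz]
    simp [u]

omit [I.Boundaryless] in
theorem mfderiv_comp_section (hf : Manifold.IsSubmersionAt I 𝓘(ℝ, E') ∞ f a) {s : N → M}
    (hs : ContMDiffAt 𝓘(ℝ, E') I ∞ s (f a)) (hsa : s (f a) = a)
    (hfs : ∀ᶠ z in 𝓝 (f a), f (s z) = z) :
    (mfderiv I 𝓘(ℝ, E') f a : E →L[ℝ] E').comp (mfderiv 𝓘(ℝ, E') I s (f a) : E' →L[ℝ] E) =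
      ContinuousLinearMap.id ℝ E' := by
  have hfd : MDifferentiableAt I 𝓘(ℝ, E') f (s (f a)) := by
    rw [hsa]; exact hf.contMDiffAt.mdifferentiableAt (by simp)
  have h := mfderiv_comp (f a) hfd (hs.mdifferentiableAt (by simp))
  have h2 : mfderiv 𝓘(ℝ, E') 𝓘(ℝ, E') (f ∘ s) (f a) = mfderiv 𝓘(ℝ, E') 𝓘(ℝ, E') id (f a) :=
    Filter.EventuallyEq.mfderiv_eq hfs
  rw [mfderiv_id] at h2
  rw [hsa] at h
  exact h.symm.trans h2

theorem mfderiv_surjective_of_isSubmersionAt (hf : Manifold.IsSubmersionAt I 𝓘(ℝ, E') ∞ f a) :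
    Function.Surjective (mfderiv I 𝓘(ℝ, E') f a) := by
  obtain ⟨s, hs, hsa, hfs⟩ := exists_local_section hf
  intro w
  exact ⟨_, DFunLike.congr_fun (mfderiv_comp_section hf hs hsa hfs) w⟩

/-- Smoothness of a map out of the target of a surjective submersion can be tested after
composition with the submersion. -/
theorem contMDiff_of_comp_submersion {E'' H'' Q : Type*} [NormedAddCommGroup E'']
    [NormedSpace ℝ E''] [TopologicalSpace H''] {J : ModelWithCorners ℝ E'' H''}
    [TopologicalSpace Q] [ChartedSpace H'' Q]
    (hf : Manifold.IsSubmersion I 𝓘(ℝ, E') ∞ f) (hsurj : Function.Surjective f) {k : N → Q}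
    (hk : ContMDiff I J ∞ (k ∘ f)) : ContMDiff 𝓘(ℝ, E') J ∞ k := by
  intro z
  obtain ⟨a, rfl⟩ := hsurj z
  obtain ⟨s, hs, hsa, hfs⟩ := exists_local_section (hf.isSubmersionAt a)
  have h := hk.contMDiffAt.comp (f a) hs
  refine h.congr_of_eventuallyEq ?_
  filter_upwards [hfs] with z hz
  simp [hz]

end Submersion

/-! ### Differentials as maps between the model spaces -/

section Differential

variable {E₁ H₁ M₁ E₂ H₂ M₂ E₃ H₃ M₃ : Type*}
  [NormedAddCommGroup E₁] [NormedSpace ℝ E₁] [TopologicalSpace H₁] {I₁ : ModelWithCorners ℝ E₁ H₁}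
  [TopologicalSpace M₁] [ChartedSpace H₁ M₁]
  [NormedAddCommGroup E₂] [NormedSpace ℝ E₂] [TopologicalSpace H₂] {I₂ : ModelWithCorners ℝ E₂ H₂}
  [TopologicalSpace M₂] [ChartedSpace H₂ M₂]
  [NormedAddCommGroup E₃] [NormedSpace ℝ E₃] [TopologicalSpace H₃] {I₃ : ModelWithCorners ℝ E₃ H₃}
  [TopologicalSpace M₃] [ChartedSpace H₃ M₃]

variable (I₁ I₂) in
/-- The differential `mfderiv` read as a map between the model spaces, which the tangent spaces are
by definition. This avoids types that depend on the value of a map at a point. -/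
def tdiff (f : M₁ → M₂) (x : M₁) : E₁ →L[ℝ] E₂ := mfderiv I₁ I₂ f x

theorem tdiff_comp {g : M₂ → M₃} {f : M₁ → M₂} {x : M₁} {y : M₂} (hg : MDifferentiableAt I₂ I₃ g y)
    (hf : MDifferentiableAt I₁ I₂ f x) (hy : f x = y) :
    tdiff I₁ I₃ (fun z => g (f z)) x = (tdiff I₂ I₃ g y).comp (tdiff I₁ I₂ f x) := by
  subst hy
  exact mfderiv_comp x hg hf

theorem tdiff_congr {f f' : M₁ → M₂} {x : M₁} (h : f =ᶠ[𝓝 x] f') :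
    tdiff I₁ I₂ f x = tdiff I₁ I₂ f' x := h.mfderiv_eq

theorem tdiff_id (x : M₁) : tdiff I₁ I₁ (fun z => z) x = ContinuousLinearMap.id ℝ E₁ := mfderiv_id

theorem tdiff_const (x : M₁) (c : M₂) : tdiff I₁ I₂ (fun _ => c) x = 0 := mfderiv_const

theorem tdiff_prodMk {f : M₁ → M₂} {g : M₁ → M₃} {x : M₁} (hf : MDifferentiableAt I₁ I₂ f x)
    (hg : MDifferentiableAt I₁ I₃ g x) :
    tdiff I₁ (I₂.prod I₃) (fun z => (f z, g z)) x = (tdiff I₁ I₂ f x).prod (tdiff I₁ I₃ g x) :=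
  mfderiv_prodMk hf hg

end Differential

/-! ### Differential calculus on Lie groups -/

section LieGroups

variable {E_G : Type*} [NormedAddCommGroup E_G] [NormedSpace ℝ E_G]
  {G : Type*} [TopologicalSpace G] [ChartedSpace E_G G] [Group G] [LieGroup 𝓘(ℝ, E_G) ∞ G]
  {E H N : Type*} [NormedAddCommGroup E] [NormedSpace ℝ E] [TopologicalSpace H]
  {J : ModelWithCorners ℝ E H} [TopologicalSpace N] [ChartedSpace H N]

/-- The left Maurer–Cartan form of a Lie group: `X ↦ k⁻¹ X` on `T_k G`. -/
def maurerCartan (k : G) : E_G →L[ℝ] E_G :=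
  mfderiv 𝓘(ℝ, E_G) 𝓘(ℝ, E_G) (fun x : G => k⁻¹ * x) k

theorem mdifferentiable_mul_left (a : G) :
    MDifferentiable 𝓘(ℝ, E_G) 𝓘(ℝ, E_G) (fun x : G => a * x) :=
  (contMDiff_mul_left (I := 𝓘(ℝ, E_G)) (n := ∞)).mdifferentiable (by simp)

theorem mdifferentiable_conj (a : G) :
    MDifferentiable 𝓘(ℝ, E_G) 𝓘(ℝ, E_G) (fun x : G => a * x * a⁻¹) :=
  ((contMDiff_mul_right (I := 𝓘(ℝ, E_G)) (n := ∞)).comp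
    (contMDiff_mul_left (I := 𝓘(ℝ, E_G)) (n := ∞))).mdifferentiable (by simp)

theorem maurerCartan_comp {u : N → G} {y : N} (hu : MDifferentiableAt J 𝓘(ℝ, E_G) u y) :
    (maurerCartan (u y)).comp (tdiff J 𝓘(ℝ, E_G) u y) =
      tdiff J 𝓘(ℝ, E_G) (fun z => (u y)⁻¹ * u z) y :=
  (tdiff_comp (mdifferentiable_mul_left ((u y)⁻¹) (u y)) hu rfl).symm

/-- A curve `w` through `1` is conjugated by `a` to a curve with velocity `Ad_a w'`. -/
theorem tdiff_conj {w : N → G} {y : N} (hw : MDifferentiableAt J 𝓘(ℝ, E_G) w y) (hwy : w y = 1)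
    (a : G) : tdiff J 𝓘(ℝ, E_G) (fun z => a * w z * a⁻¹) y =
      (Ad a : E_G →L[ℝ] E_G).comp (tdiff J 𝓘(ℝ, E_G) w y) :=
  tdiff_comp (g := fun x => a * x * a⁻¹) (mdifferentiable_conj a 1) hw hwy

theorem Ad_mul (a b : G) :
    (Ad (a * b) : E_G →L[ℝ] E_G) = (Ad a : E_G →L[ℝ] E_G).comp (Ad b : E_G →L[ℝ] E_G) := by
  refine Eq.trans ?_ (tdiff_conj (mdifferentiable_conj b 1) (by simp) a)
  change tdiff 𝓘(ℝ, E_G) 𝓘(ℝ, E_G) (fun x : G => a * b * x * (a * b)⁻¹) 1 = _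
  congr 1
  funext x
  group

omit [LieGroup 𝓘(ℝ, E_G) ∞ G] in
theorem Ad_one : (Ad (1 : G) : E_G →L[ℝ] E_G) = ContinuousLinearMap.id ℝ E_G := by
  change tdiff 𝓘(ℝ, E_G) 𝓘(ℝ, E_G) (fun x : G => 1 * x * 1⁻¹) 1 = _
  simp only [one_mul, inv_one, mul_one]
  exact tdiff_id 1

theorem tdiff_mul_of_eq_one {u v : N → G} {y : N} (hu : MDifferentiableAt J 𝓘(ℝ, E_G) u y)
    (hv : MDifferentiableAt J 𝓘(ℝ, E_G) v y) (huy : u y = 1) (hvy : v y = 1) :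
    tdiff J 𝓘(ℝ, E_G) (fun z => u z * v z) y =
      tdiff J 𝓘(ℝ, E_G) u y + tdiff J 𝓘(ℝ, E_G) v y := by
  have hm : MDifferentiableAt (𝓘(ℝ, E_G).prod 𝓘(ℝ, E_G)) 𝓘(ℝ, E_G)
      (fun p : G × G => p.1 * p.2) (1, 1) :=
    (contMDiff_mul 𝓘(ℝ, E_G) ∞).mdifferentiable (by simp) _
  have h1 : tdiff (𝓘(ℝ, E_G).prod 𝓘(ℝ, E_G)) 𝓘(ℝ, E_G) (fun p : G × G => p.1 * p.2) (1, 1) =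
      ContinuousLinearMap.fst ℝ E_G E_G + ContinuousLinearMap.snd ℝ E_G E_G := by
    have h2 : tdiff (𝓘(ℝ, E_G).prod 𝓘(ℝ, E_G)) 𝓘(ℝ, E_G) (fun p : G × G => p.1 * p.2) (1, 1) =
        tdiff (𝓘(ℝ, E_G).prod 𝓘(ℝ, E_G)) 𝓘(ℝ, E_G) (fun p : G × G => p.1 * 1) (1, 1) +
        tdiff (𝓘(ℝ, E_G).prod 𝓘(ℝ, E_G)) 𝓘(ℝ, E_G) (fun p : G × G => 1 * p.2) (1, 1) :=
      mfderiv_prod_eq_add hm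
    simp only [mul_one, one_mul] at h2
    rw [h2]
    congr 1
    · exact mfderiv_fst
    · exact mfderiv_snd
  rw [tdiff_comp (f := fun z => (u z, v z)) hm (hu.prodMk hv) (by rw [huy, hvy]), h1,
    tdiff_prodMk hu hv]
  ext w
  rfl

theorem tdiff_inv_of_eq_one {w : N → G} {y : N} (hw : MDifferentiableAt J 𝓘(ℝ, E_G) w y)
    (hwy : w y = 1) : tdiff J 𝓘(ℝ, E_G) (fun z => (w z)⁻¹) y = -tdiff J 𝓘(ℝ, E_G) w y := by
  have hi : MDifferentiableAt J 𝓘(ℝ, E_G) (fun z => (w z)⁻¹) y :=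
    ((contMDiff_inv 𝓘(ℝ, E_G) ∞).mdifferentiable (by simp) (w y)).comp y hw
  have h := tdiff_mul_of_eq_one hw hi hwy (by simp [hwy])
  simp only [mul_inv_cancel, tdiff_const] at h
  exact (neg_eq_of_add_eq_zero_right h.symm).symm

theorem tdiff_chartAt_self {E M : Type*} [NormedAddCommGroup E] [NormedSpace ℝ E]
    [TopologicalSpace M] [ChartedSpace E M] [IsManifold 𝓘(ℝ, E) 1 M] (x : M) :
    tdiff 𝓘(ℝ, E) 𝓘(ℝ, E) (chartAt E x) x = ContinuousLinearMap.id ℝ E := by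
  have h := mfderiv_extChartAt_self (I := 𝓘(ℝ, E)) (x := x)
  simp only [mfld_simps] at h
  exact h

theorem tdiff_chartAt_symm_self {E M : Type*} [NormedAddCommGroup E] [NormedSpace ℝ E]
    [TopologicalSpace M] [ChartedSpace E M] [IsManifold 𝓘(ℝ, E) 1 M] (x : M) :
    tdiff 𝓘(ℝ, E) 𝓘(ℝ, E) (chartAt E x).symm (chartAt E x x) = ContinuousLinearMap.id ℝ E := by
  have h : (tdiff 𝓘(ℝ, E) 𝓘(ℝ, E) (chartAt E x).symm (chartAt E x x)).comp
      (tdiff 𝓘(ℝ, E) 𝓘(ℝ, E) (chartAt E x) x) = ContinuousLinearMap.id ℝ E :=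
    (mdifferentiable_chart (I := 𝓘(ℝ, E)) x).symm_comp_deriv (mem_chart_source E x)
  rwa [tdiff_chartAt_self, ContinuousLinearMap.comp_id] at h

/-- The partial derivative of a smooth map `Φ`, at points where `Φ` has the constant value `b`,
depends smoothly on the parameter. -/
theorem contDiffAt_tdiff_of_eventually_const {E₁ E₂ E M : Type*} [NormedAddCommGroup E₁]
    [NormedSpace ℝ E₁] [NormedAddCommGroup E₂] [NormedSpace ℝ E₂] [NormedAddCommGroup E]
    [NormedSpace ℝ E] [TopologicalSpace M] [ChartedSpace E M] [IsManifold 𝓘(ℝ, E) ∞ M]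
    {Φ : E₁ → E₂ → M} {k : E₁ → E₂} {y₀ : E₁} {b : M}
    (hΦ : ContMDiffAt 𝓘(ℝ, E₁ × E₂) 𝓘(ℝ, E) ∞ (Function.uncurry Φ) (y₀, k y₀))
    (hk : ContDiffAt ℝ ∞ k y₀) (hb : ∀ᶠ y in 𝓝 y₀, Φ y (k y) = b) :
    ContDiffAt ℝ ∞ (fun y => tdiff 𝓘(ℝ, E₂) 𝓘(ℝ, E) (Φ y) (k y)) y₀ := by
  have : IsManifold 𝓘(ℝ, E) 1 M := IsManifold.of_le (n := ∞) (by simp)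
  set c := chartAt E b
  have hb0 : Function.uncurry Φ (y₀, k y₀) = b := hb.self_of_nhds
  have hc : ContMDiffAt 𝓘(ℝ, E) 𝓘(ℝ, E) ∞ c (Function.uncurry Φ (y₀, k y₀)) := by
    rw [hb0]
    exact contMDiffOn_chart.contMDiffAt (c.open_source.mem_nhds (mem_chart_source E b))
  have h1 : ContDiffAt ℝ ∞ (Function.uncurry fun y z => c (Φ y z)) (y₀, k y₀) := by
    rw [← contMDiffAt_iff_contDiffAt]
    exact hc.comp _ hΦ
  have h2 := h1.fderiv hk (m := ∞) (by simp)
  refine h2.congr_of_eventuallyEq ?_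
  have h3 : ∀ᶠ p in 𝓝 (y₀, k y₀),
      MDifferentiableAt 𝓘(ℝ, E₁ × E₂) 𝓘(ℝ, E) (Function.uncurry Φ) p := by
    have h4 := (contMDiffAt_iff_contMDiffAt_nhds (n := 1) (by simp)).1 (hΦ.of_le (by simp))
    exact h4.mono fun p hp => hp.mdifferentiableAt (by simp)
  have h5 : ContinuousAt (fun y => (y, k y)) y₀ := continuousAt_id.prodMk hk.continuousAt
  filter_upwards [hb, h5.eventually h3] with y hy hyd
  have h6 : MDifferentiableAt 𝓘(ℝ, E₂) 𝓘(ℝ, E) (Φ y) (k y) := by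
    have h7 : MDifferentiableAt 𝓘(ℝ, E₂) 𝓘(ℝ, E₁ × E₂) (fun z : E₂ => (y, z)) (k y) :=
      ((hasFDerivAt_prodMk_right y (k y)).differentiableAt).mdifferentiableAt
    exact MDifferentiableAt.comp (k y) (f := fun z : E₂ => (y, z)) hyd h7
  have h8 : MDifferentiableAt 𝓘(ℝ, E) 𝓘(ℝ, E) c b :=
    mdifferentiableAt_atlas (chart_mem_atlas E b) (mem_chart_source E b)
  have h9 := tdiff_comp h8 h6 hy
  rw [tdiff_chartAt_self, ContinuousLinearMap.id_comp] at h9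
  rw [← h9, tdiff, mfderiv_eq_fderiv]

theorem contDiffAt_tdiff_inv_mul {E : Type*} [NormedAddCommGroup E] [NormedSpace ℝ E]
    {u : E → G} {y₀ : E} (hu : ContMDiffAt 𝓘(ℝ, E) 𝓘(ℝ, E_G) ∞ u y₀) :
    ContDiffAt ℝ ∞ (fun y => tdiff 𝓘(ℝ, E) 𝓘(ℝ, E_G) (fun z => (u y)⁻¹ * u z) y) y₀ := by
  have : IsManifold 𝓘(ℝ, E_G) ∞ G := inferInstance
  refine contDiffAt_tdiff_of_eventually_const (Φ := fun y z => (u y)⁻¹ * u z) (k := id) (b := 1)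
    ?_ contDiffAt_id (Filter.Eventually.of_forall fun y => by simp)
  have h1 : ContMDiffAt 𝓘(ℝ, E × E) 𝓘(ℝ, E_G) ∞ (fun p : E × E => u p.1) (y₀, y₀) :=
    ContMDiffAt.comp (y₀, y₀) (f := Prod.fst) hu contDiffAt_fst.contMDiffAt
  have h2 : ContMDiffAt 𝓘(ℝ, E × E) 𝓘(ℝ, E_G) ∞ (fun p : E × E => u p.2) (y₀, y₀) :=
    ContMDiffAt.comp (y₀, y₀) (f := Prod.snd) hu contDiffAt_snd.contMDiffAt
  exact h1.inv.mul h2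

theorem contDiffAt_Ad_inv {E : Type*} [NormedAddCommGroup E] [NormedSpace ℝ E]
    {u : E → G} {y₀ : E} (hu : ContMDiffAt 𝓘(ℝ, E) 𝓘(ℝ, E_G) ∞ u y₀) :
    ContDiffAt ℝ ∞ (fun y => (Ad (u y)⁻¹ : E_G →L[ℝ] E_G)) y₀ := by
  have : IsManifold 𝓘(ℝ, E_G) ∞ G := inferInstance
  have : IsManifold 𝓘(ℝ, E_G) 1 G := IsManifold.of_le (n := ∞) (by simp)
  set c := chartAt E_G (1 : G)
  have hc1 : c.symm (c 1) = 1 := c.left_inv (mem_chart_source E_G 1)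
  have hcs : ContMDiffAt 𝓘(ℝ, E_G) 𝓘(ℝ, E_G) ∞ c.symm (c 1) :=
    contMDiffOn_chart_symm.contMDiffAt (c.open_target.mem_nhds (mem_chart_target E_G 1))
  have h := contDiffAt_tdiff_of_eventually_const (E := E_G) (y₀ := y₀)
    (Φ := fun y z => (u y)⁻¹ * c.symm z * (u y)⁻¹⁻¹) (k := fun _ => c 1) (b := 1)
    ?_ contDiffAt_const (Filter.Eventually.of_forall fun y => by simp [hc1])
  · refine h.congr_of_eventuallyEq (Filter.Eventually.of_forall fun y => ?_)
    have h1 := tdiff_conj (hcs.mdifferentiableAt (by simp)) hc1 (u y)⁻¹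
    rw [tdiff_chartAt_symm_self, ContinuousLinearMap.comp_id] at h1
    exact h1.symm
  · have h1 : ContMDiffAt 𝓘(ℝ, E × E_G) 𝓘(ℝ, E_G) ∞ (fun p : E × E_G => u p.1) (y₀, c 1) :=
      ContMDiffAt.comp (y₀, c 1) (f := Prod.fst) hu contDiffAt_fst.contMDiffAt
    have h2 : ContMDiffAt 𝓘(ℝ, E × E_G) 𝓘(ℝ, E_G) ∞ (fun p : E × E_G => c.symm p.2) (y₀, c 1) :=
      ContMDiffAt.comp (y₀, c 1) (f := Prod.snd) hcs contDiffAt_snd.contMDiffAt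
    exact (h1.inv.mul h2).mul h1.inv.inv

end LieGroups

/-! ### Immersions and embeddings -/

section Immersion

variable {E H M : Type*} [NormedAddCommGroup E] [NormedSpace ℝ E] [TopologicalSpace H]
  {I : ModelWithCorners ℝ E H} [I.Boundaryless] [TopologicalSpace M] [ChartedSpace H M]
  {E' H' N : Type*} [NormedAddCommGroup E'] [NormedSpace ℝ E'] [TopologicalSpace H']
  {J : ModelWithCorners ℝ E' H'} [TopologicalSpace N] [ChartedSpace H' N]

omit [I.Boundaryless] in
/-- Smooth maps with values in an embedded submanifold are smooth into it. -/
theorem exists_lift_of_embedding {E'' H'' Q : Type*} [NormedAddCommGroup E'']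
    [NormedSpace ℝ E''] [TopologicalSpace H''] {I'' : ModelWithCorners ℝ E'' H''}
    [TopologicalSpace Q] [ChartedSpace H'' Q] {f : M → N}
    (hf : Manifold.IsSmoothEmbedding I J ∞ f) {c : Q → N} {q : Q} {a : M}
    (hc : ContMDiffAt I'' J ∞ c q) (hca : c q = f a) (hev : ∀ᶠ t in 𝓝 q, c t ∈ Set.range f) :
    ∃ h : Q → M, ContMDiffAt I'' I ∞ h q ∧ h q = a ∧ ∀ᶠ t in 𝓝 q, f (h t) = c t := by
  classical
  let h : Q → M := fun t => if ht : c t ∈ Set.range f then ht.choose else a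
  have hfh : ∀ᶠ t in 𝓝 q, f (h t) = c t := by
    filter_upwards [hev] with t ht
    simp only [h, dif_pos ht]
    exact ht.choose_spec
  have hq : h q = a := hf.isEmbedding.injective (hfh.self_of_nhds.trans hca)
  have hcomp : ContMDiffAt I'' J ∞ (f ∘ h) q := hc.congr_of_eventuallyEq hfh
  refine ⟨h, ?_, hq, hfh⟩
  rw [ContMDiffAt.iff_comp_isImmersionAt (hf.isImmersion.isImmersionAt (h q))]
  exact ⟨hf.isEmbedding.isInducing.continuousAt_iff.2 hcomp.continuousAt, hcomp⟩

/-- An immersion has a local smooth left inverse. -/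
theorem exists_left_inverse_of_isImmersionAt {f : M → N} {a : M}
    (hf : Manifold.IsImmersionAt I J ∞ f a) :
    ∃ r : N → M, ContMDiffAt J I ∞ r (f a) ∧ ∀ᶠ x in 𝓝 a, r (f x) = x := by
  set φ := hf.domChart.extend I
  set ψ := hf.codChart.extend J
  have haφ : a ∈ φ.source := by
    rw [hf.domChart.extend_source]; exact hf.mem_domChart_source
  have hw : ∀ w ∈ φ.target, ψ (f (φ.symm w)) = hf.equiv (w, 0) := fun w hw => hf.writtenInCharts hw
  have hr : ∀ x ∈ φ.source, (hf.equiv.symm (ψ (f x))).1 = φ x := by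
    intro x hx
    have h := hw _ (φ.map_source hx)
    rw [φ.left_inv hx] at h
    rw [h, hf.equiv.symm_apply_apply]
  refine ⟨fun y => φ.symm (hf.equiv.symm (ψ y)).1, ?_, ?_⟩
  · have h1 : ContMDiffAt J 𝓘(ℝ, E') ∞ ψ (f a) :=
      contMDiffAt_extend_of_mem_maximalAtlas hf.codChart_mem_maximalAtlas hf.mem_codChart_source
    have h2 : ContDiff ℝ ∞ (fun y : E' => (hf.equiv.symm y).1) :=
      contDiff_fst.comp hf.equiv.symm.contDiff
    have h3 : ContMDiffAt 𝓘(ℝ, E) I ∞ φ.symm (hf.equiv.symm (ψ (f a))).1 := by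
      rw [hr a haφ]
      exact contMDiffAt_extend_symm_of_mem_maximalAtlas hf.domChart_mem_maximalAtlas
        (φ.map_source haφ)
    exact h3.comp (f a) (h2.contMDiff.contMDiffAt.comp (f a) h1)
  · filter_upwards [(hf.domChart.isOpen_extend_source (I := I)).mem_nhds haφ] with x hx
    simp only [hr x hx]
    exact φ.left_inv hx

end Immersion

/-! ### The decomposition `𝔨 = 𝔥 ⊕ 𝔪` and the Wang map -/

section WangMap

variable {E_K E_H E_G : Type*}
  [NormedAddCommGroup E_K] [NormedSpace ℝ E_K] [FiniteDimensional ℝ E_K]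
  [NormedAddCommGroup E_H] [NormedSpace ℝ E_H]
  [NormedAddCommGroup E_G] [NormedSpace ℝ E_G]
  {K G : Type*} [TopologicalSpace K] [ChartedSpace E_K K] [Group K] [LieGroup 𝓘(ℝ, E_K) ∞ K]
  [TopologicalSpace G] [ChartedSpace E_G G] [Group G] [LieGroup 𝓘(ℝ, E_G) ∞ G]
  {H : Subgroup K} [ChartedSpace E_H H] [LieGroup 𝓘(ℝ, E_H) ∞ H]
  {σ : K ≃* K} {lam : H →* G}

omit [FiniteDimensional ℝ E_K] [LieGroup 𝓘(ℝ, E_K) ∞ K] in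
theorem tdiff_involution (hσ : IsSymmetricSpace (E_K := E_K) H σ) (ξ : E_K) :
    tdiff 𝓘(ℝ, E_K) 𝓘(ℝ, E_K) σ 1 (tdiff 𝓘(ℝ, E_K) 𝓘(ℝ, E_K) σ 1 ξ) = ξ := by
  have hm := hσ.smooth.mdifferentiable (by simp)
  have h := tdiff_comp (hm 1) (hm 1) (map_one σ)
  simp only [hσ.involutive, tdiff_id] at h
  exact (DFunLike.congr_fun h ξ).symm

/-- A curve of fixed points of `σ` with prescribed velocity `ξ` in the `1`-eigenspace: in the chart
obtained by averaging a chart over the action of `σ`, the involution is linear. -/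
theorem exists_fixed_curve (hσ : IsSymmetricSpace (E_K := E_K) H σ) {ξ : E_K}
    (hξ : tdiff 𝓘(ℝ, E_K) 𝓘(ℝ, E_K) σ 1 ξ = ξ) :
    ∃ c : ℝ → K, ContMDiffAt 𝓘(ℝ, ℝ) 𝓘(ℝ, E_K) ∞ c 0 ∧ c 0 = 1 ∧ (∀ᶠ t in 𝓝 0, σ (c t) = c t) ∧
      tdiff 𝓘(ℝ, ℝ) 𝓘(ℝ, E_K) c 0 1 = ξ := by
  have : IsManifold 𝓘(ℝ, E_K) ∞ K := inferInstance
  have : IsManifold 𝓘(ℝ, E_K) 1 K := IsManifold.of_le (n := ∞) (by simp)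
  have : CompleteSpace E_K := FiniteDimensional.complete ℝ E_K
  set S := tdiff 𝓘(ℝ, E_K) 𝓘(ℝ, E_K) σ 1
  have hSS : ∀ v, S (S v) = v := tdiff_involution hσ
  set χ := chartAt E_K (1 : K)
  have h1s : (1 : K) ∈ χ.source := mem_chart_source E_K 1
  have hχ : ContMDiffAt 𝓘(ℝ, E_K) 𝓘(ℝ, E_K) ∞ χ 1 :=
    contMDiffOn_chart.contMDiffAt (χ.open_source.mem_nhds h1s)
  have hχs : ContMDiffAt 𝓘(ℝ, E_K) 𝓘(ℝ, E_K) ∞ χ.symm (χ 1) :=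
    contMDiffOn_chart_symm.contMDiffAt (χ.open_target.mem_nhds (mem_chart_target E_K 1))
  have hχs1 : χ.symm (χ 1) = 1 := χ.left_inv h1s
  have hχσ : ContMDiffAt 𝓘(ℝ, E_K) 𝓘(ℝ, E_K) ∞ (fun x => χ (σ x)) 1 :=
    ContMDiffAt.comp_of_eq hχ (hσ.smooth 1) (map_one σ)
  let ψ : K → E_K := fun x => (2⁻¹ : ℝ) • ((χ x - χ 1) + S (χ (σ x) - χ 1))
  have hψσ : ∀ x, ψ (σ x) = S (ψ x) := by
    intro x
    simp only [ψ, hσ.involutive, map_smul, map_add, hSS]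
    rw [add_comm]
  let Ψ : E_K → E_K := fun w => ψ (χ.symm w)
  -- the two summands of `Ψ`, expressed in the chart
  have ha : ContDiffAt ℝ ∞ (fun w => χ (χ.symm w)) (χ 1) :=
    (ContMDiffAt.comp_of_eq hχ hχs hχs1).contDiffAt
  have hb : ContDiffAt ℝ ∞ (fun w => χ (σ (χ.symm w))) (χ 1) :=
    (ContMDiffAt.comp_of_eq hχσ hχs hχs1).contDiffAt
  have hΨ : ContDiffAt ℝ ∞ Ψ (χ 1) :=
    ((ha.sub contDiffAt_const).add
      (S.contDiff.contDiffAt.comp (χ 1) (hb.sub contDiffAt_const))).const_smul (2⁻¹ : ℝ)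
  have hda : HasFDerivAt (fun w => χ (χ.symm w)) (ContinuousLinearMap.id ℝ E_K) (χ 1) := by
    refine (hasFDerivAt_id (χ 1)).congr_of_eventuallyEq ?_
    filter_upwards [χ.open_target.mem_nhds (mem_chart_target E_K 1)] with w hw
    exact χ.right_inv hw
  have hdb : HasFDerivAt (fun w => χ (σ (χ.symm w))) S (χ 1) := by
    have h1 := tdiff_comp (hχσ.mdifferentiableAt (by simp)) (hχs.mdifferentiableAt (by simp)) hχs1
    rw [tdiff_comp (hχ.mdifferentiableAt (by simp)) (hσ.smooth.mdifferentiable (by simp) 1)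
      (map_one σ), tdiff_chartAt_self, tdiff_chartAt_symm_self, ContinuousLinearMap.id_comp,
      ContinuousLinearMap.comp_id, tdiff, mfderiv_eq_fderiv] at h1
    exact (hb.differentiableAt (by simp)).hasFDerivAt.congr_fderiv h1
  have hdΨ : HasFDerivAt Ψ ((ContinuousLinearEquiv.refl ℝ E_K : E_K ≃L[ℝ] E_K) : E_K →L[ℝ] E_K)
      (χ 1) := by
    have h := ((hda.sub_const (χ 1)).add
      (S.hasFDerivAt.comp (χ 1) (hdb.sub_const (χ 1)))).const_smul (2⁻¹ : ℝ)
    refine h.congr_fderiv ?_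
    ext v
    simp only [smul_apply, add_apply,
      ContinuousLinearMap.comp_apply, ContinuousLinearMap.id_apply, hSS,
      ContinuousLinearEquiv.coe_refl]
    rw [← two_smul ℝ, smul_smul]
    norm_num
  have hΨ0 : Ψ (χ 1) = 0 := by simp [Ψ, ψ, hχs1]
  set L := hΨ.localInverse hdΨ (by simp)
  have hstrict : HasStrictFDerivAt Ψ
      ((ContinuousLinearEquiv.refl ℝ E_K : E_K ≃L[ℝ] E_K) : E_K →L[ℝ] E_K) (χ 1) :=
    hΨ.hasStrictFDerivAt' hdΨ (by simp)
  have hL0 : L 0 = χ 1 := by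
    have h := hΨ.localInverse_apply_image hdΨ (by simp)
    rwa [hΨ0] at h
  have hL : ContDiffAt ℝ ∞ L 0 := by
    have h := hΨ.to_localInverse hdΨ (by simp)
    rwa [hΨ0] at h
  have hdL : HasFDerivAt L (ContinuousLinearMap.id ℝ E_K) 0 := by
    have h := hstrict.to_localInverse.hasFDerivAt
    rw [hΨ0] at h
    exact h
  have hright : ∀ᶠ z in 𝓝 (0 : E_K), Ψ (L z) = z := by
    have h := hstrict.eventually_right_inverse
    rwa [hΨ0] at h
  have hleft : ∀ᶠ w in 𝓝 (χ 1), L (Ψ w) = w := hstrict.eventually_left_inverse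
  have hleft' : ∀ᶠ x in 𝓝 (1 : K), x ∈ χ.source ∧ L (ψ x) = χ x := by
    filter_upwards [(χ.continuousAt h1s).eventually hleft, χ.open_source.mem_nhds h1s] with x hx hxs
    refine ⟨hxs, ?_⟩
    simpa only [Ψ, χ.left_inv hxs] using hx
  have hscale : ContDiff ℝ ∞ (fun t : ℝ => t • ξ) := contDiff_id.smul contDiff_const
  have hscale0 : Filter.Tendsto (fun t : ℝ => t • ξ) (𝓝 0) (𝓝 0) := by
    have h := hscale.continuous.tendsto 0
    simpa using h
  have hγ : ContDiffAt ℝ ∞ (fun t : ℝ => L (t • ξ)) 0 :=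
    ContDiffAt.comp (0 : ℝ) (by rw [zero_smul]; exact hL) hscale.contDiffAt
  have hγ0 : L ((0 : ℝ) • ξ) = χ 1 := by rw [zero_smul, hL0]
  have hc : ContMDiffAt 𝓘(ℝ, ℝ) 𝓘(ℝ, E_K) ∞ (fun t : ℝ => χ.symm (L (t • ξ))) 0 :=
    ContMDiffAt.comp_of_eq hχs hγ.contMDiffAt hγ0
  have hc0 : χ.symm (L ((0 : ℝ) • ξ)) = 1 := by rw [hγ0, hχs1]
  refine ⟨fun t => χ.symm (L (t • ξ)), hc, hc0, ?_, ?_⟩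
  · have hc1 : Filter.Tendsto (fun t : ℝ => χ.symm (L (t • ξ))) (𝓝 0) (𝓝 1) := by
      have h := hc.continuousAt.tendsto
      rwa [hc0] at h
    have hσc1 : Filter.Tendsto (fun t : ℝ => σ (χ.symm (L (t • ξ)))) (𝓝 0) (𝓝 1) := by
      have h := hσ.smooth.continuous.tendsto 1
      rw [map_one] at h
      exact h.comp hc1
    filter_upwards [hscale0.eventually hright, hc1.eventually hleft', hσc1.eventually hleft']
      with t h1 h2 h3
    refine χ.injOn h3.1 h2.1 ?_
    rw [← h3.2, ← h2.2, hψσ, show ψ (χ.symm (L (t • ξ))) = t • ξ from h1, map_smul, hξ]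
  · have hdγ : tdiff 𝓘(ℝ, ℝ) 𝓘(ℝ, E_K) (fun t : ℝ => L (t • ξ)) 0 1 = ξ := by
      have h1 : HasFDerivAt (fun t : ℝ => t • ξ) ((ContinuousLinearMap.id ℝ ℝ).smulRight ξ) 0 :=
        (hasFDerivAt_id (0 : ℝ)).smul_const ξ
      have h2 := HasFDerivAt.comp (0 : ℝ) (f := fun t : ℝ => t • ξ) (g := L)
        (by rw [zero_smul]; exact hdL) h1
      have h3 : tdiff 𝓘(ℝ, ℝ) 𝓘(ℝ, E_K) (fun t : ℝ => L (t • ξ)) 0 = _ :=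
        mfderiv_eq_fderiv.trans h2.fderiv
      rw [h3]
      simp
    rw [tdiff_comp (hχs.mdifferentiableAt (by simp)) (hγ.contMDiffAt.mdifferentiableAt (by simp))
      hγ0, tdiff_chartAt_symm_self, ContinuousLinearMap.id_comp, hdγ]

omit [LieGroup 𝓘(ℝ, E_H) ∞ H] in
/-- The Lie algebra of `H` is the whole `1`-eigenspace of `T_e σ`. -/
theorem mem_range_tdiff_val (hH : Manifold.IsSmoothEmbedding 𝓘(ℝ, E_H) 𝓘(ℝ, E_K) ∞
      (Subtype.val : H → K)) (hσ : IsSymmetricSpace (E_K := E_K) H σ) {ξ : E_K}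
    (hξ : tdiff 𝓘(ℝ, E_K) 𝓘(ℝ, E_K) σ 1 ξ = ξ) :
    ∃ ζ : E_H, tdiff 𝓘(ℝ, E_H) 𝓘(ℝ, E_K) (Subtype.val : H → K) 1 ζ = ξ := by
  have : IsManifold 𝓘(ℝ, E_K) ∞ K := inferInstance
  obtain ⟨c, hc, hc0, hcσ, hcξ⟩ := exists_fixed_curve hσ hξ
  have hcont : ∀ᶠ t in 𝓝 (0 : ℝ), ContinuousAt c t := by
    have h := (contMDiffAt_iff_contMDiffAt_nhds (n := 1) (by simp)).1 (hc.of_le (by simp))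
    exact h.mono fun t ht => ht.continuousAt
  obtain ⟨δ, hδ, hball⟩ := Metric.eventually_nhds_iff_ball.1 (hcont.and hcσ)
  have hsub : c '' Metric.ball 0 δ ⊆ connectedComponentIn {k : K | σ k = k} 1 := by
    refine IsPreconnected.subset_connectedComponentIn ?_ ⟨0, Metric.mem_ball_self hδ, hc0⟩ ?_
    · refine ((convex_ball (0 : ℝ) δ).isPreconnected).image c fun t ht => ?_
      exact (hball t ht).1.continuousWithinAt
    · rintro _ ⟨t, ht, rfl⟩
      exact (hball t ht).2
  have hev : ∀ᶠ t in 𝓝 (0 : ℝ), c t ∈ Set.range (Subtype.val : H → K) := by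
    filter_upwards [Metric.ball_mem_nhds 0 hδ] with t ht
    rw [Subtype.range_val]
    exact hσ.identityComponent_subset (hsub ⟨t, ht, rfl⟩)
  obtain ⟨h, hh, hh0, hhc⟩ := exists_lift_of_embedding hH (a := (1 : H)) hc hc0 hev
  refine ⟨tdiff 𝓘(ℝ, ℝ) 𝓘(ℝ, E_H) h 0 1, ?_⟩
  have h1 := tdiff_comp (hH.contMDiff.mdifferentiable (by simp) 1)
    (hh.mdifferentiableAt (by simp)) hh0
  rw [tdiff_congr (I₁ := 𝓘(ℝ, ℝ)) (I₂ := 𝓘(ℝ, E_K)) hhc] at h1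
  rw [← hcξ]
  exact (DFunLike.congr_fun h1 1).symm

omit [LieGroup 𝓘(ℝ, E_H) ∞ H] in
/-- Every vector of `𝔨` is the sum of a vector of `𝔥` and a vector of `𝔪`. -/
theorem exists_decomposition (hH : Manifold.IsSmoothEmbedding 𝓘(ℝ, E_H) 𝓘(ℝ, E_K) ∞
      (Subtype.val : H → K)) (hσ : IsSymmetricSpace (E_K := E_K) H σ) (ξ : E_K) :
    ∃ (ζ : E_H) (η : E_K), ξ = tdiff 𝓘(ℝ, E_H) 𝓘(ℝ, E_K) (Subtype.val : H → K) 1 ζ + η ∧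
      tdiff 𝓘(ℝ, E_K) 𝓘(ℝ, E_K) σ 1 η = -η := by
  set S := tdiff 𝓘(ℝ, E_K) 𝓘(ℝ, E_K) σ 1
  have hSS : ∀ v, S (S v) = v := tdiff_involution hσ
  obtain ⟨ζ, hζ⟩ := mem_range_tdiff_val hH hσ (ξ := (2⁻¹ : ℝ) • (ξ + S ξ)) (by
    change S _ = _
    rw [map_smul, map_add, hSS, add_comm])
  refine ⟨ζ, (2⁻¹ : ℝ) • (ξ - S ξ), ?_, ?_⟩
  · rw [hζ, ← smul_add, add_add_sub_cancel, ← two_smul ℝ, smul_smul]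
    norm_num
  · rw [map_smul, map_sub, hSS, ← smul_neg, neg_sub]

omit [FiniteDimensional ℝ E_K] [LieGroup 𝓘(ℝ, E_K) ∞ K] [LieGroup 𝓘(ℝ, E_H) ∞ H] in
theorem tdiff_involution_val (hH : Manifold.IsSmoothEmbedding 𝓘(ℝ, E_H) 𝓘(ℝ, E_K) ∞
      (Subtype.val : H → K)) (hσ : IsSymmetricSpace (E_K := E_K) H σ) (ζ : E_H) :
    tdiff 𝓘(ℝ, E_K) 𝓘(ℝ, E_K) σ 1 (tdiff 𝓘(ℝ, E_H) 𝓘(ℝ, E_K) (Subtype.val : H → K) 1 ζ) =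
      tdiff 𝓘(ℝ, E_H) 𝓘(ℝ, E_K) (Subtype.val : H → K) 1 ζ := by
  have h := tdiff_comp (hσ.smooth.mdifferentiable (by simp) 1)
    (hH.contMDiff.mdifferentiable (by simp) (1 : H)) (y := (1 : K)) rfl
  simp only [fun x : H => hσ.fixed x x.2] at h
  exact (DFunLike.congr_fun h ζ).symm

omit [FiniteDimensional ℝ E_K] [LieGroup 𝓘(ℝ, E_K) ∞ K] [LieGroup 𝓘(ℝ, E_H) ∞ H]
  [LieGroup 𝓘(ℝ, E_G) ∞ G] in
/-- The canonical Wang map is `T_e λ` after the projection `(1 + T_e σ) / 2` of `𝔨` onto `𝔥`; the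
differential of a local left inverse of `H → K` identifies the image of `T_1 H` with `T_1 H`. -/
theorem exists_wangMap (hH : Manifold.IsSmoothEmbedding 𝓘(ℝ, E_H) 𝓘(ℝ, E_K) ∞
      (Subtype.val : H → K)) (hσ : IsSymmetricSpace (E_K := E_K) H σ) :
    ∃ W : E_K →L[ℝ] E_G, IsCanonicalWangMap (E_H := E_H) σ lam W := by
  set S := tdiff 𝓘(ℝ, E_K) 𝓘(ℝ, E_K) σ 1
  obtain ⟨r, hr, hrx⟩ := exists_left_inverse_of_isImmersionAt
    (hH.isImmersion.isImmersionAt (1 : H))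
  have h1 := tdiff_comp (hr.mdifferentiableAt (by simp))
    (hH.contMDiff.mdifferentiable (by simp) (1 : H)) rfl
  rw [tdiff_congr (I₁ := 𝓘(ℝ, E_H)) (I₂ := 𝓘(ℝ, E_H)) hrx, tdiff_id] at h1
  refine ⟨(tdiff 𝓘(ℝ, E_H) 𝓘(ℝ, E_G) lam 1).comp
    ((tdiff 𝓘(ℝ, E_K) 𝓘(ℝ, E_H) r ((1 : H) : K)).comp
      ((2⁻¹ : ℝ) • (ContinuousLinearMap.id ℝ E_K + S))), fun ζ => ?_, fun ξ hξ => ?_⟩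
  · set v := tdiff 𝓘(ℝ, E_H) 𝓘(ℝ, E_K) (Subtype.val : H → K) 1 ζ with hv
    have h2 : (2⁻¹ : ℝ) • (v + S v) = v := by
      rw [tdiff_involution_val hH hσ, ← two_smul ℝ, smul_smul]
      norm_num
    change tdiff 𝓘(ℝ, E_H) 𝓘(ℝ, E_G) lam 1 (tdiff 𝓘(ℝ, E_K) 𝓘(ℝ, E_H) r ((1 : H) : K)
      ((2⁻¹ : ℝ) • (v + S v))) = tdiff 𝓘(ℝ, E_H) 𝓘(ℝ, E_G) lam 1 ζ
    rw [h2]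
    congr 1
    exact (DFunLike.congr_fun h1 ζ).symm
  · have hξ' : S ξ = -ξ := hξ
    simp [hξ']

namespace IsCanonicalWangMap

variable {W : E_K →L[ℝ] E_G}

omit [FiniteDimensional ℝ E_K] [LieGroup 𝓘(ℝ, E_K) ∞ K] [LieGroup 𝓘(ℝ, E_H) ∞ H]
  [LieGroup 𝓘(ℝ, E_G) ∞ G] in
theorem apply_val (hW : IsCanonicalWangMap (E_H := E_H) σ lam W) (ζ : E_H) :
    W (tdiff 𝓘(ℝ, E_H) 𝓘(ℝ, E_K) (Subtype.val : H → K) 1 ζ) =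
      tdiff 𝓘(ℝ, E_H) 𝓘(ℝ, E_G) lam 1 ζ := hW.1 ζ

omit [FiniteDimensional ℝ E_K] [LieGroup 𝓘(ℝ, E_K) ∞ K] [LieGroup 𝓘(ℝ, E_H) ∞ H]
  [LieGroup 𝓘(ℝ, E_G) ∞ G] in
theorem apply_eq_zero (hW : IsCanonicalWangMap (E_H := E_H) σ lam W) {ξ : E_K}
    (hξ : tdiff 𝓘(ℝ, E_K) 𝓘(ℝ, E_K) σ 1 ξ = -ξ) : W ξ = 0 := hW.2 ξ hξ

omit [LieGroup 𝓘(ℝ, E_H) ∞ H] [LieGroup 𝓘(ℝ, E_G) ∞ G] in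
theorem unique (hH : Manifold.IsSmoothEmbedding 𝓘(ℝ, E_H) 𝓘(ℝ, E_K) ∞
      (Subtype.val : H → K)) (hσ : IsSymmetricSpace (E_K := E_K) H σ) {W' : E_K →L[ℝ] E_G}
    (hW : IsCanonicalWangMap (E_H := E_H) σ lam W)
    (hW' : IsCanonicalWangMap (E_H := E_H) σ lam W') : W = W' := by
  ext ξ
  obtain ⟨ζ, η, rfl, hη⟩ := exists_decomposition hH hσ ξ
  rw [map_add, map_add, hW.apply_val, hW'.apply_val, hW.apply_eq_zero hη, hW'.apply_eq_zero hη]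

omit [LieGroup 𝓘(ℝ, E_H) ∞ H] [LieGroup 𝓘(ℝ, E_G) ∞ G] in
theorem comp_involution (hH : Manifold.IsSmoothEmbedding 𝓘(ℝ, E_H) 𝓘(ℝ, E_K) ∞
      (Subtype.val : H → K)) (hσ : IsSymmetricSpace (E_K := E_K) H σ)
    (hW : IsCanonicalWangMap (E_H := E_H) σ lam W) :
    W.comp (tdiff 𝓘(ℝ, E_K) 𝓘(ℝ, E_K) σ 1) = W := by
  ext ξ
  obtain ⟨ζ, η, rfl, hη⟩ := exists_decomposition hH hσ ξ
  rw [ContinuousLinearMap.comp_apply, map_add, tdiff_involution_val hH hσ, hη, map_add, map_add,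
    map_neg, hW.apply_eq_zero hη, neg_zero]

/-- The canonical Wang map intertwines the adjoint actions of `H`. -/
theorem comp_Ad (hH : Manifold.IsSmoothEmbedding 𝓘(ℝ, E_H) 𝓘(ℝ, E_K) ∞
      (Subtype.val : H → K)) (hσ : IsSymmetricSpace (E_K := E_K) H σ)
    (hlam : ContMDiff 𝓘(ℝ, E_H) 𝓘(ℝ, E_G) ∞ lam)
    (hW : IsCanonicalWangMap (E_H := E_H) σ lam W) (h : H) :
    W.comp (Ad (h : K)) = (Ad (lam h) : E_G →L[ℝ] E_G).comp W := by
  have hval := hH.contMDiff.mdifferentiable (by simp) (1 : H)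
  have hl := hlam.mdifferentiable (by simp) (1 : H)
  have hs := hσ.smooth.mdifferentiable (by simp) (1 : K)
  have h1 : (Ad (h : K) : E_K →L[ℝ] E_K).comp
      (tdiff 𝓘(ℝ, E_H) 𝓘(ℝ, E_K) (Subtype.val : H → K) 1) =
      (tdiff 𝓘(ℝ, E_H) 𝓘(ℝ, E_K) (Subtype.val : H → K) 1).comp (Ad h : E_H →L[ℝ] E_H) :=
    (tdiff_conj (E_G := E_K) hval rfl (h : K)).symm.trans
      (tdiff_comp (f := fun x : H => h * x * h⁻¹) hval (mdifferentiable_conj h 1) (by simp))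
  have h2 : (tdiff 𝓘(ℝ, E_H) 𝓘(ℝ, E_G) lam 1).comp (Ad h : E_H →L[ℝ] E_H) =
      (Ad (lam h) : E_G →L[ℝ] E_G).comp (tdiff 𝓘(ℝ, E_H) 𝓘(ℝ, E_G) lam 1) := by
    rw [← tdiff_conj hl (map_one lam) (lam h)]
    refine (tdiff_comp (f := fun x : H => h * x * h⁻¹) hl (mdifferentiable_conj h 1)
      (by simp)).symm.trans ?_
    simp only [map_mul, map_inv]
  have h3 : (tdiff 𝓘(ℝ, E_K) 𝓘(ℝ, E_K) σ 1).comp (Ad (h : K) : E_K →L[ℝ] E_K) =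
      (Ad (h : K) : E_K →L[ℝ] E_K).comp (tdiff 𝓘(ℝ, E_K) 𝓘(ℝ, E_K) σ 1) := by
    rw [← tdiff_conj hs (map_one σ) (h : K)]
    refine (tdiff_comp (f := fun x : K => (h : K) * x * (h : K)⁻¹) hs
      (mdifferentiable_conj (h : K) 1) (by simp)).symm.trans ?_
    simp only [map_mul, map_inv, hσ.fixed h h.2]
  ext ξ
  obtain ⟨ζ, η, rfl, hη⟩ := exists_decomposition hH hσ ξ
  have e1 := DFunLike.congr_fun h1 ζ
  have e2 := DFunLike.congr_fun h2 ζ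
  have e3 := DFunLike.congr_fun h3 η
  simp only [ContinuousLinearMap.comp_apply] at e1 e2 e3 ⊢
  rw [hη, map_neg] at e3
  rw [map_add, map_add, map_add, hW.apply_eq_zero hη, hW.apply_val, e1, hW.apply_val, e2,
    hW.apply_eq_zero e3, add_zero, add_zero]

end IsCanonicalWangMap

end WangMap

/-! ### The canonical connection, pulled back to `K × G` -/

section CanonicalForm

variable {E_K E_H E_G E_P : Type*}
  [NormedAddCommGroup E_K] [NormedSpace ℝ E_K]
  [NormedAddCommGroup E_H] [NormedSpace ℝ E_H]
  [NormedAddCommGroup E_G] [NormedSpace ℝ E_G]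
  [NormedAddCommGroup E_P] [NormedSpace ℝ E_P]
  {K G : Type*} [TopologicalSpace K] [ChartedSpace E_K K] [Group K] [LieGroup 𝓘(ℝ, E_K) ∞ K]
  [TopologicalSpace G] [ChartedSpace E_G G] [Group G] [LieGroup 𝓘(ℝ, E_G) ∞ G]
  {H : Subgroup K} [ChartedSpace E_H H] [LieGroup 𝓘(ℝ, E_H) ∞ H]
  {σ : K ≃* K} {lam : H →* G} {W : E_K →L[ℝ] E_G}
  {E B N : Type*} [NormedAddCommGroup E] [NormedSpace ℝ E] [TopologicalSpace B]
  {J : ModelWithCorners ℝ E B} [TopologicalSpace N] [ChartedSpace B N]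

/-- The `𝔤`-valued `1`-form `(X, Y) ↦ Ad_{g⁻¹} W(k⁻¹ X) + g⁻¹ Y` on `K × G`, at `a = (k, g)`. -/
def wangForm (W : E_K →L[ℝ] E_G) (a : K × G) : E_K × E_G →L[ℝ] E_G :=
  ((Ad a.2⁻¹ : E_G →L[ℝ] E_G).comp (W.comp (maurerCartan a.1))).coprod (maurerCartan a.2)

theorem wangForm_comp_prodMk {u : N → K} {v : N → G} {y : N} {a : K × G}
    (hu : MDifferentiableAt J 𝓘(ℝ, E_K) u y) (hv : MDifferentiableAt J 𝓘(ℝ, E_G) v y)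
    (hua : u y = a.1) (hva : v y = a.2) :
    (wangForm W a).comp (tdiff J (𝓘(ℝ, E_K).prod 𝓘(ℝ, E_G)) (fun z => (u z, v z)) y) =
      (Ad a.2⁻¹ : E_G →L[ℝ] E_G).comp
        (W.comp (tdiff J 𝓘(ℝ, E_K) (fun z => a.1⁻¹ * u z) y)) +
      tdiff J 𝓘(ℝ, E_G) (fun z => a.2⁻¹ * v z) y := by
  obtain ⟨k, g⟩ := a
  subst hua hva
  rw [tdiff_prodMk hu hv]
  simp only
  rw [← maurerCartan_comp hu, ← maurerCartan_comp hv]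
  rfl

/-- The form `wangForm W` is basic for the right action of `H` on `K × G`: its pull-backs along two
maps that differ by an `H`-valued function `h` agree. The velocity of `h` contributes `W` of itself
from the factor `K` and `-T_e λ` of itself from the factor `G`, which cancel as `W = T_e λ` on `𝔥`;
the value of `h` drops out because `W` intertwines the adjoint actions of `H`. -/
theorem wangForm_comp_gauge [FiniteDimensional ℝ E_K]
    (hH : Manifold.IsSmoothEmbedding 𝓘(ℝ, E_H) 𝓘(ℝ, E_K) ∞ (Subtype.val : H → K))
    (hσ : IsSymmetricSpace (E_K := E_K) H σ) (hlam : ContMDiff 𝓘(ℝ, E_H) 𝓘(ℝ, E_G) ∞ lam)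
    (hW : IsCanonicalWangMap (E_H := E_H) σ lam W)
    {u : N → K} {v : N → G} {h : N → H} {y : N}
    (hu : MDifferentiableAt J 𝓘(ℝ, E_K) u y) (hv : MDifferentiableAt J 𝓘(ℝ, E_G) v y)
    (hh : MDifferentiableAt J 𝓘(ℝ, E_H) h y) :
    (wangForm W (u y * h y, (lam (h y))⁻¹ * v y)).comp
        (tdiff J (𝓘(ℝ, E_K).prod 𝓘(ℝ, E_G)) (fun z => (u z * h z, (lam (h z))⁻¹ * v z)) y) =
      (wangForm W (u y, v y)).comp
        (tdiff J (𝓘(ℝ, E_K).prod 𝓘(ℝ, E_G)) (fun z => (u z, v z)) y) := by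
  have hval := hH.contMDiff.mdifferentiable (by simp)
  have hl := hlam.mdifferentiable (by simp)
  have hhK : MDifferentiableAt J 𝓘(ℝ, E_K) (fun z => (h z : K)) y := (hval (h y)).comp y hh
  have hhG : MDifferentiableAt J 𝓘(ℝ, E_G) (fun z => (lam (h z))⁻¹) y :=
    ((contMDiff_inv 𝓘(ℝ, E_G) ∞).mdifferentiable (by simp) (lam (h y))).comp y
      ((hl (h y)).comp y hh)
  have hu' : MDifferentiableAt J 𝓘(ℝ, E_K) (fun z => u z * h z) y :=
    ((contMDiff_mul 𝓘(ℝ, E_K) ∞).mdifferentiable (by simp) (u y, (h y : K))).comp y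
      (hu.prodMk hhK)
  have hv' : MDifferentiableAt J 𝓘(ℝ, E_G) (fun z => (lam (h z))⁻¹ * v z) y :=
    ((contMDiff_mul 𝓘(ℝ, E_G) ∞).mdifferentiable (by simp) ((lam (h y))⁻¹, v y)).comp y
      (hhG.prodMk hv)
  rw [wangForm_comp_prodMk hu' hv' rfl rfl, wangForm_comp_prodMk hu hv rfl rfl]
  simp only
  -- the velocity of `h`, translated to the Lie algebra of `H`
  have hm : MDifferentiableAt J 𝓘(ℝ, E_H) (fun z => (h y)⁻¹ * h z) y :=
    (mdifferentiable_mul_left ((h y)⁻¹) (h y)).comp y hh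
  set θ := tdiff J 𝓘(ℝ, E_H) (fun z => (h y)⁻¹ * h z) y
  have hw : MDifferentiableAt J 𝓘(ℝ, E_K) (fun z => (u y)⁻¹ * u z) y :=
    (mdifferentiable_mul_left ((u y)⁻¹) (u y)).comp y hu
  have hz : MDifferentiableAt J 𝓘(ℝ, E_G) (fun z => (v y)⁻¹ * v z) y :=
    (mdifferentiable_mul_left ((v y)⁻¹) (v y)).comp y hv
  have hmK : MDifferentiableAt J 𝓘(ℝ, E_K) (fun z => (((h y)⁻¹ * h z : H) : K)) y :=
    (hval _).comp y hm
  have hmG : MDifferentiableAt J 𝓘(ℝ, E_G) (fun z => lam ((h y)⁻¹ * h z)) y := (hl _).comp y hm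
  have hw' : MDifferentiableAt J 𝓘(ℝ, E_K)
      (fun z => (h y : K)⁻¹ * ((u y)⁻¹ * u z) * (h y : K)⁻¹⁻¹) y :=
    (mdifferentiable_conj _ _).comp y hw
  have e1 : tdiff J 𝓘(ℝ, E_K) (fun z => (u y * h y)⁻¹ * (u z * h z)) y =
      (Ad ((h y : K)⁻¹) : E_K →L[ℝ] E_K).comp (tdiff J 𝓘(ℝ, E_K) (fun z => (u y)⁻¹ * u z) y) +
      (tdiff 𝓘(ℝ, E_H) 𝓘(ℝ, E_K) (Subtype.val : H → K) 1).comp θ := by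
    rw [← tdiff_conj hw (by simp) ((h y : K)⁻¹), ← tdiff_comp (hval 1) hm (by simp),
      ← tdiff_mul_of_eq_one hw' hmK (by simp) (by simp)]
    congr 1
    funext z
    push_cast
    group
  have e2 : tdiff J 𝓘(ℝ, E_G) (fun z => lam ((h y)⁻¹ * h z)) y =
      (tdiff 𝓘(ℝ, E_H) 𝓘(ℝ, E_G) lam 1).comp θ := tdiff_comp (hl 1) hm (by simp)
  have hi : MDifferentiableAt J 𝓘(ℝ, E_G) (fun z => (lam ((h y)⁻¹ * h z))⁻¹) y :=
    ((contMDiff_inv 𝓘(ℝ, E_G) ∞).mdifferentiable (by simp) _).comp y hmG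
  have hi' : MDifferentiableAt J 𝓘(ℝ, E_G) (fun z =>
      (v y)⁻¹ * lam (h y) * (lam ((h y)⁻¹ * h z))⁻¹ * ((v y)⁻¹ * lam (h y))⁻¹) y :=
    (mdifferentiable_conj _ _).comp y hi
  have e3 : tdiff J 𝓘(ℝ, E_G) (fun z => ((lam (h y))⁻¹ * v y)⁻¹ * ((lam (h z))⁻¹ * v z)) y =
      -(Ad ((v y)⁻¹ * lam (h y)) : E_G →L[ℝ] E_G).comp
        ((tdiff 𝓘(ℝ, E_H) 𝓘(ℝ, E_G) lam 1).comp θ) +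
      tdiff J 𝓘(ℝ, E_G) (fun z => (v y)⁻¹ * v z) y := by
    rw [← e2, ← ContinuousLinearMap.comp_neg, ← tdiff_inv_of_eq_one hmG (by simp),
      ← tdiff_conj hi (by simp) ((v y)⁻¹ * lam (h y)),
      ← tdiff_mul_of_eq_one hi' hz (by simp) (by simp)]
    congr 1
    funext z
    simp only [map_mul, map_inv]
    group
  have e4 : (Ad ((lam (h y))⁻¹ * v y)⁻¹ : E_G →L[ℝ] E_G).comp
      (W.comp (Ad ((h y : K)⁻¹) : E_K →L[ℝ] E_K)) = (Ad (v y)⁻¹ : E_G →L[ℝ] E_G).comp W := by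
    have h1 := hW.comp_Ad hH hσ hlam (h y)⁻¹
    rw [Subgroup.coe_inv] at h1
    rw [h1, ← ContinuousLinearMap.comp_assoc, ← Ad_mul]
    simp
  have e5 : ∀ ζ, W (tdiff 𝓘(ℝ, E_H) 𝓘(ℝ, E_K) (Subtype.val : H → K) 1 ζ) =
      tdiff 𝓘(ℝ, E_H) 𝓘(ℝ, E_G) lam 1 ζ := hW.apply_val
  rw [e1, e3]
  ext w
  have e6 := DFunLike.congr_fun e4 (tdiff J 𝓘(ℝ, E_K) (fun z => (u y)⁻¹ * u z) y w)
  simp only [ContinuousLinearMap.comp_apply] at e6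
  simp only [add_apply, neg_apply, ContinuousLinearMap.comp_apply, map_add, e5, e6]
  rw [mul_inv_rev, inv_inv]
  abel

/-! ### Descent to `P_λ` -/

omit [TopologicalSpace K] [TopologicalSpace G] in
theorem HomBundle.mk_surjective : Function.Surjective (HomBundle.mk H lam) := Quotient.exists_rep

omit [TopologicalSpace K] [TopologicalSpace G] in
theorem HomBundle.mk_eq_mk {a b : K × G} :
    HomBundle.mk H lam a = HomBundle.mk H lam b ↔ ∃ h : H, b = (a.1 * (h : K), (lam h)⁻¹ * a.2) :=
  Quotient.eq (r := bundleSetoid H lam)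

/-- The pull-backs of `wangForm W` along two maps to `K × G` that induce the same map to `P_λ`
agree. -/
theorem wangForm_comp_eq [FiniteDimensional ℝ E_K]
    (hH : Manifold.IsSmoothEmbedding 𝓘(ℝ, E_H) 𝓘(ℝ, E_K) ∞ (Subtype.val : H → K))
    (hσ : IsSymmetricSpace (E_K := E_K) H σ) (hlam : ContMDiff 𝓘(ℝ, E_H) 𝓘(ℝ, E_G) ∞ lam)
    (hW : IsCanonicalWangMap (E_H := E_H) σ lam W)
    {s s' : N → K × G} {y : N} (hs : ContMDiffAt J (𝓘(ℝ, E_K).prod 𝓘(ℝ, E_G)) ∞ s y)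
    (hs' : ContMDiffAt J (𝓘(ℝ, E_K).prod 𝓘(ℝ, E_G)) ∞ s' y)
    (hev : ∀ᶠ z in 𝓝 y, HomBundle.mk H lam (s z) = HomBundle.mk H lam (s' z)) :
    (wangForm W (s' y)).comp (tdiff J (𝓘(ℝ, E_K).prod 𝓘(ℝ, E_G)) s' y) =
      (wangForm W (s y)).comp (tdiff J (𝓘(ℝ, E_K).prod 𝓘(ℝ, E_G)) s y) := by
  have hu : ContMDiffAt J 𝓘(ℝ, E_K) ∞ (fun z => (s z).1) y := hs.fst
  have hv : ContMDiffAt J 𝓘(ℝ, E_G) ∞ (fun z => (s z).2) y := hs.snd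
  have hu' : ContMDiffAt J 𝓘(ℝ, E_K) ∞ (fun z => (s' z).1) y := hs'.fst
  have hc : ContMDiffAt J 𝓘(ℝ, E_K) ∞ (fun z => (s z).1⁻¹ * (s' z).1) y := hu.inv.mul hu'
  obtain ⟨h₀, hh₀⟩ := HomBundle.mk_eq_mk.1 hev.self_of_nhds
  obtain ⟨h, hh, hhy, hhc⟩ := exists_lift_of_embedding hH (a := h₀) hc (by simp [hh₀]) (by
    filter_upwards [hev] with z hz
    obtain ⟨h₁, hh₁⟩ := HomBundle.mk_eq_mk.1 hz
    exact ⟨h₁, by simp [hh₁]⟩)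
  have hs'eq : ∀ᶠ z in 𝓝 y, s' z = ((s z).1 * h z, (lam (h z))⁻¹ * (s z).2) := by
    filter_upwards [hev, hhc] with z hz hz'
    obtain ⟨h₁, hh₁⟩ := HomBundle.mk_eq_mk.1 hz
    have : h z = h₁ := Subtype.val_injective (by simp [hz', hh₁])
    rw [this, hh₁]
  have hd := tdiff_congr (I₁ := J) (I₂ := 𝓘(ℝ, E_K).prod 𝓘(ℝ, E_G)) hs'eq
  have hy := hs'eq.self_of_nhds
  rw [hd, hy]
  exact wangForm_comp_gauge (u := fun z => (s z).1) (v := fun z => (s z).2) (h := h) hH hσ hlam hW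
    (hu.mdifferentiableAt (by simp)) (hv.mdifferentiableAt (by simp))
    (hh.mdifferentiableAt (by simp))

variable [ChartedSpace E_P (HomBundle H lam)]

/-- The pull-back of `wangForm W` along a local section of `K × G → P_λ`, at each point of `P_λ`. -/
def canonicalForm
    (hP : Manifold.IsSubmersion (𝓘(ℝ, E_K).prod 𝓘(ℝ, E_G)) 𝓘(ℝ, E_P) ∞ (HomBundle.mk H lam))
    (W : E_K →L[ℝ] E_G) : DForm E_P (HomBundle H lam) 1 E_G := fun p =>
  let s := (exists_local_section (hP.isSubmersionAt (HomBundle.mk_surjective p).choose)).choose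
  ContinuousAlternatingMap.ofSubsingleton ℝ (TangentSpace 𝓘(ℝ, E_P) p) E_G (0 : Fin 1)
    ((wangForm W (s p)).comp (tdiff 𝓘(ℝ, E_P) (𝓘(ℝ, E_K).prod 𝓘(ℝ, E_G)) s p))

/-- The linear map `T_p P → 𝔤` underlying a `1`-form, read on the model space. -/
def linMap {P : Type*} [TopologicalSpace P] [ChartedSpace E_P P] (A : DForm E_P P 1 E_G) (p : P) :
    E_P →L[ℝ] E_G := lin A p

/-- `A` is induced by `wangForm W`: the pull-back of `A` to `K × G` is `wangForm W`. -/
def IsInducedBy (W : E_K →L[ℝ] E_G) (A : DForm E_P (HomBundle H lam) 1 E_G) : Prop :=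
  ∀ a : K × G, (linMap A (HomBundle.mk H lam a)).comp
    (tdiff (𝓘(ℝ, E_K).prod 𝓘(ℝ, E_G)) 𝓘(ℝ, E_P) (HomBundle.mk H lam) a) = wangForm W a

theorem canonicalForm_isInducedBy [FiniteDimensional ℝ E_K]
    (hH : Manifold.IsSmoothEmbedding 𝓘(ℝ, E_H) 𝓘(ℝ, E_K) ∞ (Subtype.val : H → K))
    (hσ : IsSymmetricSpace (E_K := E_K) H σ) (hlam : ContMDiff 𝓘(ℝ, E_H) 𝓘(ℝ, E_G) ∞ lam)
    (hW : IsCanonicalWangMap (E_H := E_H) σ lam W)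
    (hP : Manifold.IsSubmersion (𝓘(ℝ, E_K).prod 𝓘(ℝ, E_G)) 𝓘(ℝ, E_P) ∞ (HomBundle.mk H lam)) :
    IsInducedBy W (canonicalForm hP W) := by
  intro a
  set p := HomBundle.mk H lam a
  have hb := (HomBundle.mk_surjective p).choose_spec
  set b := (HomBundle.mk_surjective p).choose
  have hs := (exists_local_section (hP.isSubmersionAt b)).choose_spec
  set s := (exists_local_section (hP.isSubmersionAt b)).choose
  rw [hb] at hs
  have hsmk := tdiff_comp (hs.1.mdifferentiableAt (by simp))
    (hP.contMDiff.mdifferentiable (by simp) a) rfl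
  have h := wangForm_comp_eq (J := 𝓘(ℝ, E_K).prod 𝓘(ℝ, E_G)) hH hσ hlam hW (y := a)
    (s := fun z => z) (s' := fun z => s (HomBundle.mk H lam z)) contMDiffAt_id
    (ContMDiffAt.comp a hs.1 hP.contMDiff.contMDiffAt) (by
      filter_upwards [hP.contMDiff.continuous.continuousAt.eventually hs.2.2] with z hz
      exact hz.symm)
  rw [hsmk, tdiff_id, ContinuousLinearMap.comp_id] at h
  exact h

end CanonicalForm

/-! ### Forms on `P_λ` induced by forms on `K × G` -/

section InducedForms

variable {E_K E_H E_G E_P : Type*}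
  [NormedAddCommGroup E_K] [NormedSpace ℝ E_K]
  [NormedAddCommGroup E_H] [NormedSpace ℝ E_H]
  [NormedAddCommGroup E_G] [NormedSpace ℝ E_G]
  [NormedAddCommGroup E_P] [NormedSpace ℝ E_P]
  {K G : Type*} [TopologicalSpace K] [ChartedSpace E_K K] [Group K] [LieGroup 𝓘(ℝ, E_K) ∞ K]
  [TopologicalSpace G] [ChartedSpace E_G G] [Group G] [LieGroup 𝓘(ℝ, E_G) ∞ G]
  {H : Subgroup K} [ChartedSpace E_H H] [LieGroup 𝓘(ℝ, E_H) ∞ H]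
  {σ : K ≃* K} {lam : H →* G} {W : E_K →L[ℝ] E_G}
  [ChartedSpace E_P (HomBundle H lam)]
  {A A' : DForm E_P (HomBundle H lam) 1 E_G}

/-- The form `wangForm W`, written with the differentials of the two projections of `K × G`. -/
theorem wangForm_eq (W : E_K →L[ℝ] E_G) (a : K × G) :
    wangForm W a = (Ad a.2⁻¹ : E_G →L[ℝ] E_G).comp
        (W.comp (tdiff (𝓘(ℝ, E_K).prod 𝓘(ℝ, E_G)) 𝓘(ℝ, E_K) (fun z : K × G => a.1⁻¹ * z.1) a)) +
      tdiff (𝓘(ℝ, E_K).prod 𝓘(ℝ, E_G)) 𝓘(ℝ, E_G) (fun z : K × G => a.2⁻¹ * z.2) a := by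
  have h := wangForm_comp_prodMk (J := 𝓘(ℝ, E_K).prod 𝓘(ℝ, E_G)) (W := W) (y := a) (a := a)
    (u := fun z : K × G => z.1) (v := fun z : K × G => z.2) mdifferentiableAt_fst
    mdifferentiableAt_snd rfl rfl
  have h1 : tdiff (𝓘(ℝ, E_K).prod 𝓘(ℝ, E_G)) (𝓘(ℝ, E_K).prod 𝓘(ℝ, E_G))
      (fun z : K × G => (z.1, z.2)) a = ContinuousLinearMap.id ℝ (E_K × E_G) := tdiff_id a
  rw [h1, ContinuousLinearMap.comp_id] at h
  exact h

omit [LieGroup 𝓘(ℝ, E_K) ∞ K] [LieGroup 𝓘(ℝ, E_G) ∞ G] in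
theorem tdiff_mk_surjective
    (hP : Manifold.IsSubmersion (𝓘(ℝ, E_K).prod 𝓘(ℝ, E_G)) 𝓘(ℝ, E_P) ∞ (HomBundle.mk H lam))
    (a : K × G) : Function.Surjective
      (tdiff (𝓘(ℝ, E_K).prod 𝓘(ℝ, E_G)) 𝓘(ℝ, E_P) (HomBundle.mk H lam) a) :=
  mfderiv_surjective_of_isSubmersionAt (hP.isSubmersionAt a)

omit [LieGroup 𝓘(ℝ, E_K) ∞ K] [LieGroup 𝓘(ℝ, E_G) ∞ G] in
theorem eq_of_comp_tdiff_mk {L L' : E_P →L[ℝ] E_G}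
    (hP : Manifold.IsSubmersion (𝓘(ℝ, E_K).prod 𝓘(ℝ, E_G)) 𝓘(ℝ, E_P) ∞ (HomBundle.mk H lam))
    (a : K × G)
    (h : L.comp (tdiff (𝓘(ℝ, E_K).prod 𝓘(ℝ, E_G)) 𝓘(ℝ, E_P) (HomBundle.mk H lam) a) =
      L'.comp (tdiff (𝓘(ℝ, E_K).prod 𝓘(ℝ, E_G)) 𝓘(ℝ, E_P) (HomBundle.mk H lam) a)) : L = L' := by
  ext w
  obtain ⟨v, rfl⟩ := tdiff_mk_surjective hP a w
  exact DFunLike.congr_fun h v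

theorem form_ext {P : Type*} [TopologicalSpace P] [ChartedSpace E_P P] {A A' : DForm E_P P 1 E_G}
    {p : P} (h : linMap A p = linMap A' p) : A p = A' p :=
  (ContinuousAlternatingMap.ofSubsingleton ℝ (TangentSpace 𝓘(ℝ, E_P) p) E_G
    (0 : Fin 1)).symm.injective h

omit [LieGroup 𝓘(ℝ, E_K) ∞ K] [LieGroup 𝓘(ℝ, E_G) ∞ G] in
theorem IsInducedBy.ext
    (hP : Manifold.IsSubmersion (𝓘(ℝ, E_K).prod 𝓘(ℝ, E_G)) 𝓘(ℝ, E_P) ∞ (HomBundle.mk H lam))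
    (hA : IsInducedBy W A) (hA' : IsInducedBy W A') : A = A' := by
  funext p
  obtain ⟨a, rfl⟩ := HomBundle.mk_surjective p
  exact form_ext (eq_of_comp_tdiff_mk hP a ((hA a).trans (hA' a).symm))

omit [LieGroup 𝓘(ℝ, E_K) ∞ K] [LieGroup 𝓘(ℝ, E_G) ∞ G] in
theorem contMDiff_of_lift
    (hP : Manifold.IsSubmersion (𝓘(ℝ, E_K).prod 𝓘(ℝ, E_G)) 𝓘(ℝ, E_P) ∞ (HomBundle.mk H lam))
    {F : K × G → K × G} {f : HomBundle H lam → HomBundle H lam}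
    (hF : ContMDiff (𝓘(ℝ, E_K).prod 𝓘(ℝ, E_G)) (𝓘(ℝ, E_K).prod 𝓘(ℝ, E_G)) ∞ F)
    (hfF : ∀ a, f (HomBundle.mk H lam a) = HomBundle.mk H lam (F a)) :
    ContMDiff 𝓘(ℝ, E_P) 𝓘(ℝ, E_P) ∞ f := by
  refine contMDiff_of_comp_submersion hP HomBundle.mk_surjective ?_
  have h : f ∘ HomBundle.mk H lam = HomBundle.mk H lam ∘ F := funext hfF
  rw [h]
  exact hP.contMDiff.comp hF

omit [LieGroup 𝓘(ℝ, E_K) ∞ K] [LieGroup 𝓘(ℝ, E_G) ∞ G] in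
theorem IsInducedBy.pullback_comp
    (hP : Manifold.IsSubmersion (𝓘(ℝ, E_K).prod 𝓘(ℝ, E_G)) 𝓘(ℝ, E_P) ∞ (HomBundle.mk H lam))
    (hA : IsInducedBy W A) {F : K × G → K × G} {f : HomBundle H lam → HomBundle H lam}
    (hF : ContMDiff (𝓘(ℝ, E_K).prod 𝓘(ℝ, E_G)) (𝓘(ℝ, E_K).prod 𝓘(ℝ, E_G)) ∞ F)
    (hfF : ∀ a, f (HomBundle.mk H lam a) = HomBundle.mk H lam (F a)) (a : K × G) :
    (linMap (DForm.pullback (E' := E_P) f A) (HomBundle.mk H lam a)).comp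
        (tdiff (𝓘(ℝ, E_K).prod 𝓘(ℝ, E_G)) 𝓘(ℝ, E_P) (HomBundle.mk H lam) a) =
      (wangForm W (F a)).comp
        (tdiff (𝓘(ℝ, E_K).prod 𝓘(ℝ, E_G)) (𝓘(ℝ, E_K).prod 𝓘(ℝ, E_G)) F a) := by
  have hf := contMDiff_of_lift hP hF hfF
  have hmk := hP.contMDiff.mdifferentiable (by simp)
  have h1 := tdiff_comp (hf.mdifferentiable (by simp) _) (hmk a) rfl
  have h2 := tdiff_comp (hmk (F a)) (hF.mdifferentiable (by simp) a) rfl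
  simp only [hfF] at h1
  have h3 : linMap (DForm.pullback (E' := E_P) f A) (HomBundle.mk H lam a) =
      (linMap A (HomBundle.mk H lam (F a))).comp
        (tdiff 𝓘(ℝ, E_P) 𝓘(ℝ, E_P) f (HomBundle.mk H lam a)) := by
    rw [← hfF a]
    rfl
  rw [h3, ContinuousLinearMap.comp_assoc, ← h1, h2, ← ContinuousLinearMap.comp_assoc, hA (F a)]

omit [LieGroup 𝓘(ℝ, E_K) ∞ K] [LieGroup 𝓘(ℝ, E_G) ∞ G] in
/-- The form `A` is preserved by a bundle map that lifts to a map of `K × G` preserving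
`wangForm W`. -/
theorem IsInducedBy.pullback_eq
    (hP : Manifold.IsSubmersion (𝓘(ℝ, E_K).prod 𝓘(ℝ, E_G)) 𝓘(ℝ, E_P) ∞ (HomBundle.mk H lam))
    (hA : IsInducedBy W A) {F : K × G → K × G} {f : HomBundle H lam → HomBundle H lam}
    (hF : ContMDiff (𝓘(ℝ, E_K).prod 𝓘(ℝ, E_G)) (𝓘(ℝ, E_K).prod 𝓘(ℝ, E_G)) ∞ F)
    (hfF : ∀ a, f (HomBundle.mk H lam a) = HomBundle.mk H lam (F a))
    (hW : ∀ a, (wangForm W (F a)).comp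
        (tdiff (𝓘(ℝ, E_K).prod 𝓘(ℝ, E_G)) (𝓘(ℝ, E_K).prod 𝓘(ℝ, E_G)) F a) = wangForm W a) :
    DForm.pullback (E' := E_P) f A = A :=
  IsInducedBy.ext (W := W) hP (fun a => (hA.pullback_comp hP hF hfF a).trans (hW a)) hA

/-! ### Smoothness and symmetries of the canonical connection -/

omit [Group G] [LieGroup 𝓘(ℝ, E_G) ∞ G] in
theorem contMDiff_leftLift (k : K) : ContMDiff (𝓘(ℝ, E_K).prod 𝓘(ℝ, E_G))
    (𝓘(ℝ, E_K).prod 𝓘(ℝ, E_G)) ∞ (fun a : K × G => (k * a.1, a.2)) :=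
  (contMDiff_const.mul contMDiff_fst).prodMk contMDiff_snd

omit [Group K] [LieGroup 𝓘(ℝ, E_K) ∞ K] in
theorem contMDiff_rightLift (g : G) : ContMDiff (𝓘(ℝ, E_K).prod 𝓘(ℝ, E_G))
    (𝓘(ℝ, E_K).prod 𝓘(ℝ, E_G)) ∞ (fun a : K × G => (a.1, a.2 * g)) :=
  contMDiff_fst.prodMk (contMDiff_snd.mul contMDiff_const)

theorem IsInducedBy.pullback_leftAct
    (hP : Manifold.IsSubmersion (𝓘(ℝ, E_K).prod 𝓘(ℝ, E_G)) 𝓘(ℝ, E_P) ∞ (HomBundle.mk H lam))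
    (hA : IsInducedBy W A) (k : K) :
    DForm.pullback (E' := E_P) (HomBundle.leftAct H lam k) A = A := by
  refine hA.pullback_eq hP (contMDiff_leftLift k) (fun a => rfl) fun a => ?_
  have hu : MDifferentiableAt (𝓘(ℝ, E_K).prod 𝓘(ℝ, E_G)) 𝓘(ℝ, E_K) (fun z : K × G => k * z.1) a :=
    (contMDiff_const.mul contMDiff_fst).mdifferentiable (n := ∞) (by simp) a
  rw [wangForm_comp_prodMk (a := (k * a.1, a.2)) hu mdifferentiableAt_snd rfl rfl, wangForm_eq W a]
  simp only [mul_inv_rev, mul_assoc, inv_mul_cancel_left]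

theorem IsInducedBy.linMap_pullback_rightAct
    (hP : Manifold.IsSubmersion (𝓘(ℝ, E_K).prod 𝓘(ℝ, E_G)) 𝓘(ℝ, E_P) ∞ (HomBundle.mk H lam))
    (hA : IsInducedBy W A) (g : G) (p : HomBundle H lam) :
    linMap (DForm.pullback (E' := E_P) (fun p => HomBundle.rightAct H lam p g) A) p =
      (Ad g⁻¹ : E_G →L[ℝ] E_G).comp (linMap A p) := by
  obtain ⟨a, rfl⟩ := HomBundle.mk_surjective p
  refine eq_of_comp_tdiff_mk hP a ?_
  have hr : MDifferentiableAt (𝓘(ℝ, E_K).prod 𝓘(ℝ, E_G)) 𝓘(ℝ, E_G) (fun z : K × G => z.2 * g) a :=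
    (contMDiff_snd.mul contMDiff_const).mdifferentiable (n := ∞) (by simp) a
  rw [hA.pullback_comp hP (contMDiff_rightLift g) (fun a => rfl) a, ContinuousLinearMap.comp_assoc,
    hA a, wangForm_comp_prodMk (a := (a.1, a.2 * g)) mdifferentiableAt_fst hr rfl rfl,
    wangForm_eq W a]
  have hv : MDifferentiableAt (𝓘(ℝ, E_K).prod 𝓘(ℝ, E_G)) 𝓘(ℝ, E_G)
      (fun z : K × G => a.2⁻¹ * z.2) a :=
    (contMDiff_const.mul contMDiff_snd).mdifferentiable (n := ∞) (by simp) a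
  have h1 := tdiff_conj hv (by simp) g⁻¹
  have h2 : (fun z : K × G => g⁻¹ * (a.2⁻¹ * z.2) * g⁻¹⁻¹) =
      fun z => (a.2 * g)⁻¹ * (z.2 * g) := by
    funext z
    group
  rw [h2] at h1
  simp only
  rw [h1, mul_inv_rev, Ad_mul, ContinuousLinearMap.comp_add, ContinuousLinearMap.comp_assoc]

theorem IsInducedBy.comp_fund
    (hP : Manifold.IsSubmersion (𝓘(ℝ, E_K).prod 𝓘(ℝ, E_G)) 𝓘(ℝ, E_P) ∞ (HomBundle.mk H lam))
    (hA : IsInducedBy W A) (p : HomBundle H lam) :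
    (linMap A p).comp (tdiff 𝓘(ℝ, E_G) 𝓘(ℝ, E_P) (HomBundle.rightAct H lam p) 1) =
      ContinuousLinearMap.id ℝ E_G := by
  obtain ⟨a, rfl⟩ := HomBundle.mk_surjective p
  have hv : MDifferentiableAt 𝓘(ℝ, E_G) 𝓘(ℝ, E_G) (fun g : G => a.2 * g) 1 :=
    mdifferentiable_mul_left a.2 1
  have hu : MDifferentiableAt 𝓘(ℝ, E_G) 𝓘(ℝ, E_K) (fun _ : G => a.1) 1 := mdifferentiableAt_const
  have h1 := tdiff_comp (f := fun g : G => (a.1, a.2 * g))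
    (hP.contMDiff.mdifferentiable (by simp) a) (hu.prodMk hv) (by simp)
  change (linMap A _).comp
    (tdiff 𝓘(ℝ, E_G) 𝓘(ℝ, E_P) (fun g => HomBundle.mk H lam (a.1, a.2 * g)) 1) = _
  rw [h1, ← ContinuousLinearMap.comp_assoc, hA a, wangForm_comp_prodMk hu hv rfl (by simp)]
  simp only [inv_mul_cancel, inv_mul_cancel_left, tdiff_const, tdiff_id,
    ContinuousLinearMap.comp_zero, zero_add]

theorem IsInducedBy.comp_leftAct
    (hP : Manifold.IsSubmersion (𝓘(ℝ, E_K).prod 𝓘(ℝ, E_G)) 𝓘(ℝ, E_P) ∞ (HomBundle.mk H lam))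
    (hA : IsInducedBy W A) :
    (linMap A (HomBundle.mk H lam (1, 1))).comp (tdiff 𝓘(ℝ, E_K) 𝓘(ℝ, E_P)
      (fun k : K => HomBundle.leftAct H lam k (HomBundle.mk H lam (1, 1))) 1) = W := by
  have hu : MDifferentiableAt 𝓘(ℝ, E_K) 𝓘(ℝ, E_K) (fun k : K => k * 1) 1 := by
    simp only [mul_one]
    exact mdifferentiableAt_id
  have hv : MDifferentiableAt 𝓘(ℝ, E_K) 𝓘(ℝ, E_G) (fun _ : K => (1 : G)) 1 :=
    mdifferentiableAt_const
  have h1 := tdiff_comp (f := fun k : K => (k * 1, (1 : G)))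
    (hP.contMDiff.mdifferentiable (by simp) (1, 1)) (hu.prodMk hv) (by simp)
  change (linMap A _).comp
    (tdiff 𝓘(ℝ, E_K) 𝓘(ℝ, E_P) (fun k => HomBundle.mk H lam (k * 1, 1)) 1) = _
  rw [h1, ← ContinuousLinearMap.comp_assoc, hA (1, 1), wangForm_comp_prodMk hu hv (by simp) rfl]
  simp only [inv_one, one_mul, mul_one, tdiff_const, tdiff_id, Ad_one,
    ContinuousLinearMap.comp_id, ContinuousLinearMap.id_comp, add_zero]

/-- Along a smooth local section `(u, v)` of `K × G → P_λ`, the form `A` is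
`Ad_{v⁻¹} W(u⁻¹ du) + v⁻¹ dv`, which is smooth. -/
theorem IsInducedBy.smoothOn [IsManifold 𝓘(ℝ, E_P) ∞ (HomBundle H lam)]
    (hP : Manifold.IsSubmersion (𝓘(ℝ, E_K).prod 𝓘(ℝ, E_G)) 𝓘(ℝ, E_P) ∞ (HomBundle.mk H lam))
    (hA : IsInducedBy W A) : A.SmoothOn Set.univ := by
  intro x₀ y₀ hy₀
  refine ContDiffAt.contDiffWithinAt ?_
  set χ := chartAt E_P x₀
  have hy : y₀ ∈ χ.target := hy₀.1
  have hχ : ContMDiffAt 𝓘(ℝ, E_P) 𝓘(ℝ, E_P) ∞ χ.symm y₀ :=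
    contMDiffOn_chart_symm.contMDiffAt (χ.open_target.mem_nhds hy)
  obtain ⟨a, ha⟩ := HomBundle.mk_surjective (χ.symm y₀)
  obtain ⟨s, hs, hsa, hmk⟩ := exists_local_section (hP.isSubmersionAt a)
  rw [ha] at hs hmk
  have hsχ : ContMDiffAt 𝓘(ℝ, E_P) (𝓘(ℝ, E_K).prod 𝓘(ℝ, E_G)) ∞ (fun y => s (χ.symm y)) y₀ :=
    hs.comp y₀ hχ
  have hu : ContMDiffAt 𝓘(ℝ, E_P) 𝓘(ℝ, E_K) ∞ (fun y => (s (χ.symm y)).1) y₀ := hsχ.fst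
  have hv : ContMDiffAt 𝓘(ℝ, E_P) 𝓘(ℝ, E_G) ∞ (fun y => (s (χ.symm y)).2) y₀ := hsχ.snd
  have hev : ∀ᶠ y in 𝓝 y₀, HomBundle.mk H lam (s (χ.symm y)) = χ.symm y :=
    hχ.continuousAt.eventually hmk
  have hsmooth : ∀ᶠ y in 𝓝 y₀, MDifferentiableAt 𝓘(ℝ, E_P) (𝓘(ℝ, E_K).prod 𝓘(ℝ, E_G))
      (fun y => s (χ.symm y)) y :=
    ((contMDiffAt_iff_contMDiffAt_nhds (n := 1) (by simp)).1 (hsχ.of_le (by simp))).mono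
      fun y hy => hy.mdifferentiableAt (by simp)
  let β : E_P → E_P →L[ℝ] E_G := fun y =>
    (Ad (s (χ.symm y)).2⁻¹ : E_G →L[ℝ] E_G).comp
      (W.comp (tdiff 𝓘(ℝ, E_P) 𝓘(ℝ, E_K) (fun z => (s (χ.symm y)).1⁻¹ * (s (χ.symm z)).1) y)) +
    tdiff 𝓘(ℝ, E_P) 𝓘(ℝ, E_G) (fun z => (s (χ.symm y)).2⁻¹ * (s (χ.symm z)).2) y
  have hβ : ContDiffAt ℝ ∞ β y₀ :=
    ((contDiffAt_Ad_inv hv).clm_comp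
      (contDiffAt_const.clm_comp (contDiffAt_tdiff_inv_mul hu))).add (contDiffAt_tdiff_inv_mul hv)
  let ι : (E_P →L[ℝ] E_G) ≃ₗᵢ[ℝ] E_P [⋀^Fin 1]→L[ℝ] E_G :=
    ContinuousAlternatingMap.ofSubsingletonLIE 0
  have hβ' : ContDiffAt ℝ ∞ (fun y => ι (β y)) y₀ := ι.contDiff.contDiffAt.comp y₀ hβ
  refine hβ'.congr_of_eventuallyEq ?_
  filter_upwards [hev, hev.eventually_nhds, hsmooth, χ.open_target.mem_nhds hy]
    with y hy1 hy2 hy3 hy4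
  have h1 : (linMap A (χ.symm y)).comp (tdiff 𝓘(ℝ, E_P) 𝓘(ℝ, E_P) χ.symm y) = β y := by
    have h2 := tdiff_comp (hP.contMDiff.mdifferentiable (by simp) (s (χ.symm y))) hy3 rfl
    rw [tdiff_congr (I₁ := 𝓘(ℝ, E_P)) (I₂ := 𝓘(ℝ, E_P)) hy2] at h2
    have h3 := hA (s (χ.symm y))
    rw [hy1] at h3
    have h4 := wangForm_comp_prodMk (W := W) (a := s (χ.symm y)) hy3.fst hy3.snd rfl rfl
    calc (linMap A (χ.symm y)).comp (tdiff 𝓘(ℝ, E_P) 𝓘(ℝ, E_P) (fun z => χ.symm z) y)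
        = (wangForm W (s (χ.symm y))).comp (tdiff 𝓘(ℝ, E_P) (𝓘(ℝ, E_K).prod 𝓘(ℝ, E_G))
          (fun z => s (χ.symm z)) y) := by
          rw [h2, ← ContinuousLinearMap.comp_assoc, h3]
      _ = β y := h4
  rw [← h1]
  ext w
  refine congrArg (A (χ.symm y)) (funext fun i => ?_)
  rw [Subsingleton.elim i 0]
  rfl

end InducedForms

/-! ### Existence and uniqueness of the canonical connection -/

section Canonical

variable {E_K E_H E_G E_P : Type*}
  [NormedAddCommGroup E_K] [NormedSpace ℝ E_K]
  [NormedAddCommGroup E_H] [NormedSpace ℝ E_H]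
  [NormedAddCommGroup E_G] [NormedSpace ℝ E_G]
  [NormedAddCommGroup E_P] [NormedSpace ℝ E_P]
  {K G : Type*} [TopologicalSpace K] [ChartedSpace E_K K] [Group K] [LieGroup 𝓘(ℝ, E_K) ∞ K]
  [TopologicalSpace G] [ChartedSpace E_G G] [Group G] [LieGroup 𝓘(ℝ, E_G) ∞ G]
  {H : Subgroup K} [ChartedSpace E_H H] [LieGroup 𝓘(ℝ, E_H) ∞ H]
  {σ : K ≃* K} {lam : H →* G} {W : E_K →L[ℝ] E_G}
  [ChartedSpace E_P (HomBundle H lam)]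
  {A A' : DForm E_P (HomBundle H lam) 1 E_G}

omit [LieGroup 𝓘(ℝ, E_H) ∞ H] in
theorem IsInducedBy.isCanonicalConnection [IsManifold 𝓘(ℝ, E_P) ∞ (HomBundle H lam)]
    (hP : Manifold.IsSubmersion (𝓘(ℝ, E_K).prod 𝓘(ℝ, E_G)) 𝓘(ℝ, E_P) ∞ (HomBundle.mk H lam))
    (hW : IsCanonicalWangMap (E_H := E_H) σ lam W) (hA : IsInducedBy W A) :
    IsCanonicalConnection (E_K := E_K) (E_H := E_H) σ A where
  principal :=
    { smooth := hA.smoothOn hP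
      equivariant := fun g p =>
        form_ext (A' := fun q => (Ad g⁻¹ : E_G →L[ℝ] E_G).compContinuousAlternatingMap (A q))
          (hA.linMap_pullback_rightAct hP g p)
      fund := fun p η => DFunLike.congr_fun (hA.comp_fund hP p) η }
  invariant := hA.pullback_leftAct hP
  wang := ⟨W, hW, fun ξ => DFunLike.congr_fun (hA.comp_leftAct hP) ξ⟩

omit [Group G] in
theorem linMap_comp_tdiff {P : Type*} [TopologicalSpace P] [ChartedSpace E_P P]
    (A : DForm E_P P 1 E_G) {f : P → P} {p q : P} (h : f p = q) :
    (linMap A q).comp (tdiff 𝓘(ℝ, E_P) 𝓘(ℝ, E_P) f p) =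
      linMap (DForm.pullback (E' := E_P) f A) p := by
  subst h
  rfl

omit [LieGroup 𝓘(ℝ, E_K) ∞ K] in
theorem mdifferentiable_rightAct_apply
    (hP : Manifold.IsSubmersion (𝓘(ℝ, E_K).prod 𝓘(ℝ, E_G)) 𝓘(ℝ, E_P) ∞ (HomBundle.mk H lam))
    (p : HomBundle H lam) :
    MDifferentiable 𝓘(ℝ, E_G) 𝓘(ℝ, E_P) (HomBundle.rightAct H lam p) := by
  obtain ⟨a, rfl⟩ := HomBundle.mk_surjective p
  intro g
  have h : MDifferentiableAt 𝓘(ℝ, E_G) (𝓘(ℝ, E_K).prod 𝓘(ℝ, E_G)) (fun g : G => (a.1, a.2 * g)) g :=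
    mdifferentiableAt_const.prodMk (mdifferentiable_mul_left a.2 g)
  exact MDifferentiableAt.comp g (hP.contMDiff.mdifferentiable (by simp) (a.1, a.2 * g)) h

omit [LieGroup 𝓘(ℝ, E_H) ∞ H] in
/-- A canonical connection is induced by the form `wangForm W` on `K × G`: by `K`-invariance and
equivariance it is determined by its values on the two orbit directions at `[e, e]`. -/
theorem IsCanonicalConnection.exists_isInducedBy
    (hP : Manifold.IsSubmersion (𝓘(ℝ, E_K).prod 𝓘(ℝ, E_G)) 𝓘(ℝ, E_P) ∞ (HomBundle.mk H lam))
    (hA : IsCanonicalConnection (E_K := E_K) (E_H := E_H) σ A) :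
    ∃ W : E_K →L[ℝ] E_G, IsCanonicalWangMap (E_H := E_H) σ lam W ∧ IsInducedBy W A := by
  obtain ⟨W, hW, hWA⟩ := hA.wang
  refine ⟨W, hW, fun a => ?_⟩
  have hmk := hP.contMDiff.mdifferentiable (by simp)
  set po := HomBundle.mk H lam (1, 1)
  have hWA' : (linMap A po).comp (tdiff 𝓘(ℝ, E_K) 𝓘(ℝ, E_P)
      (fun k : K => HomBundle.leftAct H lam k po) 1) = W := by
    ext ξ
    exact hWA ξ
  have hfund : ∀ p, (linMap A p).comp (tdiff 𝓘(ℝ, E_G) 𝓘(ℝ, E_P) (HomBundle.rightAct H lam p) 1) =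
      ContinuousLinearMap.id ℝ E_G := fun p => by
    ext η
    exact hA.principal.fund p η
  have hright : linMap (DForm.pullback (E' := E_P) (fun p => HomBundle.rightAct H lam p a.2) A)
      (HomBundle.leftAct H lam a.1 po) = (Ad a.2⁻¹ : E_G →L[ℝ] E_G).comp
        (linMap A (HomBundle.leftAct H lam a.1 po)) := by
    ext v
    exact DFunLike.congr_fun (hA.principal.equivariant a.2 (HomBundle.leftAct H lam a.1 po))
      fun _ => v
  have hu : MDifferentiableAt (𝓘(ℝ, E_K).prod 𝓘(ℝ, E_G)) 𝓘(ℝ, E_K)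
      (fun z : K × G => a.1⁻¹ * z.1) a :=
    (contMDiff_const.mul contMDiff_fst).mdifferentiable (n := ∞) (by simp) a
  have hv : MDifferentiableAt (𝓘(ℝ, E_K).prod 𝓘(ℝ, E_G)) 𝓘(ℝ, E_G)
      (fun z : K × G => a.2⁻¹ * z.2) a :=
    (contMDiff_const.mul contMDiff_snd).mdifferentiable (n := ∞) (by simp) a
  have hsplit : tdiff (𝓘(ℝ, E_K).prod 𝓘(ℝ, E_G)) 𝓘(ℝ, E_P) (HomBundle.mk H lam) a =
      tdiff (𝓘(ℝ, E_K).prod 𝓘(ℝ, E_G)) 𝓘(ℝ, E_P)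
        (fun z : K × G => HomBundle.mk H lam (z.1, a.2)) a +
      tdiff (𝓘(ℝ, E_K).prod 𝓘(ℝ, E_G)) 𝓘(ℝ, E_P)
        (fun z : K × G => HomBundle.mk H lam (a.1, z.2)) a := mfderiv_prod_eq_add (hmk a)
  -- the orbit of `G` through `[k, g]`
  have h2 : tdiff (𝓘(ℝ, E_K).prod 𝓘(ℝ, E_G)) 𝓘(ℝ, E_P)
      (fun z : K × G => HomBundle.mk H lam (a.1, z.2)) a =
      (tdiff 𝓘(ℝ, E_G) 𝓘(ℝ, E_P) (HomBundle.rightAct H lam (HomBundle.mk H lam a)) 1).comp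
        (tdiff (𝓘(ℝ, E_K).prod 𝓘(ℝ, E_G)) 𝓘(ℝ, E_G) (fun z : K × G => a.2⁻¹ * z.2) a) := by
    rw [← tdiff_comp (mdifferentiable_rightAct_apply hP _ 1) hv (by simp)]
    congr 1
    funext z
    change _ = HomBundle.mk H lam (a.1, a.2 * (a.2⁻¹ * z.2))
    rw [mul_inv_cancel_left]
  -- the orbit of `K` through `[k, g]`, moved to `[e, e]`
  have horb : MDifferentiableAt 𝓘(ℝ, E_K) 𝓘(ℝ, E_P)
      (fun k : K => HomBundle.leftAct H lam k po) 1 := by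
    have h : MDifferentiableAt 𝓘(ℝ, E_K) (𝓘(ℝ, E_K).prod 𝓘(ℝ, E_G)) (fun k : K => (k * 1, (1 : G)))
        1 := by
      simp only [mul_one]
      exact mdifferentiableAt_id.prodMk mdifferentiableAt_const
    exact MDifferentiableAt.comp (1 : K) (hmk _) h
  have hone : HomBundle.leftAct H lam 1 po = po := by
    change HomBundle.mk H lam (1 * 1, 1) = po
    rw [mul_one]
  have hR : MDifferentiable 𝓘(ℝ, E_P) 𝓘(ℝ, E_P) (fun p => HomBundle.rightAct H lam p a.2) :=
    (contMDiff_of_lift hP (contMDiff_rightLift a.2) fun _ => rfl).mdifferentiable (by simp)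
  have hL : MDifferentiable 𝓘(ℝ, E_P) 𝓘(ℝ, E_P) (HomBundle.leftAct H lam a.1) :=
    (contMDiff_of_lift hP (contMDiff_leftLift a.1) fun _ => rfl).mdifferentiable (by simp)
  have ha : HomBundle.rightAct H lam (HomBundle.leftAct H lam a.1 po) a.2 =
      HomBundle.mk H lam a := by
    change HomBundle.mk H lam (a.1 * 1, 1 * a.2) = _
    rw [mul_one, one_mul]
  have h1 : tdiff (𝓘(ℝ, E_K).prod 𝓘(ℝ, E_G)) 𝓘(ℝ, E_P)
      (fun z : K × G => HomBundle.mk H lam (z.1, a.2)) a =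
      (tdiff 𝓘(ℝ, E_P) 𝓘(ℝ, E_P) (fun p => HomBundle.rightAct H lam p a.2)
        (HomBundle.leftAct H lam a.1 po)).comp
      ((tdiff 𝓘(ℝ, E_P) 𝓘(ℝ, E_P) (HomBundle.leftAct H lam a.1) po).comp
      ((tdiff 𝓘(ℝ, E_K) 𝓘(ℝ, E_P) (fun k : K => HomBundle.leftAct H lam k po) 1).comp
      (tdiff (𝓘(ℝ, E_K).prod 𝓘(ℝ, E_G)) 𝓘(ℝ, E_K) (fun z : K × G => a.1⁻¹ * z.1) a))) := by
    have e1 := tdiff_comp horb hu (inv_mul_cancel a.1)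
    have d1 : MDifferentiableAt (𝓘(ℝ, E_K).prod 𝓘(ℝ, E_G)) 𝓘(ℝ, E_P)
        (fun z : K × G => HomBundle.leftAct H lam (a.1⁻¹ * z.1) po) a :=
      MDifferentiableAt.comp_of_eq (f := fun z : K × G => a.1⁻¹ * z.1) a horb hu
        (inv_mul_cancel a.1)
    have p1 : HomBundle.leftAct H lam (a.1⁻¹ * a.1) po = po := by rw [inv_mul_cancel, hone]
    have e2 := tdiff_comp (hL po) d1 p1
    have d2 : MDifferentiableAt (𝓘(ℝ, E_K).prod 𝓘(ℝ, E_G)) 𝓘(ℝ, E_P)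
        (fun z : K × G => HomBundle.leftAct H lam a.1
          (HomBundle.leftAct H lam (a.1⁻¹ * z.1) po)) a :=
      MDifferentiableAt.comp_of_eq (f := fun z : K × G => HomBundle.leftAct H lam (a.1⁻¹ * z.1) po)
        a (hL po) d1 p1
    have e3 := tdiff_comp (hR (HomBundle.leftAct H lam a.1 po)) d2 (by rw [p1])
    rw [← e1, ← e2, ← e3]
    congr 1
    funext z
    change _ = HomBundle.mk H lam (a.1 * (a.1⁻¹ * z.1 * 1), 1 * a.2)
    rw [mul_one, one_mul, mul_inv_cancel_left]
  rw [hsplit, ContinuousLinearMap.comp_add, h2, ← ContinuousLinearMap.comp_assoc, hfund,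
    ContinuousLinearMap.id_comp, h1, ← ContinuousLinearMap.comp_assoc,
    linMap_comp_tdiff A (f := fun p => HomBundle.rightAct H lam p a.2) ha,
    hright, ContinuousLinearMap.comp_assoc, ← ContinuousLinearMap.comp_assoc (linMap A _),
    linMap_comp_tdiff A (f := HomBundle.leftAct H lam a.1) rfl, hA.invariant,
    ← ContinuousLinearMap.comp_assoc (linMap A _), hWA', wangForm_eq W a]

theorem existsUnique_isCanonicalConnection [FiniteDimensional ℝ E_K]
    [IsManifold 𝓘(ℝ, E_P) ∞ (HomBundle H lam)]
    (hH : Manifold.IsSmoothEmbedding 𝓘(ℝ, E_H) 𝓘(ℝ, E_K) ∞ (Subtype.val : H → K))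
    (hσ : IsSymmetricSpace (E_K := E_K) H σ) (hlam : ContMDiff 𝓘(ℝ, E_H) 𝓘(ℝ, E_G) ∞ lam)
    (hP : Manifold.IsSubmersion (𝓘(ℝ, E_K).prod 𝓘(ℝ, E_G)) 𝓘(ℝ, E_P) ∞ (HomBundle.mk H lam)) :
    ∃! A : DForm E_P (HomBundle H lam) 1 E_G,
      IsCanonicalConnection (E_K := E_K) (E_H := E_H) σ A := by
  obtain ⟨W, hW⟩ := exists_wangMap (lam := lam) (E_G := E_G) hH hσ
  have hA := canonicalForm_isInducedBy hH hσ hlam hW hP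
  refine ⟨canonicalForm hP W, hA.isCanonicalConnection hP hW, fun A' hA' => ?_⟩
  obtain ⟨W', hW', hA''⟩ := hA'.exists_isInducedBy hP
  rw [← hW.unique hH hσ hW'] at hA''
  exact hA''.ext hP hA

end Canonical

/-! ### The geodesic symmetries and their lifts to `P_λ` -/

section Symmetries

variable {K G : Type*} [Group K] [Group G] {H : Subgroup K} {σ : K ≃* K} {lam : H →* G}

/-- The symmetry `k' H ↦ k σ(k⁻¹ k') H` of `K/H` at the point `k H`. -/
def baseSymm (hσ : ∀ h ∈ H, σ h = h) (k : K) : K ⧸ H → K ⧸ H :=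
  Quotient.map' (fun x => k * σ (k⁻¹ * x)) fun a b hab => by
    rw [QuotientGroup.leftRel_apply] at hab ⊢
    have h : (k * σ (k⁻¹ * a))⁻¹ * (k * σ (k⁻¹ * b)) = a⁻¹ * b := by
      rw [← hσ _ hab]
      simp only [map_mul, map_inv]
      group
    rwa [h]

/-- The lift `[k', g] ↦ [k σ(k⁻¹ k'), g]` to `P_λ` of the symmetry of `K/H` at `k H`. -/
def bundleSymm (hσ : ∀ h ∈ H, σ h = h) (lam : H →* G) (k : K) : HomBundle H lam → HomBundle H lam :=
  Quotient.map (sa := bundleSetoid H lam) (sb := bundleSetoid H lam)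
    (fun a : K × G => (k * σ (k⁻¹ * a.1), a.2)) (by
      rintro a b ⟨h, rfl⟩
      exact ⟨h, by simp [hσ h h.2, mul_assoc]⟩)

theorem baseSymm_smul (hσ : ∀ h ∈ H, σ h = h) (k x : K) (y : K ⧸ H) :
    baseSymm hσ k (x • y) = (k * σ (k⁻¹ * x)) • baseSymm hσ 1 y := by
  obtain ⟨y, rfl⟩ := QuotientGroup.mk_surjective y
  change (QuotientGroup.mk (k * σ (k⁻¹ * (x * y))) : K ⧸ H) =
    QuotientGroup.mk (k * σ (k⁻¹ * x) * (1 * σ (1⁻¹ * y)))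
  simp [mul_assoc]

variable {E_K E_H E_G E_M E_P : Type*}
  [NormedAddCommGroup E_K] [NormedSpace ℝ E_K]
  [NormedAddCommGroup E_H] [NormedSpace ℝ E_H]
  [NormedAddCommGroup E_G] [NormedSpace ℝ E_G]
  [NormedAddCommGroup E_M] [NormedSpace ℝ E_M]
  [NormedAddCommGroup E_P] [NormedSpace ℝ E_P]
  [TopologicalSpace K] [ChartedSpace E_K K] [LieGroup 𝓘(ℝ, E_K) ∞ K]
  [TopologicalSpace G] [ChartedSpace E_G G] [LieGroup 𝓘(ℝ, E_G) ∞ G]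
  [ChartedSpace E_H H] [LieGroup 𝓘(ℝ, E_H) ∞ H]
  [ChartedSpace E_M (K ⧸ H)] [ChartedSpace E_P (HomBundle H lam)]

theorem contMDiff_symmetry (hσ : IsSymmetricSpace (E_K := E_K) H σ) (k : K) :
    ContMDiff 𝓘(ℝ, E_K) 𝓘(ℝ, E_K) ∞ (fun x => k * σ (k⁻¹ * x)) :=
  (contMDiff_mul_left (I := 𝓘(ℝ, E_K)) (n := ∞)).comp
    (hσ.smooth.comp (contMDiff_mul_left (I := 𝓘(ℝ, E_K)) (n := ∞)))

omit [LieGroup 𝓘(ℝ, E_K) ∞ K] in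
theorem contMDiff_quotient_of_lift
    (hM : Manifold.IsSubmersion 𝓘(ℝ, E_K) 𝓘(ℝ, E_M) ∞ (QuotientGroup.mk : K → K ⧸ H))
    {F : K → K} {f : K ⧸ H → K ⧸ H} (hF : ContMDiff 𝓘(ℝ, E_K) 𝓘(ℝ, E_K) ∞ F)
    (hfF : ∀ x : K, f (QuotientGroup.mk x) = QuotientGroup.mk (F x)) :
    ContMDiff 𝓘(ℝ, E_M) 𝓘(ℝ, E_M) ∞ f := by
  refine contMDiff_of_comp_submersion hM QuotientGroup.mk_surjective ?_
  have h : f ∘ (QuotientGroup.mk : K → K ⧸ H) = (QuotientGroup.mk : K → K ⧸ H) ∘ F := funext hfF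
  rw [h]
  exact hM.contMDiff.comp hF

theorem contMDiff_baseSymm (hσ : IsSymmetricSpace (E_K := E_K) H σ)
    (hM : Manifold.IsSubmersion 𝓘(ℝ, E_K) 𝓘(ℝ, E_M) ∞ (QuotientGroup.mk : K → K ⧸ H)) (k : K) :
    ContMDiff 𝓘(ℝ, E_M) 𝓘(ℝ, E_M) ∞ (baseSymm hσ.fixed k) :=
  contMDiff_quotient_of_lift hM (contMDiff_symmetry hσ k) fun _ => rfl

theorem contMDiff_smul_quotient
    (hM : Manifold.IsSubmersion 𝓘(ℝ, E_K) 𝓘(ℝ, E_M) ∞ (QuotientGroup.mk : K → K ⧸ H)) (k : K) :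
    ContMDiff 𝓘(ℝ, E_M) 𝓘(ℝ, E_M) ∞ (fun y : K ⧸ H => k • y) :=
  contMDiff_quotient_of_lift hM (contMDiff_mul_left (I := 𝓘(ℝ, E_K)) (n := ∞) (a := k)) fun _ => rfl

omit [LieGroup 𝓘(ℝ, E_H) ∞ H] in
/-- The symmetry at the base point acts as `-1` on the tangent space, because `T_e σ` is `-1` on `𝔪`
and the differential of the projection `K → K/H` vanishes on `𝔥`. -/
theorem tdiff_baseSymm_one [FiniteDimensional ℝ E_K]
    (hH : Manifold.IsSmoothEmbedding 𝓘(ℝ, E_H) 𝓘(ℝ, E_K) ∞ (Subtype.val : H → K))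
    (hσ : IsSymmetricSpace (E_K := E_K) H σ)
    (hM : Manifold.IsSubmersion 𝓘(ℝ, E_K) 𝓘(ℝ, E_M) ∞ (QuotientGroup.mk : K → K ⧸ H)) (v : E_M) :
    tdiff 𝓘(ℝ, E_M) 𝓘(ℝ, E_M) (baseSymm hσ.fixed 1) ((1 : K) : K ⧸ H) v = -v := by
  have hq := hM.contMDiff.mdifferentiable (by simp)
  have hsurj : Function.Surjective
      (tdiff 𝓘(ℝ, E_K) 𝓘(ℝ, E_M) (QuotientGroup.mk : K → K ⧸ H) 1) :=
    mfderiv_surjective_of_isSubmersionAt (hM.isSubmersionAt 1)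
  obtain ⟨ξ, rfl⟩ := hsurj v
  obtain ⟨ζ, η, rfl, hη⟩ := exists_decomposition hH hσ ξ
  have h1 := tdiff_comp ((contMDiff_baseSymm hσ hM 1).mdifferentiable (by simp) _) (hq 1) rfl
  have h2 := tdiff_comp (hq 1) (hσ.smooth.mdifferentiable (by simp) 1) (map_one σ)
  have h3 : (fun x : K => baseSymm hσ.fixed 1 (x : K ⧸ H)) = fun x => (σ x : K ⧸ H) := by
    funext x
    change (QuotientGroup.mk (1 * σ (1⁻¹ * x)) : K ⧸ H) = _
    simp
  rw [h3, h2] at h1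
  have h4 := tdiff_comp (hq 1) (hH.contMDiff.mdifferentiable (by simp) (1 : H)) rfl
  have h5 : (fun x : H => ((x : K) : K ⧸ H)) = fun _ => ((1 : K) : K ⧸ H) := by
    funext x
    rw [QuotientGroup.eq]
    simp
  rw [h5, tdiff_const] at h4
  have e1 := DFunLike.congr_fun h1
    (tdiff 𝓘(ℝ, E_H) 𝓘(ℝ, E_K) (Subtype.val : H → K) 1 ζ + η)
  have e4 := DFunLike.congr_fun h4 ζ
  simp only [ContinuousLinearMap.comp_apply, zero_apply] at e1 e4
  rw [← e1, map_add, tdiff_involution_val hH hσ, hη, map_add, map_add, ← e4, map_neg, zero_add,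
    zero_add]

end Symmetries

/-! ### Isometry of the symmetries and the Yang–Mills equation -/

section YangMillsEquation

variable {E_K E_H E_G E_M E_P : Type*}
  [NormedAddCommGroup E_K] [NormedSpace ℝ E_K]
  [NormedAddCommGroup E_H] [NormedSpace ℝ E_H]
  [NormedAddCommGroup E_G] [NormedSpace ℝ E_G]
  [NormedAddCommGroup E_M] [NormedSpace ℝ E_M]
  [NormedAddCommGroup E_P] [NormedSpace ℝ E_P]
  {K G : Type*} [TopologicalSpace K] [ChartedSpace E_K K] [Group K] [LieGroup 𝓘(ℝ, E_K) ∞ K]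
  [TopologicalSpace G] [ChartedSpace E_G G] [Group G] [LieGroup 𝓘(ℝ, E_G) ∞ G]
  {H : Subgroup K} [ChartedSpace E_H H]
  {σ : K ≃* K} {lam : H →* G} {W : E_K →L[ℝ] E_G}
  [ChartedSpace E_M (K ⧸ H)] [ChartedSpace E_P (HomBundle H lam)]
  {A : DForm E_P (HomBundle H lam) 1 E_G}

theorem surjective_tdiff_smul
    (hM : Manifold.IsSubmersion 𝓘(ℝ, E_K) 𝓘(ℝ, E_M) ∞ (QuotientGroup.mk : K → K ⧸ H)) (k : K)
    (y : K ⧸ H) :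
    Function.Surjective (tdiff 𝓘(ℝ, E_M) 𝓘(ℝ, E_M) (fun y : K ⧸ H => k • y) y) := by
  intro v
  have h := tdiff_comp (x := k • y) (y := y) (f := fun y : K ⧸ H => k⁻¹ • y)
    ((contMDiff_smul_quotient hM k).mdifferentiable (by simp) y)
    ((contMDiff_smul_quotient hM k⁻¹).mdifferentiable (by simp) _) (inv_smul_smul k y)
  simp only [smul_inv_smul, tdiff_id] at h
  exact ⟨_, (DFunLike.congr_fun h v).symm⟩

/-- The symmetry at `k H` is conjugate to the symmetry at `H`, up to the action of `K`. -/
theorem tdiff_baseSymm [FiniteDimensional ℝ E_K]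
    (hH : Manifold.IsSmoothEmbedding 𝓘(ℝ, E_H) 𝓘(ℝ, E_K) ∞ (Subtype.val : H → K))
    (hσ : IsSymmetricSpace (E_K := E_K) H σ)
    (hM : Manifold.IsSubmersion 𝓘(ℝ, E_K) 𝓘(ℝ, E_M) ∞ (QuotientGroup.mk : K → K ⧸ H)) (k x : K)
    (v : E_M) :
    tdiff 𝓘(ℝ, E_M) 𝓘(ℝ, E_M) (baseSymm hσ.fixed k) (x • ((1 : K) : K ⧸ H))
        (tdiff 𝓘(ℝ, E_M) 𝓘(ℝ, E_M) (fun y : K ⧸ H => x • y) ((1 : K) : K ⧸ H) v) =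
      -tdiff 𝓘(ℝ, E_M) 𝓘(ℝ, E_M) (fun y : K ⧸ H => (k * σ (k⁻¹ * x)) • y) ((1 : K) : K ⧸ H) v := by
  have hL := fun x : K => (contMDiff_smul_quotient hM x).mdifferentiable (n := ∞) (by simp)
  have hS := fun k : K => (contMDiff_baseSymm hσ hM k).mdifferentiable (n := ∞) (by simp)
  have h1 := tdiff_comp (hS k (x • ((1 : K) : K ⧸ H))) (hL x ((1 : K) : K ⧸ H)) rfl
  have hone : baseSymm hσ.fixed 1 ((1 : K) : K ⧸ H) = ((1 : K) : K ⧸ H) := by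
    change (QuotientGroup.mk (1 * σ (1⁻¹ * 1)) : K ⧸ H) = _
    simp
  have h2 := tdiff_comp (hL (k * σ (k⁻¹ * x)) ((1 : K) : K ⧸ H)) (hS 1 ((1 : K) : K ⧸ H)) hone
  simp only [baseSymm_smul hσ.fixed] at h1
  rw [h2] at h1
  have h3 := DFunLike.congr_fun h1 v
  simp only [ContinuousLinearMap.comp_apply] at h3
  rw [← h3, tdiff_baseSymm_one hH hσ hM, map_neg]

omit [TopologicalSpace K] in
theorem smul_mk_one (x : K) : x • ((1 : K) : K ⧸ H) = (x : K ⧸ H) := by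
  change (QuotientGroup.mk (x * 1) : K ⧸ H) = _
  rw [mul_one]

/-- The symmetries of `K/H` are isometries of every invariant metric. -/
theorem baseSymm_isometry [FiniteDimensional ℝ E_K] [IsManifold 𝓘(ℝ, E_M) ∞ (K ⧸ H)]
    (hH : Manifold.IsSmoothEmbedding 𝓘(ℝ, E_H) 𝓘(ℝ, E_K) ∞ (Subtype.val : H → K))
    (hσ : IsSymmetricSpace (E_K := E_K) H σ)
    (hM : Manifold.IsSubmersion 𝓘(ℝ, E_K) 𝓘(ℝ, E_M) ∞ (QuotientGroup.mk : K → K ⧸ H))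
    {g : Metric E_M (K ⧸ H)} (hg : IsInvariantMetric g) (k : K) (y : K ⧸ H)
    (v w : TangentSpace 𝓘(ℝ, E_M) y) :
    g.inner (baseSymm hσ.fixed k y)
        (mfderiv 𝓘(ℝ, E_M) 𝓘(ℝ, E_M) (baseSymm hσ.fixed k) y v)
        (mfderiv 𝓘(ℝ, E_M) 𝓘(ℝ, E_M) (baseSymm hσ.fixed k) y w) = g.inner y v w := by
  let γ : K ⧸ H → E_M →L[ℝ] E_M →L[ℝ] ℝ := fun y => g.inner y
  have hγ : ∀ (k : K) (y : K ⧸ H) (v w : E_M), γ (k • y)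
      (tdiff 𝓘(ℝ, E_M) 𝓘(ℝ, E_M) (fun y : K ⧸ H => k • y) y v)
      (tdiff 𝓘(ℝ, E_M) 𝓘(ℝ, E_M) (fun y : K ⧸ H => k • y) y w) = γ y v w := hg
  change γ (baseSymm hσ.fixed k y) (tdiff 𝓘(ℝ, E_M) 𝓘(ℝ, E_M) (baseSymm hσ.fixed k) y v)
    (tdiff 𝓘(ℝ, E_M) 𝓘(ℝ, E_M) (baseSymm hσ.fixed k) y w) = γ y v w
  obtain ⟨x, rfl⟩ := QuotientGroup.mk_surjective y
  revert v w
  change ∀ v w : E_M, _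
  rw [← smul_mk_one x]
  intro v w
  obtain ⟨v, rfl⟩ := surjective_tdiff_smul hM x ((1 : K) : K ⧸ H) v
  obtain ⟨w, rfl⟩ := surjective_tdiff_smul hM x ((1 : K) : K ⧸ H) w
  have hone : baseSymm hσ.fixed 1 ((1 : K) : K ⧸ H) = ((1 : K) : K ⧸ H) := by
    change (QuotientGroup.mk (1 * σ (1⁻¹ * 1)) : K ⧸ H) = _
    simp
  rw [tdiff_baseSymm hH hσ hM, tdiff_baseSymm hH hσ hM, baseSymm_smul, hone, map_neg, map_neg,
    neg_apply, neg_neg, hγ, hγ]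

/-- The lifted symmetries preserve the connection: on `K × G` they change `W` to `W ∘ T_e σ`, which
is `W`. -/
theorem isSymmetry_bundleSymm [FiniteDimensional ℝ E_K]
    (hH : Manifold.IsSmoothEmbedding 𝓘(ℝ, E_H) 𝓘(ℝ, E_K) ∞ (Subtype.val : H → K))
    (hσ : IsSymmetricSpace (E_K := E_K) H σ)
    (hM : Manifold.IsSubmersion 𝓘(ℝ, E_K) 𝓘(ℝ, E_M) ∞ (QuotientGroup.mk : K → K ⧸ H))
    (hP : Manifold.IsSubmersion (𝓘(ℝ, E_K).prod 𝓘(ℝ, E_G)) 𝓘(ℝ, E_P) ∞ (HomBundle.mk H lam))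
    (hW : IsCanonicalWangMap (E_H := E_H) σ lam W) (hA : IsInducedBy W A) (k : K) :
    IsSymmetry (E_M := E_M) (HomBundle.proj H lam) (HomBundle.rightAct H lam) A
      (bundleSymm hσ.fixed lam k) (baseSymm hσ.fixed k) := by
  have hF : ContMDiff (𝓘(ℝ, E_K).prod 𝓘(ℝ, E_G)) (𝓘(ℝ, E_K).prod 𝓘(ℝ, E_G)) ∞
      (fun a : K × G => (k * σ (k⁻¹ * a.1), a.2)) :=
    ((contMDiff_symmetry hσ k).comp contMDiff_fst).prodMk contMDiff_snd
  have hinvol : ∀ x : K, k * σ (k⁻¹ * (k * σ (k⁻¹ * x))) = x := fun x => by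
    rw [inv_mul_cancel_left, hσ.involutive, mul_inv_cancel_left]
  refine ⟨contMDiff_of_lift hP hF fun _ => rfl, contMDiff_baseSymm hσ hM k, ?_, ?_, ?_, ?_, ?_⟩
  · intro p
    obtain ⟨a, rfl⟩ := HomBundle.mk_surjective p
    change HomBundle.mk H lam (k * σ (k⁻¹ * (k * σ (k⁻¹ * a.1))), a.2) = _
    rw [hinvol]
  · intro y
    obtain ⟨x, rfl⟩ := QuotientGroup.mk_surjective y
    change (QuotientGroup.mk (k * σ (k⁻¹ * (k * σ (k⁻¹ * x)))) : K ⧸ H) = _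
    rw [hinvol]
  · intro p
    obtain ⟨a, rfl⟩ := HomBundle.mk_surjective p
    rfl
  · intro p g
    obtain ⟨a, rfl⟩ := HomBundle.mk_surjective p
    rfl
  · refine hA.pullback_eq hP hF (fun _ => rfl) fun a => ?_
    have hu : MDifferentiableAt (𝓘(ℝ, E_K).prod 𝓘(ℝ, E_G)) 𝓘(ℝ, E_K)
        (fun z : K × G => k * σ (k⁻¹ * z.1)) a :=
      ((contMDiff_symmetry hσ k).comp contMDiff_fst).mdifferentiable (n := ∞) (by simp) a
    have hw : MDifferentiableAt (𝓘(ℝ, E_K).prod 𝓘(ℝ, E_G)) 𝓘(ℝ, E_K)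
        (fun z : K × G => a.1⁻¹ * z.1) a :=
      (contMDiff_const.mul contMDiff_fst).mdifferentiable (n := ∞) (by simp) a
    have h1 := tdiff_comp (hσ.smooth.mdifferentiable (by simp) 1) hw (inv_mul_cancel a.1)
    have h2 : (fun z : K × G => (k * σ (k⁻¹ * a.1))⁻¹ * (k * σ (k⁻¹ * z.1))) =
        fun z => σ (a.1⁻¹ * z.1) := by
      funext z
      simp only [map_mul, map_inv]
      group
    rw [wangForm_comp_prodMk (a := (k * σ (k⁻¹ * a.1), a.2)) hu mdifferentiableAt_snd rfl rfl,
      wangForm_eq W a]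
    simp only [h2]
    rw [h1, ← ContinuousLinearMap.comp_assoc W, hW.comp_involution hH hσ]

omit [LieGroup 𝓘(ℝ, E_K) ∞ K] [LieGroup 𝓘(ℝ, E_G) ∞ G] in
theorem contMDiff_proj
    (hM : Manifold.IsSubmersion 𝓘(ℝ, E_K) 𝓘(ℝ, E_M) ∞ (QuotientGroup.mk : K → K ⧸ H))
    (hP : Manifold.IsSubmersion (𝓘(ℝ, E_K).prod 𝓘(ℝ, E_G)) 𝓘(ℝ, E_P) ∞ (HomBundle.mk H lam)) :
    ContMDiff 𝓘(ℝ, E_P) 𝓘(ℝ, E_M) ∞ (HomBundle.proj H lam) :=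
  contMDiff_of_comp_submersion hP HomBundle.mk_surjective
    (hM.contMDiff.comp (contMDiff_fst (I := 𝓘(ℝ, E_K)) (J := 𝓘(ℝ, E_G)) (M := K) (N := G)))

/-- Every point of `P_λ` has the form `[k, g]` and is fixed by the lift of the symmetry at `k H`. -/
theorem IsInducedBy.isYangMills [FiniteDimensional ℝ E_K] [FiniteDimensional ℝ E_M]
    [IsManifold 𝓘(ℝ, E_M) ∞ (K ⧸ H)] [IsManifold 𝓘(ℝ, E_P) ∞ (HomBundle H lam)]
    (hH : Manifold.IsSmoothEmbedding 𝓘(ℝ, E_H) 𝓘(ℝ, E_K) ∞ (Subtype.val : H → K))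
    (hσ : IsSymmetricSpace (E_K := E_K) H σ)
    (hM : Manifold.IsSubmersion 𝓘(ℝ, E_K) 𝓘(ℝ, E_M) ∞ (QuotientGroup.mk : K → K ⧸ H))
    (hP : Manifold.IsSubmersion (𝓘(ℝ, E_K).prod 𝓘(ℝ, E_G)) 𝓘(ℝ, E_P) ∞ (HomBundle.mk H lam))
    (hW : IsCanonicalWangMap (E_H := E_H) σ lam W) (hA : IsInducedBy W A)
    {g : Metric E_M (K ⧸ H)} (hg : IsInvariantMetric g) :
    IsYangMills (HomBundle.proj H lam) (HomBundle.rightAct H lam) g A := by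
  intro U μ hU hμ p hp
  obtain ⟨⟨k, a⟩, rfl⟩ := HomBundle.mk_surjective p
  refine codiff_curvature_eq_zero (isSymmetry_bundleSymm hH hσ hM hP hW hA k)
    (contMDiff_proj hM hP) ?_ (fun p => mdifferentiable_rightAct_apply hP p 1) g
    (baseSymm_isometry hH hσ hM hg k) ?_ ?_ hU hμ hp
  · intro p
    obtain ⟨b, rfl⟩ := HomBundle.mk_surjective p
    change HomBundle.mk H lam (b.1, b.2 * 1) = _
    rw [mul_one]
  · change HomBundle.mk H lam (k * σ (k⁻¹ * k), a) = _
    simp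
  · change ∀ v : E_M, tdiff 𝓘(ℝ, E_M) 𝓘(ℝ, E_M) (baseSymm hσ.fixed k) (k : K ⧸ H) v = -v
    rw [← smul_mk_one k]
    intro v
    obtain ⟨v, rfl⟩ := surjective_tdiff_smul hM k ((1 : K) : K ⧸ H) v
    rw [tdiff_baseSymm hH hσ hM]
    simp

end YangMillsEquation

end YangMills

end

theorem mainTheorem2
    {E_K E_H E_G E_M E_P : Type*}
    [NormedAddCommGroup E_K] [NormedSpace ℝ E_K] [FiniteDimensional ℝ E_K]
    [NormedAddCommGroup E_H] [NormedSpace ℝ E_H] [FiniteDimensional ℝ E_H]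
    [NormedAddCommGroup E_G] [NormedSpace ℝ E_G] [FiniteDimensional ℝ E_G]
    [NormedAddCommGroup E_M] [NormedSpace ℝ E_M] [FiniteDimensional ℝ E_M]
    [NormedAddCommGroup E_P] [NormedSpace ℝ E_P] [FiniteDimensional ℝ E_P]
    -- Lie groups `K` and `G`
    {K G : Type*} [TopologicalSpace K] [ChartedSpace E_K K] [Group K] [LieGroup 𝓘(ℝ, E_K) ∞ K]
    [TopologicalSpace G] [ChartedSpace E_G G] [Group G] [LieGroup 𝓘(ℝ, E_G) ∞ G]
    -- a Lie subgroup `H` of `K` such that `(K, H, σ)` is a symmetric space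
    (H : Subgroup K) [ChartedSpace E_H H] [LieGroup 𝓘(ℝ, E_H) ∞ H]
    (hH : Manifold.IsSmoothEmbedding 𝓘(ℝ, E_H) 𝓘(ℝ, E_K) ∞ (Subtype.val : H → K))
    (σ : K ≃* K) (hσ : YangMills.IsSymmetricSpace (E_K := E_K) H σ)
    -- a homomorphism of Lie groups `λ : H → G`
    (lam : H →* G) (hlam : ContMDiff 𝓘(ℝ, E_H) 𝓘(ℝ, E_G) ∞ lam)
    -- the manifold structures of the quotients `K/H` and `P_λ = K ×_H G`: the unique ones for which
    -- the quotient maps are submersions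
    [ChartedSpace E_M (K ⧸ H)] [IsManifold 𝓘(ℝ, E_M) ∞ (K ⧸ H)]
    (hM : Manifold.IsSubmersion 𝓘(ℝ, E_K) 𝓘(ℝ, E_M) ∞ (QuotientGroup.mk : K → K ⧸ H))
    [ChartedSpace E_P (YangMills.HomBundle H lam)]
    [IsManifold 𝓘(ℝ, E_P) ∞ (YangMills.HomBundle H lam)]
    (hP : Manifold.IsSubmersion (𝓘(ℝ, E_K).prod 𝓘(ℝ, E_G)) 𝓘(ℝ, E_P) ∞ (YangMills.HomBundle.mk H lam))
    -- a `K`-invariant Riemannian metric on `K/H`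
    (g : YangMills.Metric E_M (K ⧸ H)) (hg : YangMills.IsInvariantMetric g) :
    (∃! A : YangMills.DForm E_P (YangMills.HomBundle H lam) 1 E_G,
      YangMills.IsCanonicalConnection (E_K := E_K) (E_H := E_H) σ A) ∧
    ∀ A : YangMills.DForm E_P (YangMills.HomBundle H lam) 1 E_G,
      YangMills.IsCanonicalConnection (E_K := E_K) (E_H := E_H) σ A →
      YangMills.IsYangMills (YangMills.HomBundle.proj H lam) (YangMills.HomBundle.rightAct H lam)
        g A := by
  refine ⟨YangMills.existsUnique_isCanonicalConnection hH hσ hlam hP, fun A hA => ?_⟩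
  obtain ⟨W, hW, hWA⟩ := hA.exists_isInducedBy hP
  exact hWA.isYangMills hH hσ hM hP hW hg
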